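/- Let $\zeta$ be the Riemann zeta function and let $Z(t)=e^{i\theta(t)}\zeta(\tfrac12+it)$ be Hardy's function, where $\theta(t)=\arg\bigl(\pi^{-it/2}\,\Gamma(\tfrac14+\tfrac{it}{2})\bigr)$, the argument being defined by continuous variation of $t\in\mathbb{R}$ starting with the value $0$ at $t=0$. For integers $k\ge 0$ and $t>0$ define $R_k(t)$ by $$Z^{(k)}(t)=2\sum_{1\le n\le\sqrt{t/2\pi}}\frac{1}{\sqrt n}\,\bigl(\theta'(t)-\log n\bigr)^k\cos\Bigl(\theta(t)-t\log n+k\frac{\pi}{2}\Bigr)+R_k(t).$$ (1) For every constant $c>1$ there are constants $C$ and $T>0$, depending only on $c$, such that for all $t\ge T$ and all integers $k\ge 0$ with $\theta'(t)\le k\le 3\,\theta'(t)^2$, $$|R_k(t)|\le C\left(t^{-1/2}\,c^{k/\theta'(t)}\,\theta'(t)^k+t^{-3/4}\,e^{k/(2\theta'(t))}\,k\,\theta'(t)^{k-1}\right).$$ (2) Consequently, for every constant $c'<3$, $R_k(t)=o(\theta'(t)^k)$ as $t\to\infty$, uniformly for integers $0\le k\le c'\,\theta'(t)^2$; that is, for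 every $\varepsilon>0$ there is $T$ such that $|R_k(t)|\le\varepsilon\,\theta'(t)^k$ for all $t\ge T$ and all integers $k$ with $0\le k\le c'\,\theta'(t)^2$. -/

import Mathlib

/-- The nowhere vanishing curve `t ↦ π^{-it/2} Γ(1/4 + it/2)`. -/
noncomputable def gammaCurve (t : ℝ) : ℂ :=
  (Real.pi : ℂ) ^ (-(Complex.I * (t / 2))) * Complex.Gamma (1 / 4 + Complex.I * (t / 2))

theorem gammaCurve_ne_zero (t : ℝ) : gammaCurve t ≠ 0 := by
  refine mul_ne_zero ?_ (Complex.Gamma_ne_zero_of_re_pos ?_)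
  · simp [Complex.cpow_eq_zero_iff, Real.pi_ne_zero]
  · simp

theorem continuous_gammaCurve : Continuous gammaCurve := by
  refine Continuous.mul ?_ ?_
  · refine Continuous.const_cpow (by fun_prop) (Or.inl ?_)
    exact_mod_cast Real.pi_ne_zero
  · refine continuous_iff_continuousAt.2 fun t => ?_
    refine ContinuousAt.comp (g := Complex.Gamma)
      (f := fun t : ℝ => (1 / 4 + Complex.I * (t / 2) : ℂ)) ?_ (by fun_prop)
    refine (Complex.differentiableAt_Gamma _ fun m h => ?_).continuousAt
    have h1 := congrArg Complex.re h
    have h2 : (0 : ℝ) ≤ (m : ℝ) := m.cast_nonneg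
    simp at h1
    linarith

/-- `φ` is the argument of `gammaCurve`, determined by continuous variation of `t`, with the
value `0` at `t = 0`. -/
def IsContinuousArg (φ : ℝ → ℝ) : Prop :=
  Continuous φ ∧ φ 0 = 0 ∧
    ∀ t : ℝ, gammaCurve t = ‖gammaCurve t‖ * Complex.exp (Complex.I * φ t)

/-- There is exactly one such argument. -/
theorem existsUnique_isContinuousArg : ∃! φ : ℝ → ℝ, IsContinuousArg φ := by
  have hn : ∀ t, (‖gammaCurve t‖ : ℂ) ≠ 0 := fun t => by
    simpa using gammaCurve_ne_zero t
  have hmem : ∀ t, gammaCurve t / ‖gammaCurve t‖ ∈ Submonoid.unitSphere ℂ := fun t => by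
    refine mem_sphere_zero_iff_norm.2 ?_
    rw [norm_div, Complex.norm_real, norm_norm]
    exact div_self (norm_ne_zero_iff.2 (gammaCurve_ne_zero t))
  let f : C(ℝ, Circle) :=
    ⟨fun t => ⟨gammaCurve t / ‖gammaCurve t‖, hmem t⟩,
      Continuous.subtype_mk (continuous_gammaCurve.div
        (Complex.continuous_ofReal.comp continuous_gammaCurve.norm) hn) hmem⟩
  have hfv : ∀ t, ((f t : Circle) : ℂ) = gammaCurve t / ‖gammaCurve t‖ := fun t => rfl
  have hlift : ∀ φ : ℝ → ℝ, (Circle.exp ∘ φ = f) ↔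
      ∀ t : ℝ, gammaCurve t = ‖gammaCurve t‖ * Complex.exp (Complex.I * φ t) := by
    intro φ
    rw [funext_iff]
    refine forall_congr' fun t => ?_
    rw [Function.comp_apply, Circle.ext_iff, hfv, Circle.coe_exp, eq_div_iff (hn t), mul_comm,
      mul_comm (φ t : ℂ), eq_comm]
  have h0 : Circle.exp 0 = f 0 := by
    rw [Circle.exp_zero, Circle.ext_iff, hfv, Circle.coe_one]
    have h : gammaCurve 0 = ((Real.Gamma (1 / 4) : ℝ) : ℂ) := by
      simp [gammaCurve, ← Complex.Gamma_ofReal]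
    have hp : 0 < Real.Gamma (1 / 4) := Real.Gamma_pos_of_pos (by norm_num)
    rw [h, Complex.norm_real, Real.norm_of_nonneg hp.le, div_self]
    exact_mod_cast hp.ne'
  obtain ⟨F, ⟨hF0, hF⟩, hu⟩ :=
    Circle.isCoveringMap_exp.existsUnique_continuousMap_lifts f 0 0 h0
  refine ⟨F, ⟨F.continuous, hF0, (hlift F).1 hF⟩, fun φ hφ => ?_⟩
  have := hu ⟨φ, hφ.1⟩ ⟨hφ.2.1, (hlift φ).2 hφ.2.2⟩
  exact congrArg DFunLike.coe this

/-- `θ(t) = arg (π^{-it/2} Γ(1/4 + it/2))`, the argument being defined by continuous variation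
of `t` starting with the value `0` at `t = 0`. -/
noncomputable def rsTheta : ℝ → ℝ :=
  Classical.choose existsUnique_isContinuousArg.exists

theorem rsTheta_spec : IsContinuousArg rsTheta :=
  Classical.choose_spec existsUnique_isContinuousArg.exists

/-- Hardy's function `Z(t) = e^{iθ(t)} ζ(1/2 + it)` (its values happen to be real). -/
noncomputable def hardyZ (t : ℝ) : ℂ :=
  Complex.exp (Complex.I * rsTheta t) * riemannZeta (1 / 2 + Complex.I * t)

/-- The main term of the approximate functional equation for `Z^{(k)}(t)`; the sum is over the
integers `1 ≤ n ≤ √(t / 2π)`. -/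
noncomputable def afeMain (k : ℕ) (t : ℝ) : ℝ :=
  2 * ∑ n ∈ Finset.Icc 1 ⌊Real.sqrt (t / (2 * Real.pi))⌋₊,
    1 / Real.sqrt n * (deriv rsTheta t - Real.log n) ^ k *
      Real.cos (rsTheta t - t * Real.log n + k * (Real.pi / 2))

/-- The error term `R_k(t)`, that is `Z^{(k)}(t)` minus the main term. -/
noncomputable def afeError (k : ℕ) (t : ℝ) : ℂ :=
  iteratedDeriv k hardyZ t - (afeMain k t : ℂ)

open Filter Topology MeasureTheory

/-! Write L = θ'(t), A = √(t/2π), N = ⌊A⌋. Hardy's function and θ extend holomorphically to Re z > 0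
as `hardyC` and `rsThetaC`. There `hardyC` is compared with `afeSum`, the sum over n ≤ N of
exp(±iθ(z)) n^{-1/2∓iz}, and `afeSum` with `linSum`, where θ is replaced by its tangent at t. The
k-th derivative of `linSum` at t is exactly the main term (`iteratedDeriv_linSum`), so R_k(t) is the
k-th derivative at t of (`hardyC` - `afeSum`) + (`afeSum` - `linSum`) (`afeError_eq`). Each
difference is bounded by Cauchy's estimate on a circle about t whose radius r depends on k.

Truncation error. On |z - t| ≤ r ≤ √t the crude bound O(t² 2^r) holds
(`norm_hardyC_sub_afeSum_le_mul_two_rpow`). For k ≥ L/8 this suffices: with r = βk/L, β a large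
constant, k!/r^k is about L^k (eβ)^{-k}, and since L is of order log t the factor β^{-k} beats the
power of t. For k ≤ L/8 there is no such gain, and a genuine approximate functional equation is
needed on a disc of radius 1/8, with error O(A^{-1/4}) (`norm_hardyC_sub_afeSum_le`). It is proved
by writing the completed zeta function as a sum of incomplete Gamma integrals along a ray close to
the imaginary axis (`completedRiemannZeta_eq_gaussUpper`). The n-th integral passes from nearly
complete to nearly empty as n crosses A, and a first derivative test bounds the discrepancy.

Linearization error. Since θ'' = O(1/t) and every frequency L - log n is at most L in modulus,
`afeSum` - `linSum` is O(t^{-3/4} e^{Lr} r²) (`norm_afeSum_sub_linSum_le`). For k ≥ L the choice r =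
k/L makes e^{Lr} = e^k cancel against Stirling's e^{-k} in k!; for k ≤ L the choice r = 1 is enough.

Together: R_k(t) = O(t^{-1/2} L^k) for L ≤ k ≤ 3L² (`norm_afeError_le`), which is stronger than (1)
because c^{k/L} ≥ 1, and R_k(t) = o(L^k) uniformly for k ≤ 3L² (`norm_afeError_le_of_small`), which
gives (2). -/

/-! ### The logarithm of Γ, its second derivative and its increments -/

/-- The general term of the series for `log Γ`. -/
noncomputable def logGammaTerm (n : ℕ) (w : ℂ) : ℂ :=
  w * (Real.log (1 + 1 / ((n : ℝ) + 1)) : ℝ) - Complex.log (1 + w / ((n : ℂ) + 1))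

/-- Partial sums of the series for `log Γ`. -/
noncomputable def logGammaPartial (m : ℕ) (w : ℂ) : ℂ :=
  -Complex.log w + ∑ n ∈ Finset.range m, logGammaTerm n w

/-- The holomorphic branch of `log Γ` on the slit plane which is real on the positive axis. -/
noncomputable def logGamma (w : ℂ) : ℂ :=
  -Complex.log w + ∑' n : ℕ, logGammaTerm n w

theorem one_add_div_mem_slitPlane {w : ℂ} (hw : w ∈ Complex.slitPlane) (n : ℕ) :
    1 + w / ((n : ℂ) + 1) ∈ Complex.slitPlane := by
  have hn : (0 : ℝ) < (n : ℝ) + 1 := by positivity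
  have h : w / ((n : ℂ) + 1) = ((((n : ℝ) + 1)⁻¹ : ℝ) : ℂ) * w := by
    push_cast; rw [div_eq_mul_inv, mul_comm]
  rw [Complex.mem_slitPlane_iff] at hw ⊢
  rw [h]
  rcases hw with hw | hw
  · left
    simp only [Complex.add_re, Complex.one_re, Complex.re_ofReal_mul]
    positivity
  · right
    simp only [Complex.add_im, Complex.one_im, Complex.im_ofReal_mul, zero_add]
    exact mul_ne_zero (by positivity) hw

theorem add_nat_ne_zero_of_mem_slitPlane {w : ℂ} (hw : w ∈ Complex.slitPlane) (n : ℕ) :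
    w + n ≠ 0 := by
  intro h
  have h1 : w = -(n : ℂ) := by linear_combination h
  rw [Complex.mem_slitPlane_iff, h1] at hw
  have : (0 : ℝ) ≤ n := n.cast_nonneg
  simp at hw
  linarith

theorem hasDerivAt_logGammaTerm {w : ℂ} (hw : w ∈ Complex.slitPlane) (n : ℕ) :
    HasDerivAt (logGammaTerm n)
      ((Real.log (1 + 1 / ((n : ℝ) + 1)) : ℝ) - 1 / (w + (n + 1 : ℕ))) w := by
  have h1 := one_add_div_mem_slitPlane hw n
  have h3 : w + ((n + 1 : ℕ) : ℂ) ≠ 0 := add_nat_ne_zero_of_mem_slitPlane hw (n + 1)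
  have hn : ((n : ℂ) + 1) ≠ 0 := by exact_mod_cast n.succ_ne_zero
  have h2 : HasDerivAt (fun w : ℂ => 1 + w / ((n : ℂ) + 1)) (1 / ((n : ℂ) + 1)) w := by
    simpa using ((hasDerivAt_id w).div_const ((n : ℂ) + 1)).const_add 1
  have h4 := ((hasDerivAt_id w).mul_const
    ((Real.log (1 + 1 / ((n : ℝ) + 1)) : ℝ) : ℂ)).sub (h2.clog h1)
  have h5 : 1 + w / ((n : ℂ) + 1) = (w + (n + 1 : ℕ)) / ((n : ℂ) + 1) := by
    push_cast; field_simp; ring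
  refine h4.congr_deriv ?_
  rw [h5]
  push_cast at h3 ⊢
  field_simp

/-- The linear parts w/(n+1) of the two logarithms cancel, and each remainder is quadratic in
1/(n+1). -/
theorem norm_logGammaTerm_le {w : ℂ} {R : ℝ} {n : ℕ} (hR : 1 ≤ R) (hw : ‖w‖ ≤ R)
    (hn : 2 * R ≤ n) : ‖logGammaTerm n w‖ ≤ (2 * R ^ 2) * (1 / ((n : ℝ) + 1) ^ 2) := by
  have hn0 : (0 : ℝ) < (n : ℝ) + 1 := by positivity
  have key : ∀ z : ℂ, ‖z‖ ≤ 1 / 2 → ‖Complex.log (1 + z) - z‖ ≤ ‖z‖ ^ 2 := by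
    intro z hz
    refine (Complex.norm_log_one_add_sub_self_le (by linarith)).trans ?_
    have : (1 - ‖z‖)⁻¹ ≤ 2 := by
      rw [inv_le_comm₀ (by linarith) two_pos]; linarith
    nlinarith [sq_nonneg ‖z‖]
  have e1 : ‖w / ((n : ℂ) + 1)‖ = ‖w‖ / ((n : ℝ) + 1) := by
    rw [norm_div]; congr 1
    have : ((n : ℂ) + 1) = (((n : ℝ) + 1 : ℝ) : ℂ) := by push_cast; rfl
    rw [this, Complex.norm_real, Real.norm_of_nonneg hn0.le]
  have e2 : ‖(1 : ℂ) / ((n : ℂ) + 1)‖ = 1 / ((n : ℝ) + 1) := by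
    rw [norm_div, norm_one]; congr 1
    have : ((n : ℂ) + 1) = (((n : ℝ) + 1 : ℝ) : ℂ) := by push_cast; rfl
    rw [this, Complex.norm_real, Real.norm_of_nonneg hn0.le]
  have b1 : ‖w / ((n : ℂ) + 1)‖ ≤ 1 / 2 := by
    rw [e1, div_le_iff₀ hn0]; linarith
  have b2 : ‖(1 : ℂ) / ((n : ℂ) + 1)‖ ≤ 1 / 2 := by
    rw [e2, div_le_iff₀ hn0]; linarith
  have e3 : ((Real.log (1 + 1 / ((n : ℝ) + 1)) : ℝ) : ℂ) =
      Complex.log (1 + 1 / ((n : ℂ) + 1)) := by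
    rw [Complex.ofReal_log (by positivity)]; push_cast; rfl
  have e4 : logGammaTerm n w = w * (Complex.log (1 + 1 / ((n : ℂ) + 1)) - 1 / ((n : ℂ) + 1)) -
      (Complex.log (1 + w / ((n : ℂ) + 1)) - w / ((n : ℂ) + 1)) := by
    rw [logGammaTerm, e3]; ring
  rw [e4]
  refine (norm_sub_le _ _).trans ?_
  rw [norm_mul]
  have c1 := key _ b1
  have c2 := key _ b2
  rw [e1, div_pow] at c1
  rw [e2, div_pow, one_pow] at c2
  have hp : 0 ≤ 1 / ((n : ℝ) + 1) ^ 2 := by positivity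
  have d1 : ‖w‖ * ‖Complex.log (1 + 1 / ((n : ℂ) + 1)) - 1 / ((n : ℂ) + 1)‖ ≤
      R ^ 2 * (1 / ((n : ℝ) + 1) ^ 2) :=
    mul_le_mul (by nlinarith) c2 (norm_nonneg _) (by positivity)
  have d2 : ‖w‖ ^ 2 / ((n : ℝ) + 1) ^ 2 ≤ R ^ 2 * (1 / ((n : ℝ) + 1) ^ 2) := by
    rw [div_eq_mul_one_div]
    exact mul_le_mul_of_nonneg_right (pow_le_pow_left₀ (norm_nonneg _) hw 2) hp
  linarith

/-- Weierstrass M-test on unit balls, applied from some index on. Locally uniform convergence of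
holomorphic functions is what allows two termwise differentiations later. -/
theorem tendstoLocallyUniformlyOn_logGammaPartial :
    TendstoLocallyUniformlyOn logGammaPartial logGamma atTop Complex.slitPlane := by
  have h : TendstoLocallyUniformlyOn (fun m w => ∑ n ∈ Finset.range m, logGammaTerm n w)
      (fun w => ∑' n, logGammaTerm n w) atTop Complex.slitPlane := by
    refine tendstoLocallyUniformlyOn_of_forall_exists_nhds fun w₀ _ => ?_
    have hs : Summable fun n : ℕ => (2 * (‖w₀‖ + 1) ^ 2) * (1 / ((n : ℝ) + 1) ^ 2) := by
      refine Summable.mul_left _ ?_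
      have := (summable_nat_add_iff 1).2 (Real.summable_one_div_nat_pow.2 one_lt_two)
      simpa using this
    refine ⟨Metric.ball w₀ 1, mem_nhdsWithin_of_mem_nhds (Metric.ball_mem_nhds _ one_pos), ?_⟩
    refine tendstoUniformlyOn_tsum_nat_eventually hs ?_
    filter_upwards [eventually_ge_atTop ⌈2 * (‖w₀‖ + 1)⌉₊] with n hn w hw
    refine norm_logGammaTerm_le (by linarith [norm_nonneg w₀]) ?_ (Nat.ceil_le.1 hn)
    have : ‖w - w₀‖ < 1 := by simpa [dist_eq_norm] using hw
    have h2 := norm_add_le (w - w₀) w₀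
    rw [sub_add_cancel] at h2
    linarith
  rw [Metric.tendstoLocallyUniformlyOn_iff] at h ⊢
  intro ε hε w hw
  obtain ⟨t, ht, h2⟩ := h ε hε w hw
  refine ⟨t, ht, h2.mono fun m hm y hy => ?_⟩
  have := hm y hy
  simpa [logGamma, logGammaPartial, dist_eq_norm] using this

theorem hasDerivAt_logGammaPartial (m : ℕ) {w : ℂ} (hw : w ∈ Complex.slitPlane) :
    HasDerivAt (logGammaPartial m) (∑ n ∈ Finset.range m,
      ((Real.log (1 + 1 / ((n : ℝ) + 1)) : ℝ) : ℂ) - ∑ n ∈ Finset.range (m + 1), 1 / (w + n)) w := by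
  have h1 : HasDerivAt (fun w => -Complex.log w) (-w⁻¹) w := (Complex.hasDerivAt_log hw).neg
  have h2 := h1.add (HasDerivAt.fun_sum (u := Finset.range m)
    fun n _ => hasDerivAt_logGammaTerm hw n)
  refine h2.congr_deriv ?_
  rw [Finset.sum_range_succ', Finset.sum_sub_distrib]
  simp only [Nat.cast_zero, add_zero, one_div]
  ring

theorem hasDerivAt_deriv_logGammaPartial (m : ℕ) {w : ℂ} (hw : w ∈ Complex.slitPlane) :
    HasDerivAt (deriv (logGammaPartial m)) (∑ n ∈ Finset.range (m + 1), 1 / (w + n) ^ 2) w := by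
  have h0 : deriv (logGammaPartial m) =ᶠ[𝓝 w] fun w => ∑ n ∈ Finset.range m,
      ((Real.log (1 + 1 / ((n : ℝ) + 1)) : ℝ) : ℂ) - ∑ n ∈ Finset.range (m + 1), 1 / (w + n) := by
    filter_upwards [Complex.isOpen_slitPlane.mem_nhds hw] with y hy
    exact (hasDerivAt_logGammaPartial m hy).deriv
  refine HasDerivAt.congr_of_eventuallyEq ?_ h0
  have h1 : HasDerivAt (fun w : ℂ => ∑ n ∈ Finset.range (m + 1), 1 / (w + n))
      (∑ n ∈ Finset.range (m + 1), -(1 / (w + n) ^ 2)) w := by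
    refine HasDerivAt.fun_sum fun n _ => ?_
    have h2 : HasDerivAt (fun w : ℂ => w + n) 1 w := (hasDerivAt_id w).add_const _
    simp only [one_div]
    exact (h2.fun_inv (add_nat_ne_zero_of_mem_slitPlane hw n)).congr_deriv (by simp [neg_div])
  simpa using h1.const_sub (∑ n ∈ Finset.range m, ((Real.log (1 + 1 / ((n : ℝ) + 1)) : ℝ) : ℂ))

theorem differentiableOn_logGamma : DifferentiableOn ℂ logGamma Complex.slitPlane :=
  tendstoLocallyUniformlyOn_logGammaPartial.differentiableOn
    (Eventually.of_forall fun m _ hw =>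
      (hasDerivAt_logGammaPartial m hw).differentiableAt.differentiableWithinAt)
    Complex.isOpen_slitPlane

theorem tendsto_logGammaPartial {w : ℂ} (hw : w ∈ Complex.slitPlane) :
    Tendsto (fun m => logGammaPartial m w) atTop (𝓝 (logGamma w)) :=
  tendstoLocallyUniformlyOn_logGammaPartial.tendsto_at hw

theorem tendsto_deriv_deriv_logGamma {w : ℂ} (hw : w ∈ Complex.slitPlane) :
    Tendsto (fun m : ℕ => ∑ n ∈ Finset.range (m + 1), 1 / (w + n) ^ 2) atTop
      (𝓝 (deriv (deriv logGamma) w)) := by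
  have h1 := tendstoLocallyUniformlyOn_logGammaPartial.deriv
    (Eventually.of_forall fun m _ hw =>
      (hasDerivAt_logGammaPartial m hw).differentiableAt.differentiableWithinAt)
    Complex.isOpen_slitPlane
  have h2 := h1.deriv (Eventually.of_forall fun m _ hw =>
      (hasDerivAt_deriv_logGammaPartial m hw).differentiableAt.differentiableWithinAt)
    Complex.isOpen_slitPlane
  refine (h2.tendsto_at hw).congr fun m => ?_
  exact (hasDerivAt_deriv_logGammaPartial m hw).deriv

/-- The real logarithms telescope to log(m+1), whereas Euler's product carries m^w; the quotient (1
+ 1/m)^w tends to 1. -/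
theorem exp_logGammaPartial {w : ℂ} (hw : w ∈ Complex.slitPlane) {m : ℕ} (hm : m ≠ 0) :
    Complex.exp (logGammaPartial m w) =
      Complex.GammaSeq w m * Complex.exp (w * (Real.log (1 + 1 / (m : ℝ)) : ℝ)) := by
  have hm0 : (0 : ℝ) < m := by positivity
  have hlog : ∑ n ∈ Finset.range m, Real.log (1 + 1 / ((n : ℝ) + 1)) =
      Real.log m + Real.log (1 + 1 / (m : ℝ)) := by
    have h1 : ∀ n : ℕ, Real.log (1 + 1 / ((n : ℝ) + 1)) =
        Real.log (((n + 1 : ℕ) : ℝ) + 1) - Real.log ((n : ℝ) + 1) := by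
      intro n
      rw [← Real.log_div (by positivity) (by positivity)]
      congr 1; push_cast; field_simp
    simp_rw [h1]
    rw [Finset.sum_range_sub (fun n : ℕ => Real.log ((n : ℝ) + 1)), ← Real.log_mul
      (by positivity) (by positivity)]
    simp only [Nat.cast_zero, zero_add, Real.log_one, sub_zero]
    congr 1; field_simp
  have hprod : ∏ j ∈ Finset.range (m + 1), (w + j) =
      w * m.factorial * ∏ n ∈ Finset.range m, (1 + w / ((n : ℂ) + 1)) := by
    rw [Finset.prod_range_succ', Nat.cast_zero, add_zero, ← Finset.prod_range_add_one_eq_factorial]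
    push_cast
    rw [mul_assoc, ← Finset.prod_mul_distrib, mul_comm]
    congr 1
    refine Finset.prod_congr rfl fun n _ => ?_
    have hn : ((n : ℂ) + 1) ≠ 0 := by exact_mod_cast n.succ_ne_zero
    field_simp; ring
  have hw0 : w ≠ 0 := Complex.slitPlane_ne_zero hw
  have hS : logGammaPartial m w = w * (Real.log m : ℝ) + w * (Real.log (1 + 1 / (m : ℝ)) : ℝ) -
      (Complex.log w + ∑ n ∈ Finset.range m, Complex.log (1 + w / ((n : ℂ) + 1))) := by
    have : (∑ n ∈ Finset.range m, ((Real.log (1 + 1 / ((n : ℝ) + 1)) : ℝ) : ℂ)) =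
        (Real.log m : ℝ) + (Real.log (1 + 1 / (m : ℝ)) : ℝ) := by exact_mod_cast hlog
    rw [logGammaPartial]
    simp only [logGammaTerm]
    rw [Finset.sum_sub_distrib, ← Finset.mul_sum, this]
    ring
  rw [hS, Complex.exp_sub, Complex.exp_add, Complex.exp_add, Complex.exp_log hw0, Complex.exp_sum,
    Finset.prod_congr rfl fun n _ =>
      Complex.exp_log (Complex.slitPlane_ne_zero (one_add_div_mem_slitPlane hw n)),
    Complex.GammaSeq, hprod]
  have hcp : (m : ℂ) ^ w = Complex.exp (w * (Real.log m : ℝ)) := by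
    rw [Complex.cpow_def_of_ne_zero (by exact_mod_cast hm), Complex.ofReal_log hm0.le, mul_comm]
    simp
  rw [hcp]
  have hf : (m.factorial : ℂ) ≠ 0 := by exact_mod_cast m.factorial_ne_zero
  have hP : ∏ n ∈ Finset.range m, (1 + w / ((n : ℂ) + 1)) ≠ 0 :=
    Finset.prod_ne_zero_iff.2 fun n _ =>
      Complex.slitPlane_ne_zero (one_add_div_mem_slitPlane hw n)
  field_simp

theorem exp_logGamma {w : ℂ} (hw : w ∈ Complex.slitPlane) :
    Complex.exp (logGamma w) = Complex.Gamma w := by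
  have h1 := (Complex.continuous_exp.tendsto _).comp (tendsto_logGammaPartial hw)
  have h3 : Tendsto (fun m : ℕ => Complex.exp (w * (Real.log (1 + 1 / (m : ℝ)) : ℝ))) atTop
      (𝓝 1) := by
    have a1 : Tendsto (fun m : ℕ => 1 + 1 / (m : ℝ)) atTop (𝓝 1) := by
      simpa using tendsto_one_div_atTop_nhds_zero_nat.const_add (1 : ℝ)
    have a2 := (Real.continuousAt_log one_ne_zero).tendsto.comp a1
    have a3 := (Complex.continuous_ofReal.tendsto _).comp a2
    have a4 := (Complex.continuous_exp.tendsto _).comp (a3.const_mul w)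
    simpa [Function.comp_def] using a4
  have h2 := (Complex.GammaSeq_tendsto_Gamma w).mul h3
  rw [mul_one] at h2
  refine tendsto_nhds_unique (h1.congr' ?_) h2
  filter_upwards [eventually_ne_atTop 0] with m hm
  exact exp_logGammaPartial hw hm

theorem conj_mem_slitPlane {w : ℂ} (hw : w ∈ Complex.slitPlane) :
    (starRingEnd ℂ) w ∈ Complex.slitPlane := by
  rw [Complex.mem_slitPlane_iff] at hw ⊢
  simpa using hw

theorem logGamma_conj {w : ℂ} (hw : w ∈ Complex.slitPlane) :
    logGamma ((starRingEnd ℂ) w) = (starRingEnd ℂ) (logGamma w) := by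
  have h1 := tendsto_logGammaPartial (conj_mem_slitPlane hw)
  have h2 := (Complex.continuous_conj.tendsto _).comp (tendsto_logGammaPartial hw)
  refine tendsto_nhds_unique h1 (h2.congr fun m => ?_)
  simp only [Function.comp, logGammaPartial, logGammaTerm, map_add, map_neg, map_sum, map_sub,
    map_mul, Complex.conj_ofReal]
  rw [Complex.log_conj _ (Complex.slitPlane_arg_ne_pi hw)]
  congr 1
  refine Finset.sum_congr rfl fun n _ => ?_
  congr 1
  rw [← Complex.log_conj _ (Complex.slitPlane_arg_ne_pi (one_add_div_mem_slitPlane hw n))]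
  simp

/-- By the mean value theorem the arctangent difference is v/(y² + v²) with |y - x| ≤ 1/2, and v ≥ 1
gives y² + v² ≤ 2(x² + v²). Along x = u + n the right side telescopes. -/
theorem one_div_sq_add_sq_le_arctan {v : ℝ} (hv : 1 ≤ v) (x : ℝ) :
    1 / (x ^ 2 + v ^ 2) ≤
      2 / v * (Real.arctan ((x + 1 / 2) / v) - Real.arctan ((x - 1 / 2) / v)) := by
  have hv0 : 0 < v := by linarith
  have hder : ∀ y : ℝ, HasDerivAt (fun y => Real.arctan (y / v)) (1 / (1 + (y / v) ^ 2) * (1 / v)) y :=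
    fun y => ((hasDerivAt_id y).div_const v).arctan
  obtain ⟨y, hy, he⟩ := exists_hasDerivAt_eq_slope (fun y => Real.arctan (y / v)) _
    (show x - 1 / 2 < x + 1 / 2 by linarith)
    (fun y _ => (hder y).continuousAt.continuousWithinAt) (fun y _ => hder y)
  have h1 : x + 1 / 2 - (x - 1 / 2) = 1 := by ring
  rw [h1, div_one] at he
  rw [← he]
  have e : 2 / v * (1 / (1 + (y / v) ^ 2) * (1 / v)) = 2 / (y ^ 2 + v ^ 2) := by
    field_simp; ring
  rw [e, div_le_div_iff₀ (by positivity) (by positivity)]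
  have hy1 : y - x ≤ 1 / 2 := by linarith [hy.2]
  have hy2 : -(1 / 2) ≤ y - x := by linarith [hy.1]
  nlinarith [sq_nonneg (2 * x - y)]

theorem sum_one_div_sq_add_sq_le {v : ℝ} (hv : 1 ≤ v) (u : ℝ) (m : ℕ) :
    ∑ n ∈ Finset.range m, 1 / ((u + n) ^ 2 + v ^ 2) ≤ 8 / v := by
  have hv0 : 0 < v := by linarith
  have h1 : ∑ n ∈ Finset.range m, 1 / ((u + n) ^ 2 + v ^ 2) ≤
      ∑ n ∈ Finset.range m, 2 / v * (Real.arctan ((u + (n + 1 : ℕ) - 1 / 2) / v) -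
        Real.arctan ((u + (n : ℕ) - 1 / 2) / v)) := by
    refine Finset.sum_le_sum fun n _ => ?_
    have e : u + ((n + 1 : ℕ) : ℝ) - 1 / 2 = u + n + 1 / 2 := by push_cast; ring
    rw [e]
    exact one_div_sq_add_sq_le_arctan hv (u + n)
  refine h1.trans ?_
  rw [← Finset.mul_sum, Finset.sum_range_sub (fun n : ℕ => Real.arctan ((u + n - 1 / 2) / v))]
  have a1 := Real.arctan_lt_pi_div_two ((u + m - 1 / 2) / v)
  have a2 := Real.neg_pi_div_two_lt_arctan ((u + (0 : ℕ) - 1 / 2) / v)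
  have a3 := Real.pi_lt_four
  calc _ ≤ 2 / v * 4 := mul_le_mul_of_nonneg_left (by linarith) (by positivity)
    _ = 8 / v := by ring

/-- The second derivative is ∑ (w+n)^{-2}, and the bound is uniform in Re w. Combined with Γ(w+1) =
wΓ(w) and the reflection formula, it takes the place of Stirling's formula below. -/
theorem norm_deriv_deriv_logGamma_le {w : ℂ} (hw : 1 ≤ |w.im|) :
    ‖deriv (deriv logGamma) w‖ ≤ 8 / |w.im| := by
  have hs : w ∈ Complex.slitPlane := by
    rw [Complex.mem_slitPlane_iff]; right
    intro h; rw [h] at hw; simp at hw; linarith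
  refine le_of_tendsto (tendsto_deriv_deriv_logGamma hs).norm (Eventually.of_forall fun m => ?_)
  refine (norm_sum_le _ _).trans ((Finset.sum_le_sum fun n _ => ?_).trans
    (sum_one_div_sq_add_sq_le hw w.re (m + 1)))
  rw [norm_div, norm_one, norm_pow, Complex.sq_norm, Complex.normSq_apply, sq_abs]
  simp [sq]

/-- Second order Taylor estimate on a convex open set. -/
theorem norm_sub_sub_deriv_mul_le {f : ℂ → ℂ} {S : Set ℂ} {M : ℝ} (hS : Convex ℝ S)
    (hSo : IsOpen S) (hf : DifferentiableOn ℂ f S) (hM : ∀ z ∈ S, ‖deriv (deriv f) z‖ ≤ M)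
    {c x : ℂ} (hc : c ∈ S) (hx : x ∈ S) :
    ‖f x - f c - deriv f c * (x - c)‖ ≤ M * ‖x - c‖ ^ 2 := by
  have hM0 : 0 ≤ M := (norm_nonneg _).trans (hM c hc)
  have hd : ∀ y ∈ S, DifferentiableAt ℂ f y := fun y hy => (hf y hy).differentiableAt (hSo.mem_nhds hy)
  have hd2 : ∀ y ∈ S, DifferentiableAt ℂ (deriv f) y := fun y hy =>
    ((hf.deriv hSo) y hy).differentiableAt (hSo.mem_nhds hy)
  have h1 : ∀ y ∈ S, ‖deriv f y - deriv f c‖ ≤ M * ‖y - c‖ := fun y hy =>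
    hS.norm_image_sub_le_of_norm_deriv_le hd2 hM hc hy
  have hseg : segment ℝ c x ⊆ S := hS.segment_subset hc hx
  have hg : ∀ y ∈ segment ℝ c x, HasDerivAt (fun y => f y - deriv f c * y) (deriv f y - deriv f c) y := by
    intro y hy
    exact ((hd y (hseg hy)).hasDerivAt.sub ((hasDerivAt_id y).const_mul (deriv f c))).congr_deriv
      (by simp)
  have h2 := (convex_segment c x).norm_image_sub_le_of_norm_deriv_le
    (f := fun y => f y - deriv f c * y) (C := M * ‖x - c‖)
    (fun y hy => (hg y hy).differentiableAt) (fun y hy => by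
      rw [(hg y hy).deriv]
      refine (h1 y (hseg hy)).trans (mul_le_mul_of_nonneg_left ?_ hM0)
      obtain ⟨a, b, ha, hb, hab, rfl⟩ := hy
      have : a • c + b • x - c = b • (x - c) := by
        have : (a : ℝ) = 1 - b := by linarith
        rw [this]; module
      rw [this, norm_smul, Real.norm_of_nonneg hb]
      exact mul_le_of_le_one_left (norm_nonneg _) (by linarith))
    (left_mem_segment ℝ c x) (right_mem_segment ℝ c x)
  calc _ = ‖f x - deriv f c * x - (f c - deriv f c * c)‖ := by congr 1; ring
    _ ≤ _ := h2
    _ = _ := by ring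

theorem mem_slitPlane_of_one_le_abs_im {w : ℂ} (hw : 1 ≤ |w.im|) : w ∈ Complex.slitPlane := by
  rw [Complex.mem_slitPlane_iff]; right
  intro h; rw [h] at hw; simp at hw; linarith

theorem norm_logGamma_add_sub_le {w : ℂ} (hw : 2 ≤ |w.im|) (h : ℝ) :
    ‖logGamma (w + h) - logGamma w - deriv logGamma w * h‖ ≤ 16 / |w.im| * h ^ 2 := by
  -- A horizontal strip contains w + h for every real h; on it |Im y| ≥ |Im w|/2, which turns 8 into
  -- 16.
  set S : Set ℂ := Complex.im ⁻¹' (Metric.ball w.im (|w.im| / 2)) with hS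
  have hconv : Convex ℝ S := (convex_ball _ _).is_linear_preimage Complex.imLm.isLinear
  have hopen : IsOpen S := Metric.isOpen_ball.preimage Complex.continuous_im
  have him : ∀ y ∈ S, |w.im| / 2 ≤ |y.im| := by
    intro y hy
    have h1 : |y.im - w.im| < |w.im| / 2 := by simpa [hS, Real.dist_eq] using hy
    have h2 := abs_sub_abs_le_abs_sub w.im y.im
    rw [abs_sub_comm] at h2
    linarith
  have hbd : ∀ y ∈ S, ‖deriv (deriv logGamma) y‖ ≤ 16 / |w.im| := by
    intro y hy
    have h1 := him y hy
    refine (norm_deriv_deriv_logGamma_le (by linarith)).trans ?_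
    rw [div_le_div_iff₀ (by linarith) (by linarith)]
    linarith
  have h3 := norm_sub_sub_deriv_mul_le hconv hopen (differentiableOn_logGamma.mono
    fun y hy => mem_slitPlane_of_one_le_abs_im (by linarith [him y hy])) hbd
    (c := w) (x := w + h) (by simp only [hS, Set.mem_preimage]; exact Metric.mem_ball_self (by linarith))
    (by simp only [hS, Set.mem_preimage, Complex.add_im, Complex.ofReal_im, add_zero]
        exact Metric.mem_ball_self (by linarith))
  simpa using h3

/-- Taking moduli in Γ(w+1) = wΓ(w) shows that Re log Γ grows by exactly log|w| from w to w + 1,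
whatever the branch; a Taylor step of length 1 compares this with the derivative. -/
theorem abs_re_deriv_logGamma_sub_log_le {w : ℂ} (hw : 2 ≤ |w.im|) :
    |(deriv logGamma w).re - Real.log ‖w‖| ≤ 16 / |w.im| := by
  have h1 := norm_logGamma_add_sub_le hw 1
  have hs : w ∈ Complex.slitPlane := mem_slitPlane_of_one_le_abs_im (by linarith)
  have hs1 : w + 1 ∈ Complex.slitPlane :=
    mem_slitPlane_of_one_le_abs_im (by simpa using (by linarith : 1 ≤ |w.im|))
  have hw0 : w ≠ 0 := Complex.slitPlane_ne_zero hs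
  have e1 : Complex.exp (logGamma (w + 1)) = w * Complex.exp (logGamma w) := by
    rw [exp_logGamma hs, exp_logGamma hs1, Complex.Gamma_add_one _ hw0]
  have e2 := congrArg (fun z => Real.log ‖z‖) e1
  simp only [norm_mul, Complex.norm_exp] at e2
  rw [Real.log_mul (norm_ne_zero_iff.2 hw0) (Real.exp_pos _).ne', Real.log_exp, Real.log_exp] at e2
  have h2 := (Complex.abs_re_le_norm _).trans h1
  simp only [Complex.ofReal_one, mul_one, one_pow, Complex.sub_re] at h2
  rw [e2] at h2
  have e3 : Real.log ‖w‖ - (deriv logGamma w).re =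
      Real.log ‖w‖ + (logGamma w).re - (logGamma w).re - (deriv logGamma w).re := by ring
  rw [abs_sub_comm, e3]
  simpa using h2

/-- A second difference: in the Taylor expansions at w + 1/2 with steps ±1/2 the linear terms
cancel, and each remainder is at most 8 · (1/2)² = 2, whence the exponent 4. -/
theorem norm_Gamma_add_half_sq_le {w : ℂ} (hw : 2 ≤ |w.im|) :
    ‖Complex.Gamma (w + 1 / 2)‖ ^ 2 ≤ Real.exp 4 * ‖w‖ * ‖Complex.Gamma w‖ ^ 2 := by
  have hs : w ∈ Complex.slitPlane := mem_slitPlane_of_one_le_abs_im (by linarith)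
  have hs1 : w + 1 ∈ Complex.slitPlane :=
    mem_slitPlane_of_one_le_abs_im (by simpa using (by linarith : 1 ≤ |w.im|))
  have hi : (w + 1 / 2).im = w.im := by simp
  have hs2 : w + 1 / 2 ∈ Complex.slitPlane :=
    mem_slitPlane_of_one_le_abs_im (by rw [hi]; linarith)
  have a1 := norm_logGamma_add_sub_le (w := w + 1 / 2) (by rwa [hi]) (1 / 2)
  have a2 := norm_logGamma_add_sub_le (w := w + 1 / 2) (by rwa [hi]) (-(1 / 2))
  rw [hi] at a1 a2
  have i1 : w + 1 / 2 + ((1 / 2 : ℝ) : ℂ) = w + 1 := by push_cast; ring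
  have i2 : w + 1 / 2 + ((-(1 / 2) : ℝ) : ℂ) = w := by push_cast; ring
  rw [i1] at a1
  rw [i2] at a2
  have hb : 16 / |w.im| ≤ 8 := by
    rw [div_le_iff₀ (by linarith)]; linarith
  have a3 : ‖2 * logGamma (w + 1 / 2) - logGamma (w + 1) - logGamma w‖ ≤ 4 := by
    have := norm_add_le_of_le a1 a2
    rw [← norm_neg] at this
    have e : -(logGamma (w + 1) - logGamma (w + 1 / 2) - deriv logGamma (w + 1 / 2) *
        ((1 / 2 : ℝ) : ℂ) + (logGamma w - logGamma (w + 1 / 2) - deriv logGamma (w + 1 / 2) *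
        ((-(1 / 2) : ℝ) : ℂ))) = 2 * logGamma (w + 1 / 2) - logGamma (w + 1) - logGamma w := by
      push_cast; ring
    rw [e] at this
    linarith
  have e1 : Complex.Gamma (w + 1 / 2) ^ 2 = Complex.exp (2 * logGamma (w + 1 / 2) -
      logGamma (w + 1) - logGamma w) * (w * Complex.Gamma w ^ 2) := by
    have h : w * Complex.Gamma w ^ 2 = Complex.Gamma (w + 1) * Complex.Gamma w := by
      rw [Complex.Gamma_add_one _ (Complex.slitPlane_ne_zero hs)]; ring
    rw [h, ← exp_logGamma hs, ← exp_logGamma hs1, ← exp_logGamma hs2, ← Complex.exp_add,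
      ← Complex.exp_add, ← Complex.exp_nat_mul]
    congr 1; push_cast; ring
  rw [← norm_pow, e1, norm_mul, norm_mul, norm_pow, ← mul_assoc]
  gcongr
  rw [Complex.norm_exp]
  exact Real.exp_le_exp.2 ((Complex.re_le_norm _).trans a3)

/-! ### Holomorphic continuation of θ and the size of θ' and θ'' -/

/-- The holomorphic extension of `rsTheta`. -/
noncomputable def rsThetaC (z : ℂ) : ℂ :=
  (logGamma (1 / 4 + Complex.I * (z / 2)) - logGamma (1 / 4 - Complex.I * (z / 2))) /
    (2 * Complex.I) - z / 2 * (Real.log Real.pi : ℝ)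

theorem mem_slitPlane_of_re_pos {z : ℂ} (hz : 0 < z.re) :
    1 / 4 + Complex.I * (z / 2) ∈ Complex.slitPlane ∧
      1 / 4 - Complex.I * (z / 2) ∈ Complex.slitPlane := by
  constructor <;>
  · rw [Complex.mem_slitPlane_iff]; right
    simp [hz.ne']

/-- Im log Γ(1/4 + it/2) - (t/2) log π is a continuous argument vanishing at 0, so uniqueness
identifies it with `rsTheta`. For real t the two values of log Γ in `rsThetaC` are conjugate, so
their difference is 2i times that imaginary part. -/
theorem rsTheta_eq (t : ℝ) : (rsTheta t : ℂ) = rsThetaC t := by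
  have hmem : ∀ t : ℝ, (1 / 4 + Complex.I * (t / 2) : ℂ) ∈ Complex.slitPlane := fun t => by
    rw [Complex.mem_slitPlane_iff]; left; simp
  set φ : ℝ → ℝ := fun t => (logGamma (1 / 4 + Complex.I * (t / 2))).im - t / 2 * Real.log Real.pi
    with hφ
  have harg : IsContinuousArg φ := by
    refine ⟨?_, ?_, ?_⟩
    · refine Continuous.sub (Complex.continuous_im.comp ?_) (by fun_prop)
      refine differentiableOn_logGamma.continuousOn.comp_continuous (by fun_prop) hmem
    -- At t = 0 the point 1/4 is real, and conjugation symmetry forces Im log Γ(1/4) = 0.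
    · have h := logGamma_conj (hmem 0)
      have h2 := congrArg Complex.im h
      simp only [Complex.conj_im] at h2
      have e : (starRingEnd ℂ) (1 / 4 + Complex.I * (((0 : ℝ) : ℂ) / 2)) =
        1 / 4 + Complex.I * (((0 : ℝ) : ℂ) / 2) := by simp [Complex.conj_ofNat]
      rw [e] at h2
      simp only [hφ, zero_div, zero_mul, sub_zero]
      linarith
    · intro t
      have e : gammaCurve t = Complex.exp (logGamma (1 / 4 + Complex.I * (t / 2)) -
          Complex.I * (t / 2) * (Real.log Real.pi : ℝ)) := by
        rw [gammaCurve, ← exp_logGamma (hmem t), Complex.cpow_def_of_ne_zero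
          (by exact_mod_cast Real.pi_ne_zero), ← Complex.exp_add, Complex.ofReal_log Real.pi_pos.le]
        congr 1; ring
      rw [e, Complex.norm_exp, Complex.ofReal_exp, ← Complex.exp_add]
      congr 1
      apply Complex.ext <;> simp [hφ]
  have huniq := existsUnique_isContinuousArg.unique rsTheta_spec harg
  rw [huniq]
  have hc : (1 / 4 - Complex.I * (t / 2) : ℂ) = (starRingEnd ℂ) (1 / 4 + Complex.I * (t / 2)) := by
    simp [sub_eq_add_neg, Complex.conj_ofNat]
  rw [rsThetaC, hc, logGamma_conj (hmem t), Complex.sub_conj]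
  simp only [hφ]
  push_cast
  field_simp

theorem hasDerivAt_rsThetaC {z : ℂ} (hz : 0 < z.re) :
    HasDerivAt rsThetaC ((deriv logGamma (1 / 4 + Complex.I * (z / 2)) +
      deriv logGamma (1 / 4 - Complex.I * (z / 2))) / 4 - (Real.log Real.pi : ℝ) / 2) z := by
  obtain ⟨m1, m2⟩ := mem_slitPlane_of_re_pos hz
  have d0 : HasDerivAt (fun z : ℂ => Complex.I * (z / 2)) (Complex.I * (1 / 2)) z :=
    ((hasDerivAt_id z).div_const 2).const_mul _
  have d1 := ((differentiableOn_logGamma _ m1).differentiableAt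
    (Complex.isOpen_slitPlane.mem_nhds m1)).hasDerivAt.comp z (d0.const_add (1 / 4))
  have d2 := ((differentiableOn_logGamma _ m2).differentiableAt
    (Complex.isOpen_slitPlane.mem_nhds m2)).hasDerivAt.comp z (d0.const_sub (1 / 4))
  have d3 := ((d1.sub d2).div_const (2 * Complex.I)).sub
    (((hasDerivAt_id z).div_const 2).mul_const ((Real.log Real.pi : ℝ) : ℂ))
  refine d3.congr_deriv ?_
  field_simp
  ring

theorem isOpen_re_pos : IsOpen {z : ℂ | 0 < z.re} := isOpen_lt continuous_const Complex.continuous_re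

theorem differentiableOn_rsThetaC : DifferentiableOn ℂ rsThetaC {z : ℂ | 0 < z.re} :=
  fun _ hz => (hasDerivAt_rsThetaC hz).differentiableAt.differentiableWithinAt

theorem norm_deriv_deriv_rsThetaC_le {z : ℂ} (hz : 2 ≤ z.re) :
    ‖deriv (deriv rsThetaC) z‖ ≤ 4 / z.re := by
  have hz0 : 0 < z.re := by linarith
  obtain ⟨m1, m2⟩ := mem_slitPlane_of_re_pos hz0
  have h0 : deriv rsThetaC =ᶠ[𝓝 z] fun z => (deriv logGamma (1 / 4 + Complex.I * (z / 2)) +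
      deriv logGamma (1 / 4 - Complex.I * (z / 2))) / 4 - (Real.log Real.pi : ℝ) / 2 := by
    filter_upwards [isOpen_re_pos.mem_nhds hz0] with y hy
    exact (hasDerivAt_rsThetaC hy).deriv
  have d0 : HasDerivAt (fun z : ℂ => Complex.I * (z / 2)) (Complex.I * (1 / 2)) z :=
    ((hasDerivAt_id z).div_const 2).const_mul _
  have hdd := differentiableOn_logGamma.deriv Complex.isOpen_slitPlane
  have d1 := ((hdd _ m1).differentiableAt
    (Complex.isOpen_slitPlane.mem_nhds m1)).hasDerivAt.comp z (d0.const_add (1 / 4))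
  have d2 := ((hdd _ m2).differentiableAt
    (Complex.isOpen_slitPlane.mem_nhds m2)).hasDerivAt.comp z (d0.const_sub (1 / 4))
  have d3 := ((d1.add d2).div_const 4).sub_const (((Real.log Real.pi : ℝ) : ℂ) / 2)
  rw [h0.deriv_eq]
  have e3 := d3.deriv
  simp only [Function.comp_def] at e3
  have i1 : |(1 / 4 + Complex.I * (z / 2)).im| = z.re / 2 := by
    simp; positivity
  have i2 : |(1 / 4 - Complex.I * (z / 2)).im| = z.re / 2 := by
    simp; positivity
  have b1 := norm_deriv_deriv_logGamma_le (w := 1 / 4 + Complex.I * (z / 2)) (by rw [i1]; linarith)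
  have b2 := norm_deriv_deriv_logGamma_le (w := 1 / 4 - Complex.I * (z / 2)) (by rw [i2]; linarith)
  rw [i1] at b1
  rw [i2] at b2
  erw [e3]
  have nI : ‖Complex.I * (1 / 2)‖ = 1 / 2 := by simp
  rw [norm_div]
  have n4 : ‖(4 : ℂ)‖ = 4 := by simp
  rw [n4, div_le_div_iff₀ (by norm_num) hz0]
  have := norm_add_le (deriv (deriv logGamma) (1 / 4 + Complex.I * (z / 2)) * (Complex.I * (1 / 2)))
    (deriv (deriv logGamma) (1 / 4 - Complex.I * (z / 2)) * -(Complex.I * (1 / 2)))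
  rw [norm_mul _ (Complex.I * (1 / 2)), norm_mul _ (-(Complex.I * (1 / 2))), norm_neg, nI] at this
  have e8 : 8 / (z.re / 2) * z.re = 16 := by field_simp; norm_num
  calc _ ≤ (8 / (z.re / 2) * (1 / 2) + 8 / (z.re / 2) * (1 / 2)) * z.re := by
        gcongr
        exact this.trans (by gcongr)
    _ = 4 * 4 := by linear_combination e8

theorem hasDerivAt_rsTheta {t : ℝ} (ht : 0 < t) :
    HasDerivAt rsTheta (deriv rsThetaC t).re t := by
  have h := (hasDerivAt_rsThetaC (z := t) (by simpa)).differentiableAt.hasDerivAt.real_of_complex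
  have e : (fun x : ℝ => (rsThetaC x).re) = rsTheta := by
    funext x; rw [← rsTheta_eq]; simp
  rwa [e] at h

theorem deriv_rsTheta_eq {t : ℝ} (ht : 0 < t) : ((deriv rsTheta t : ℝ) : ℂ) = deriv rsThetaC t := by
  have h1 := (hasDerivAt_rsTheta ht).ofReal_comp
  have h2 := (hasDerivAt_rsThetaC (z := t) (by simpa)).differentiableAt.hasDerivAt.comp_ofReal
  have e : (fun x : ℝ => rsThetaC x) = fun x : ℝ => ((rsTheta x : ℝ) : ℂ) := by
    funext x; rw [← rsTheta_eq]
  rw [e] at h2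
  rw [(hasDerivAt_rsTheta ht).deriv]
  exact h1.unique h2

/-- θ' is a quarter of the sum of Re (log Γ)' at 1/4 ± it/2, less (log π)/2. Each real part is
within 32/t of log|1/4 ± it/2|, which is within 2/t of log(t/2); (2·32 + 2·2)/4 = 17. -/
theorem abs_deriv_rsTheta_sub_log_le {t : ℝ} (ht : 4 ≤ t) :
    |deriv rsTheta t - Real.log (t / (2 * Real.pi)) / 2| ≤ 17 / t := by
  have ht0 : 0 < t := by linarith
  have hre : ((t : ℂ)).re = t := Complex.ofReal_re t
  have e0 : deriv rsTheta t = ((deriv logGamma (1 / 4 + Complex.I * (t / 2))).re +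
      (deriv logGamma (1 / 4 - Complex.I * (t / 2))).re) / 4 - Real.log Real.pi / 2 := by
    rw [(hasDerivAt_rsTheta ht0).deriv, (hasDerivAt_rsThetaC (z := t) (by simpa)).deriv]
    simp
  have i1 : |(1 / 4 + Complex.I * ((t : ℂ) / 2)).im| = t / 2 := by
    simp; positivity
  have i2 : |(1 / 4 - Complex.I * ((t : ℂ) / 2)).im| = t / 2 := by
    simp; positivity
  have b1 := abs_re_deriv_logGamma_sub_log_le (w := 1 / 4 + Complex.I * ((t : ℂ) / 2))
    (by rw [i1]; linarith)
  have b2 := abs_re_deriv_logGamma_sub_log_le (w := 1 / 4 - Complex.I * ((t : ℂ) / 2))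
    (by rw [i2]; linarith)
  rw [i1] at b1
  rw [i2] at b2
  have n1 : ‖1 / 4 + Complex.I * ((t : ℂ) / 2)‖ ^ 2 = 1 / 16 + t ^ 2 / 4 := by
    rw [Complex.sq_norm, Complex.normSq_apply]; simp; ring
  have n2 : ‖1 / 4 - Complex.I * ((t : ℂ) / 2)‖ ^ 2 = 1 / 16 + t ^ 2 / 4 := by
    rw [Complex.sq_norm, Complex.normSq_apply]; simp; ring
  have key : ∀ r : ℝ, 0 ≤ r → r ^ 2 = 1 / 16 + t ^ 2 / 4 →
      Real.log (t / 2) ≤ Real.log r ∧ Real.log r ≤ Real.log (t / 2) + 2 / t := by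
    intro r hr h
    have h1 : t / 2 ≤ r := by nlinarith
    have h2 : r ≤ t / 2 * (1 + 2 / t) := by
      have : t / 2 * (1 + 2 / t) = t / 2 + 1 := by field_simp
      rw [this]; nlinarith
    refine ⟨Real.log_le_log (by linarith) h1, ?_⟩
    refine (Real.log_le_log (by linarith) h2).trans ?_
    rw [Real.log_mul (by positivity) (by positivity)]
    have := Real.log_le_sub_one_of_pos (show 0 < 1 + 2 / t by positivity)
    linarith
  obtain ⟨k1, k2⟩ := key _ (norm_nonneg _) n1
  obtain ⟨k3, k4⟩ := key _ (norm_nonneg _) n2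
  have el : Real.log (t / (2 * Real.pi)) = Real.log (t / 2) - Real.log Real.pi := by
    rw [← div_div, Real.log_div (by positivity) Real.pi_ne_zero]
  have e16 : 16 / (t / 2) = 32 * (1 / t) := by field_simp; norm_num
  have e17 : 17 / t = 17 * (1 / t) := by ring
  have e2 : 2 / t = 2 * (1 / t) := by ring
  rw [e16] at b1 b2
  rw [e2] at k2 k4
  rw [e17, e0, el]
  rw [abs_le] at b1 b2 ⊢
  have hp : 0 < 1 / t := by positivity
  constructor <;> linarith [b1.1, b1.2, b2.1, b2.2]

/-- On the ball of radius t/2 the real part stays above t/2, so |θ''| ≤ 4/(t/2) there. -/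
theorem norm_rsThetaC_sub_le {t : ℝ} (ht : 4 ≤ t) {z : ℂ} (hz : ‖z - t‖ < t / 2) :
    ‖rsThetaC z - rsTheta t - deriv rsTheta t * (z - t)‖ ≤ 8 / t * ‖z - t‖ ^ 2 := by
  have ht0 : 0 < t := by linarith
  have hre : ∀ y ∈ Metric.ball (t : ℂ) (t / 2), t / 2 ≤ y.re := by
    intro y hy
    have h1 : ‖y - t‖ < t / 2 := by simpa [dist_eq_norm] using hy
    have h2 := (abs_le.1 (Complex.abs_re_le_norm (y - t))).1
    simp at h2
    linarith
  rw [rsTheta_eq, deriv_rsTheta_eq ht0]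
  refine norm_sub_sub_deriv_mul_le (convex_ball (t : ℂ) (t / 2)) Metric.isOpen_ball
    (differentiableOn_rsThetaC.mono fun y hy => ?_) (fun y hy => ?_)
    (Metric.mem_ball_self (by linarith)) (by simpa [dist_eq_norm] using hz)
  · have := hre y hy
    show 0 < y.re
    linarith
  · have h1 := hre y hy
    refine (norm_deriv_deriv_rsThetaC_le (by linarith)).trans ?_
    rw [div_le_div_iff₀ (by linarith) ht0]
    linarith

/-! ### Hardy's function as a holomorphic function, and its functional equation -/

/-- The common modulus factor of `Gammaℝ s` and `Gammaℝ (1 - s)` at `s = 1/2 + iz`. -/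
noncomputable def gammaGeom (z : ℂ) : ℂ :=
  Complex.exp ((logGamma (1 / 4 + Complex.I * (z / 2)) + logGamma (1 / 4 - Complex.I * (z / 2))) / 2 -
    (Real.log Real.pi : ℝ) / 4)

theorem gammaGeom_ne_zero (z : ℂ) : gammaGeom z ≠ 0 := Complex.exp_ne_zero _

/-- Half the difference of the two values of log Γ goes into iθ, half their sum into `gammaGeom`;
the reflected point only changes the sign of θ. -/
theorem Gammaℝ_half_add {z : ℂ} (hz : 0 < z.re) :
    Complex.Gammaℝ (1 / 2 + Complex.I * z) =
      Complex.exp (Complex.I * rsThetaC z) * gammaGeom z := by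
  obtain ⟨m1, m2⟩ := mem_slitPlane_of_re_pos hz
  have e1 : (1 / 2 + Complex.I * z) / 2 = 1 / 4 + Complex.I * (z / 2) := by ring
  rw [Complex.Gammaℝ_def, e1, ← exp_logGamma m1, Complex.cpow_def_of_ne_zero
    (by exact_mod_cast Real.pi_ne_zero), ← Complex.exp_add, gammaGeom, ← Complex.exp_add, rsThetaC,
    Complex.ofReal_log Real.pi_pos.le]
  congr 1
  field_simp
  ring

theorem Gammaℝ_half_sub {z : ℂ} (hz : 0 < z.re) :
    Complex.Gammaℝ (1 / 2 - Complex.I * z) =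
      Complex.exp (-(Complex.I * rsThetaC z)) * gammaGeom z := by
  obtain ⟨m1, m2⟩ := mem_slitPlane_of_re_pos hz
  have e1 : (1 / 2 - Complex.I * z) / 2 = 1 / 4 - Complex.I * (z / 2) := by ring
  rw [Complex.Gammaℝ_def, e1, ← exp_logGamma m2, Complex.cpow_def_of_ne_zero
    (by exact_mod_cast Real.pi_ne_zero), ← Complex.exp_add, gammaGeom, ← Complex.exp_add, rsThetaC,
    Complex.ofReal_log Real.pi_pos.le]
  congr 1
  field_simp
  ring

/-- Hardy's function on the right half plane. -/
noncomputable def hardyC (z : ℂ) : ℂ :=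
  Complex.exp (Complex.I * rsThetaC z) * riemannZeta (1 / 2 + Complex.I * z)

theorem hardyZ_eq (t : ℝ) : hardyZ t = hardyC t := by
  rw [hardyZ, hardyC, rsTheta_eq]

theorem half_add_ne {z : ℂ} (hz : 0 < z.re) :
    1 / 2 + Complex.I * z ≠ 0 ∧ 1 / 2 + Complex.I * z ≠ 1 ∧
    1 / 2 - Complex.I * z ≠ 0 ∧ 1 / 2 - Complex.I * z ≠ 1 := by
  refine ⟨?_, ?_, ?_, ?_⟩ <;>
  · intro h
    have := congrArg Complex.im h
    simp at this
    linarith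

theorem hardyC_mul_gammaGeom {z : ℂ} (hz : 0 < z.re) :
    hardyC z * gammaGeom z = completedRiemannZeta (1 / 2 + Complex.I * z) := by
  obtain ⟨h0, h1, h2, h3⟩ := half_add_ne hz
  have hG : Complex.Gammaℝ (1 / 2 + Complex.I * z) ≠ 0 := by
    rw [Gammaℝ_half_add hz]
    exact mul_ne_zero (Complex.exp_ne_zero _) (gammaGeom_ne_zero z)
  rw [hardyC, riemannZeta_def_of_ne_zero h0]
  rw [mul_right_comm, ← Gammaℝ_half_add hz, mul_div_cancel₀ _ hG]

/-- Multiplied by `gammaGeom z`, the two sides become the completed zeta function at s and at 1 - s.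
In the half plane Im z > 0 this form has its zeta value to the right of the critical line. -/
theorem hardyC_eq_reflect {z : ℂ} (hz : 0 < z.re) :
    hardyC z = Complex.exp (-(Complex.I * rsThetaC z)) * riemannZeta (1 / 2 - Complex.I * z) := by
  obtain ⟨h0, h1, h2, h3⟩ := half_add_ne hz
  have hG : Complex.Gammaℝ (1 / 2 - Complex.I * z) ≠ 0 := by
    rw [Gammaℝ_half_sub hz]
    exact mul_ne_zero (Complex.exp_ne_zero _) (gammaGeom_ne_zero z)
  have e : (1 / 2 - Complex.I * z) = 1 - (1 / 2 + Complex.I * z) := by ring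
  refine mul_right_cancel₀ (gammaGeom_ne_zero z) ?_
  rw [hardyC_mul_gammaGeom hz, mul_right_comm, ← Gammaℝ_half_sub hz, riemannZeta_def_of_ne_zero h2,
    mul_div_cancel₀ _ hG, e, completedRiemannZeta_one_sub]

/-- A lower bound for `gammaGeom`, needed to divide it out of the completed zeta function. With w =
1/4 + iz/2 its square is π^{-1/2} Γ(w) Γ(1/2 - w). The reflection formula evaluates Γ(1/2 - w) Γ(1/2
+ w), and `norm_Gamma_add_half_sq_le` replaces Γ(1/2 + w) by √|w| Γ(w). -/
theorem one_le_mul_norm_gammaGeom_sq {z : ℂ} (hz : 4 ≤ z.re) :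
    1 ≤ Real.exp 2 * Real.exp (Real.pi * z.re / 2) * Real.sqrt ‖1 / 4 + Complex.I * (z / 2)‖ *
      ‖gammaGeom z‖ ^ 2 := by
  have hz0 : 0 < z.re := by linarith
  obtain ⟨m1, m2⟩ := mem_slitPlane_of_re_pos hz0
  set w := 1 / 4 + Complex.I * (z / 2) with hw
  have hwi : w.im = z.re / 2 := by simp [hw]
  have e1 : gammaGeom z ^ 2 = Complex.Gamma w * Complex.Gamma (1 / 4 - Complex.I * (z / 2)) *
      Complex.exp (-((Real.log Real.pi : ℝ) / 2)) := by
    rw [← exp_logGamma m1, ← exp_logGamma m2, gammaGeom, ← Complex.exp_nat_mul, ← Complex.exp_add,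
      ← Complex.exp_add]
    congr 1; push_cast; ring
  have e2 : ‖gammaGeom z‖ ^ 2 * Real.sqrt Real.pi = ‖Complex.Gamma w‖ *
      ‖Complex.Gamma (1 / 4 - Complex.I * (z / 2))‖ := by
    rw [← norm_pow, e1, norm_mul, norm_mul, mul_assoc]
    have : ‖Complex.exp (-((Real.log Real.pi : ℝ) / 2))‖ * Real.sqrt Real.pi = 1 := by
      rw [Complex.norm_exp, Real.sqrt_eq_rpow, Real.rpow_def_of_pos Real.pi_pos, ← Real.exp_add]
      have : (-(((Real.log Real.pi : ℝ) : ℂ) / 2)).re = -(Real.log Real.pi / 2) := by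
        simp
      rw [this]
      simp; ring
    rw [this, mul_one]
  have e3 : Complex.Gamma (1 / 4 - Complex.I * (z / 2)) * Complex.Gamma (w + 1 / 2) *
      Complex.sin (Real.pi * (w + 1 / 2)) = Real.pi := by
    have h := Complex.Gamma_mul_Gamma_one_sub (w + 1 / 2)
    have h1 : 1 - (w + 1 / 2) = 1 / 4 - Complex.I * (z / 2) := by rw [hw]; ring
    rw [h1] at h
    have hs : Complex.sin (Real.pi * (w + 1 / 2)) ≠ 0 := by
      intro h0
      rw [h0, div_zero] at h
      have hs2 : w + 1 / 2 ∈ Complex.slitPlane := by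
        rw [Complex.mem_slitPlane_iff]; right
        simp [hwi, hz0.ne']
      rcases mul_eq_zero.1 h with h | h
      · rw [← exp_logGamma hs2] at h; exact Complex.exp_ne_zero _ h
      · rw [← exp_logGamma m2] at h; exact Complex.exp_ne_zero _ h
    rw [mul_comm (Complex.Gamma (1 / 4 - _)), h, div_mul_cancel₀ _ hs]
  have e4 : ‖Complex.sin (Real.pi * (w + 1 / 2))‖ ≤ Real.exp (Real.pi * z.re / 2) := by
    rw [Complex.sin]
    rw [norm_div, norm_mul, Complex.norm_I, mul_one, Complex.norm_ofNat, div_le_iff₀ two_pos]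
    refine (norm_sub_le _ _).trans ?_
    rw [Complex.norm_exp, Complex.norm_exp]
    have i1 : (-(Real.pi * (w + 1 / 2)) * Complex.I).re = Real.pi * z.re / 2 := by
      simp [hwi]; ring
    have i2 : (Real.pi * (w + 1 / 2) * Complex.I).re = -(Real.pi * z.re / 2) := by
      simp [hwi]; ring
    rw [i1, i2]
    have : Real.exp (-(Real.pi * z.re / 2)) ≤ Real.exp (Real.pi * z.re / 2) :=
      Real.exp_le_exp.2 (by have := mul_pos Real.pi_pos hz0; linarith)
    linarith
  have e5 : ‖Complex.Gamma (w + 1 / 2)‖ ≤ Real.exp 2 * Real.sqrt ‖w‖ * ‖Complex.Gamma w‖ := by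
    refine le_of_sq_le_sq ?_ (by positivity)
    refine (norm_Gamma_add_half_sq_le (by rw [hwi, abs_of_pos] <;> linarith)).trans_eq ?_
    rw [mul_pow, mul_pow, Real.sq_sqrt (norm_nonneg _), ← Real.exp_nat_mul]
    norm_num
  have e6 := congrArg norm e3
  rw [norm_mul, norm_mul, Complex.norm_real, Real.norm_of_nonneg Real.pi_pos.le] at e6
  have e7 : Real.pi ≤ ‖Complex.Gamma (1 / 4 - Complex.I * (z / 2))‖ *
      (Real.exp 2 * Real.sqrt ‖w‖ * ‖Complex.Gamma w‖) * Real.exp (Real.pi * z.re / 2) := by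
    refine e6.symm.le.trans ?_
    gcongr
  have e8 : Real.pi ≤ (Real.exp 2 * Real.exp (Real.pi * z.re / 2) * Real.sqrt ‖w‖ *
      ‖gammaGeom z‖ ^ 2) * Real.sqrt Real.pi := by
    calc _ ≤ _ := e7
      _ = Real.exp 2 * Real.exp (Real.pi * z.re / 2) * Real.sqrt ‖w‖ * (‖Complex.Gamma w‖ *
        ‖Complex.Gamma (1 / 4 - Complex.I * (z / 2))‖) := by ring
      _ = _ := by rw [← e2]; ring
  have hsp : 1 ≤ Real.sqrt Real.pi := Real.one_le_sqrt.2 (by linarith [Real.pi_gt_three])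
  nlinarith [Real.mul_self_sqrt Real.pi_pos.le]

/-! ### Crude bounds for ζ and for its truncated Dirichlet series -/

/-- The fractional part, cut off to `(1, ∞)`. -/
noncomputable def fractCut : ℝ → ℂ := (Set.Ioi (1 : ℝ)).indicator fun x => ((Int.fract x : ℝ) : ℂ)

theorem norm_fractCut_le (x : ℝ) : ‖fractCut x‖ ≤ 1 := by
  rw [fractCut]
  refine (Set.indicator_le_self' (f := fun x => ‖((Int.fract x : ℝ) : ℂ)‖) (s := Set.Ioi 1)
    (fun _ _ => norm_nonneg _) x |> fun h => ?_)
  rw [norm_indicator_eq_indicator_norm]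
  refine h.trans ?_
  beta_reduce
  rw [Complex.norm_real, Real.norm_of_nonneg (Int.fract_nonneg x)]
  exact (Int.fract_lt_one x).le

theorem measurable_fractCut : Measurable fractCut :=
  Measurable.indicator (Complex.measurable_ofReal.comp measurable_fract) measurableSet_Ioi

/-- The function vanishes near 0, so only boundedness at infinity restricts s. The Mellin form
supplies holomorphy in s without differentiating under the integral. -/
theorem differentiableAt_mellin_fractCut {s : ℂ} (hs : s.re < 0) :
    DifferentiableAt ℂ (mellin fractCut) s := by
  refine mellin_differentiableAt_of_isBigO_rpow (a := 0) (b := s.re - 1) ?_ ?_ hs ?_ (by linarith)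
  · refine LocallyIntegrable.locallyIntegrableOn ?_ _
    refine (locallyIntegrable_const (1 : ℝ)).mono measurable_fractCut.aestronglyMeasurable ?_
    exact Eventually.of_forall fun x => by simpa using norm_fractCut_le x
  · refine Asymptotics.IsBigO.of_bound 1 (Eventually.of_forall fun x => ?_)
    simpa using norm_fractCut_le x
  · refine Asymptotics.IsBigO.of_bound 1 ?_
    filter_upwards [mem_nhdsWithin_of_mem_nhds (Iio_mem_nhds one_pos)] with x hx
    have : fractCut x = 0 := Set.indicator_of_notMem (by simpa using (le_of_lt hx)) _
    rw [this, norm_zero]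
    positivity

theorem mellin_fractCut_neg (s : ℂ) : mellin fractCut (-s) =
    ∫ t in Set.Ioi (1 : ℝ), ((Int.fract t : ℝ) : ℂ) * (t : ℂ) ^ (-(s + 1)) := by
  have h : ∀ t : ℝ, (t : ℂ) ^ (-s - 1) • fractCut t =
      (Set.Ioi (1 : ℝ)).indicator (fun t : ℝ => ((Int.fract t : ℝ) : ℂ) * (t : ℂ) ^ (-(s + 1))) t := by
    intro t
    by_cases ht : t ∈ Set.Ioi (1 : ℝ)
    · rw [Set.indicator_of_mem ht, fractCut, Set.indicator_of_mem ht, smul_eq_mul, mul_comm]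
      congr 2; ring
    · rw [Set.indicator_of_notMem ht, fractCut, Set.indicator_of_notMem ht, smul_zero]
  rw [mellin]
  simp_rw [h]
  rw [setIntegral_indicator measurableSet_Ioi]
  congr 2
  rw [Set.inter_eq_right]
  exact Set.Ioi_subset_Ioi zero_le_one

theorem norm_fract_mul_cpow_le (s : ℂ) {t : ℝ} (ht : t ∈ Set.Ioi (1 : ℝ)) :
    ‖((Int.fract t : ℝ) : ℂ) * (t : ℂ) ^ (-(s + 1))‖ ≤ t ^ (-s.re - 1) := by
  have ht0 : (0 : ℝ) < t := zero_lt_one.trans ht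
  rw [norm_mul, Complex.norm_cpow_eq_rpow_re_of_pos ht0, Complex.norm_real,
    Real.norm_of_nonneg (Int.fract_nonneg t)]
  have e : (-(s + 1)).re = -s.re - 1 := by simp; ring
  rw [e]
  exact mul_le_of_le_one_left (Real.rpow_nonneg ht0.le _) (Int.fract_lt_one t).le

theorem integrableOn_fract_mul_cpow {s : ℂ} (hs : 0 < s.re) :
    IntegrableOn (fun t : ℝ => ((Int.fract t : ℝ) : ℂ) * (t : ℂ) ^ (-(s + 1))) (Set.Ioi 1) := by
  refine (integrableOn_Ioi_rpow_of_lt (a := -s.re - 1) (by linarith) one_pos).mono' ?_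
    (ae_restrict_of_forall_mem measurableSet_Ioi fun t ht => norm_fract_mul_cpow_le s ht)
  refine AEStronglyMeasurable.mul (Complex.measurable_ofReal.comp measurable_fract).aestronglyMeasurable ?_
  refine ContinuousOn.aestronglyMeasurable (fun t ht => ?_) measurableSet_Ioi
  have ht0 : (0 : ℝ) < t := zero_lt_one.trans ht
  exact (Complex.continuousAt_ofReal_cpow_const _ _ (Or.inr ht0.ne')).continuousWithinAt

theorem norm_mellin_fractCut_neg_le {s : ℂ} (hs : 0 < s.re) :
    ‖mellin fractCut (-s)‖ ≤ 1 / s.re := by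
  rw [mellin_fractCut_neg]
  refine (norm_integral_le_of_norm_le (integrableOn_Ioi_rpow_of_lt (a := -s.re - 1)
    (by linarith) one_pos) (ae_restrict_of_forall_mem measurableSet_Ioi fun t ht =>
      norm_fract_mul_cpow_le s ht)).trans_eq ?_
  rw [integral_Ioi_rpow_of_lt (by linarith) one_pos, Real.one_rpow]
  have : -s.re - 1 + 1 = -s.re := by ring
  rw [this]; field_simp

/-- Abel summation with ⌊t⌋ = t - {t} gives ζ(s) = s/(s-1) - s∫{t}t^{-s-1}dt, and s/(s-1) = 1 +
1/(s-1). -/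
theorem riemannZeta₀_eq_of_one_lt_re {s : ℂ} (hs : 1 < s.re) :
    riemannZeta₀ s = 1 - s * mellin fractCut (-s) := by
  have hs1 : s ≠ 1 := by rintro rfl; simp at hs
  have hs1' : s - 1 ≠ 0 := sub_ne_zero.2 hs1
  have h := LSeries_eq_mul_integral' (fun _ => 1) zero_le_one hs (by
    simpa using Asymptotics.isBigO_refl (fun n : ℕ => (n : ℝ)) atTop)
  have hz : LSeries (fun _ => 1) s = riemannZeta s := LSeries_one_eq_riemannZeta hs
  rw [hz] at h
  have hint : ∀ t ∈ Set.Ioi (1 : ℝ), (∑ _k ∈ Finset.Icc 1 ⌊t⌋₊, (1 : ℂ)) * (t : ℂ) ^ (-(s + 1)) =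
      (t : ℂ) ^ (-s) - ((Int.fract t : ℝ) : ℂ) * (t : ℂ) ^ (-(s + 1)) := by
    intro t ht
    have ht0 : (0 : ℝ) < t := zero_lt_one.trans ht
    have e1 : ((⌊t⌋₊ : ℕ) : ℝ) = t - Int.fract t := by
      rw [natCast_floor_eq_intCast_floor ht0.le, Int.self_sub_fract]
    have e2 : ((⌊t⌋₊ : ℕ) : ℂ) = t - ((Int.fract t : ℝ) : ℂ) := by exact_mod_cast congrArg Complex.ofReal e1
    have e3 : (t : ℂ) ^ (-s) = t * (t : ℂ) ^ (-(s + 1)) := by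
      have : -s = 1 + (-(s + 1)) := by ring
      conv_lhs => rw [this]
      rw [Complex.cpow_add _ _ (by exact_mod_cast ht0.ne'), Complex.cpow_one]
    rw [Finset.sum_const, Nat.card_Icc, nsmul_eq_mul, mul_one, Nat.add_sub_cancel, e2, e3]
    ring
  have hre : (-s).re < -1 := by simp; exact hs
  rw [setIntegral_congr_fun measurableSet_Ioi hint, integral_sub
    (integrableOn_Ioi_cpow_of_lt hre one_pos) (integrableOn_fract_mul_cpow (by linarith)),
    integral_Ioi_cpow_of_lt hre one_pos, ← mellin_fractCut_neg] at h
  rw [riemannZeta₀, if_neg hs1, h]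
  have h2 : -s + 1 ≠ 0 := fun h => hs1' (by linear_combination -h)
  simp only [Complex.ofReal_one, Complex.one_cpow]
  field_simp
  ring

theorem riemannZeta₀_eq {s : ℂ} (hs : 0 < s.re) :
    riemannZeta₀ s = 1 - s * mellin fractCut (-s) := by
  have hU : IsPreconnected {s : ℂ | 0 < s.re} := (convex_halfSpace_re_gt 0).isPreconnected
  have hf : AnalyticOnNhd ℂ riemannZeta₀ {s : ℂ | 0 < s.re} :=
    differentiable_riemannZeta₀.differentiableOn.analyticOnNhd isOpen_re_pos
  have hg : AnalyticOnNhd ℂ (fun s => 1 - s * mellin fractCut (-s)) {s : ℂ | 0 < s.re} := by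
    refine DifferentiableOn.analyticOnNhd (fun s hs => ?_) isOpen_re_pos
    have h1 := (differentiableAt_mellin_fractCut (s := -s) (by simpa using hs)).comp s
      differentiableAt_id.neg
    exact ((differentiableAt_id.mul h1).const_sub 1).differentiableWithinAt
  refine hf.eqOn_of_preconnected_of_eventuallyEq hg hU (z₀ := 2) (by simp) ?_ hs
  filter_upwards [(isOpen_lt continuous_const Complex.continuous_re).mem_nhds
    (show (2 : ℂ) ∈ {s : ℂ | 1 < s.re} by simp)] with s hs
  exact riemannZeta₀_eq_of_one_lt_re hs

theorem norm_riemannZeta_le {s : ℂ} (hs : 1 / 2 ≤ s.re) (hi : 1 ≤ |s.im|) :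
    ‖riemannZeta s‖ ≤ 2 + 2 * ‖s‖ := by
  have hs1 : s ≠ 1 := by rintro rfl; simp at hi; linarith
  rw [riemannZeta_eq_inv_sub_add hs1, riemannZeta₀_eq (by linarith)]
  have h1 : ‖(s - 1)⁻¹‖ ≤ 1 := by
    rw [norm_inv]
    refine inv_le_one_of_one_le₀ (hi.trans ?_)
    simpa using Complex.abs_im_le_norm (s - 1)
  have h2 := norm_mellin_fractCut_neg_le (s := s) (by linarith)
  have h3 : 1 / s.re ≤ 2 := by
    rw [div_le_iff₀ (by linarith)]; linarith
  have h4 : ‖1 - s * mellin fractCut (-s)‖ ≤ 1 + ‖s‖ * 2 := by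
    refine (norm_sub_le _ _).trans ?_
    rw [norm_one, norm_mul]
    gcongr
    exact h2.trans h3
  refine (norm_add_le _ _).trans ?_
  linarith

theorem norm_natCast_cpow_neg {n : ℕ} (hn : n ≠ 0) (s : ℂ) : ‖(n : ℂ) ^ (-s)‖ = (n : ℝ) ^ (-s.re) := by
  have := Complex.norm_cpow_eq_rpow_re_of_pos (show (0 : ℝ) < n by positivity) (-s)
  simpa using this

/-- For Re s ≤ 2 the power of N is at least 1 and ζ and the sum are bounded separately. For Re s > 2
the tail term at n + N + 1 is at most N^{2 - Re s} (n+1)^{-2}. What matters is the factor N^{-Re s},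
which later offsets the growth of exp(±iθ). -/
theorem norm_riemannZeta_sub_sum_le {s : ℂ} (hs : 1 / 2 ≤ s.re) (hi : 1 ≤ |s.im|) {N : ℕ}
    (hN : 1 ≤ N) :
    ‖riemannZeta s - ∑ n ∈ Finset.Icc 1 N, (n : ℂ) ^ (-s)‖ ≤
      (4 + 2 * ‖s‖ + N) * (N : ℝ) ^ (2 - s.re) := by
  have hN1 : (1 : ℝ) ≤ N := by exact_mod_cast hN
  rcases le_or_gt s.re 2 with h2 | h2
  · have hpow : 1 ≤ (N : ℝ) ^ (2 - s.re) := Real.one_le_rpow hN1 (by linarith)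
    have hsum : ‖∑ n ∈ Finset.Icc 1 N, (n : ℂ) ^ (-s)‖ ≤ N := by
      refine (norm_sum_le_of_le (f := fun n : ℕ => (n : ℂ) ^ (-s)) _ (n := fun _ => (1 : ℝ)) fun n hn => ?_).trans_eq (by simp)
      have hn1 := (Finset.mem_Icc.1 hn).1
      rw [norm_natCast_cpow_neg (by omega)]
      exact Real.rpow_le_one_of_one_le_of_nonpos (by exact_mod_cast hn1) (by linarith)
    refine (norm_sub_le _ _).trans ?_
    have := norm_riemannZeta_le hs hi
    calc _ ≤ (4 + 2 * ‖s‖ + N) * 1 := by linarith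
      _ ≤ _ := by gcongr
  · have hsumm : Summable fun n : ℕ => 1 / ((n : ℂ) + 1) ^ s := by
      have := (summable_nat_add_iff 1).2 (Complex.summable_one_div_nat_cpow.2 (by linarith : 1 < s.re))
      simpa using this
    rw [zeta_eq_tsum_one_div_nat_add_one_cpow (by linarith), ← hsumm.sum_add_tsum_nat_add N]
    have e : ∑ n ∈ Finset.range N, 1 / ((n : ℂ) + 1) ^ s = ∑ n ∈ Finset.Icc 1 N, (n : ℂ) ^ (-s) := by
      rw [Finset.range_eq_Ico]
      refine Eq.trans ?_ (Finset.sum_Ico_add' (fun n : ℕ => (n : ℂ) ^ (-s)) 0 N 1)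
      refine Finset.sum_congr rfl fun n _ => ?_
      rw [Complex.cpow_neg, one_div]; push_cast; rfl
    rw [e, add_sub_cancel_left]
    have hS : HasSum (fun n : ℕ => 1 / ((n : ℝ) + 1) ^ 2) (Real.pi ^ 2 / 6) := by
      have := (hasSum_nat_add_iff' 1).2 hasSum_zeta_two
      simpa using this
    have hb : ∀ n : ℕ, ‖1 / (((n + N : ℕ) : ℂ) + 1) ^ s‖ ≤
        (N : ℝ) ^ (2 - s.re) * (1 / ((n : ℝ) + 1) ^ 2) := by
      intro n
      have h1 := norm_natCast_cpow_neg (n := n + N + 1) (by omega) s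
      rw [Complex.cpow_neg] at h1
      push_cast at h1 ⊢
      rw [one_div, h1]
      have hp : (0 : ℝ) < (n : ℝ) + N + 1 := by positivity
      have h3 : ((n : ℝ) + N + 1) ^ (-s.re) = ((n : ℝ) + N + 1) ^ (2 - s.re) *
          (1 / ((n : ℝ) + N + 1) ^ 2) := by
        rw [Real.rpow_sub hp, Real.rpow_neg hp.le]
        norm_cast
        field_simp
      rw [h3]
      have hn0 : (0 : ℝ) ≤ n := n.cast_nonneg
      refine mul_le_mul (Real.rpow_le_rpow_of_nonpos (by linarith) (by linarith) (by linarith)) ?_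
        (by positivity) (by positivity)
      gcongr
      linarith
    have h4 := tsum_of_norm_bounded (hS.mul_left _) hb
    refine h4.trans ?_
    rw [mul_comm]
    gcongr
    have := Real.pi_lt_d2
    have h0 := norm_nonneg s
    nlinarith [Real.pi_gt_three]

/-! ### The completed zeta function through rotated theta series and incomplete Gamma integrals -/

/-- The theta series `∑_{n ∈ ℤ} exp (-π n² a)`. -/
noncomputable def thetaSum (a : ℂ) : ℂ := jacobiTheta (Complex.I * a)

theorem thetaSum_inv {a : ℂ} (ha : 0 < a.re) :
    thetaSum a = 1 / a ^ (1 / 2 : ℂ) * thetaSum (1 / a) := by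
  have h := Complex.tsum_exp_neg_mul_int_sq ha
  have e : ∀ b : ℂ, thetaSum b = ∑' n : ℤ, Complex.exp (-Real.pi * b * (n : ℂ) ^ 2) := by
    intro b
    rw [thetaSum, jacobiTheta]
    refine tsum_congr fun n => ?_
    congr 1
    linear_combination (Real.pi * n ^ 2 * b : ℂ) * Complex.I_mul_I
  rw [e, e, h]
  congr 1
  refine tsum_congr fun n => ?_
  congr 1; ring

theorem inv_re_pos {a : ℂ} (ha : 0 < a.re) : 0 < (1 / a).re := by
  have h0 : a ≠ 0 := by rintro rfl; simp at ha
  rw [one_div, Complex.inv_re]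
  exact div_pos ha (Complex.normSq_pos.2 h0)

theorem locallyIntegrableOn_thetaSum_mul {a : ℂ} (ha : 0 < a.re) :
    LocallyIntegrableOn (fun x : ℝ => thetaSum (a * x)) (Set.Ioi 0) := by
  refine ContinuousOn.locallyIntegrableOn (fun x hx => ?_) measurableSet_Ioi
  have hx0 : (0 : ℝ) < x := hx
  have : 0 < (Complex.I * (a * x)).im := by simp; positivity
  refine ContinuousAt.continuousWithinAt ?_
  exact ContinuousAt.comp (g := jacobiTheta) (f := fun x : ℝ => Complex.I * (a * (x : ℂ)))
    (continuousAt_jacobiTheta this) (by fun_prop)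

theorem isBigO_thetaSum_mul_sub_one {a : ℂ} (ha : 0 < a.re) (r : ℝ) :
    (fun x : ℝ => thetaSum (a * x) - 1) =O[atTop] (fun x : ℝ => x ^ r) := by
  have h1 : (fun x : ℝ => thetaSum (a * x) - 1) =O[atTop]
      fun x : ℝ => Real.exp (-(Real.pi * a.re) * x) := by
    have ht : Tendsto (fun x : ℝ => Complex.I * (a * x)) atTop (comap Complex.im atTop) := by
      rw [tendsto_comap_iff]
      have : (Complex.im ∘ fun x : ℝ => Complex.I * (a * x)) = fun x => a.re * x := by
        funext x; simp
      rw [this]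
      exact tendsto_id.const_mul_atTop ha
    have := isBigO_at_im_infty_jacobiTheta_sub_one.comp_tendsto ht
    refine this.congr (fun x => rfl) fun x => ?_
    simp; ring
  exact h1.trans (isLittleO_exp_neg_mul_rpow_atTop (by positivity) r).isBigO

theorem mul_ofReal_cpow {a : ℂ} (ha : 0 < a.re) {x : ℝ} (hx : 0 < x) (s : ℂ) :
    (a * x) ^ s = a ^ s * (x : ℂ) ^ s := by
  have h0 : a ≠ 0 := by rintro rfl; simp at ha
  have hx0 : (x : ℂ) ≠ 0 := by exact_mod_cast hx.ne'
  rw [Complex.cpow_def_of_ne_zero (mul_ne_zero h0 hx0), Complex.cpow_def_of_ne_zero h0,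
    Complex.cpow_def_of_ne_zero hx0, ← Complex.exp_add, mul_comm a, Complex.log_ofReal_mul hx h0,
    Complex.ofReal_log hx.le]
  congr 1; ring

theorem inv_cpow_of_re_pos {a : ℂ} (ha : 0 < a.re) (s : ℂ) : (1 / a) ^ s = (a ^ s)⁻¹ := by
  rw [one_div, Complex.inv_cpow]
  have := Complex.abs_arg_lt_pi_div_two_iff.2 (Or.inl ha)
  intro h
  rw [h, abs_of_pos Real.pi_pos] at this
  linarith [Real.pi_pos]

/-- The pair of rotated theta functions, with its functional equation. -/
noncomputable def thetaPair (a : ℂ) (ha : 0 < a.re) : WeakFEPair ℂ where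
  f := fun x => thetaSum (a * x)
  g := fun x => thetaSum (1 / a * x)
  k := 1 / 2
  ε := 1 / a ^ (1 / 2 : ℂ)
  f₀ := 1
  g₀ := 1
  hf_int := locallyIntegrableOn_thetaSum_mul ha
  hg_int := locallyIntegrableOn_thetaSum_mul (inv_re_pos ha)
  hk := by norm_num
  hε := by
    have h0 : a ≠ 0 := by rintro rfl; simp at ha
    simp [Complex.cpow_eq_zero_iff, h0]
  h_feq := fun x hx => by
    have hx0 : (0 : ℝ) < x := hx
    have h0 : a ≠ 0 := by rintro rfl; simp at ha
    have hre : 0 < (a * ((1 / x : ℝ) : ℂ)).re := by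
      rw [Complex.re_mul_ofReal]; positivity
    rw [thetaSum_inv hre, mul_ofReal_cpow ha (by positivity), smul_eq_mul]
    have e1 : 1 / (a * ((1 / x : ℝ) : ℂ)) = 1 / a * x := by
      push_cast; field_simp
    have e2 : (((1 / x : ℝ) : ℂ) ^ (1 / 2 : ℂ)) = (((x ^ (1 / 2 : ℝ) : ℝ) : ℂ))⁻¹ := by
      have := Complex.ofReal_cpow (x := 1 / x) (by positivity) (1 / 2 : ℝ)
      push_cast at this
      push_cast
      rw [← this, Real.div_rpow zero_le_one hx0.le, Real.one_rpow]
      push_cast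
      rw [one_div]
    rw [e1, e2]
    field_simp
  hf_top := isBigO_thetaSum_mul_sub_one ha
  hg_top := isBigO_thetaSum_mul_sub_one (inv_re_pos ha)

/-- The integrand of the Gamma integral along a rotated ray. -/
noncomputable def gaussTerm (a : ℂ) (n : ℕ) (w : ℂ) (x : ℝ) : ℂ :=
  (x : ℂ) ^ (w - 1) * Complex.exp (-((Real.pi * ((n : ℂ) + 1) ^ 2 * a) * x))

theorem gauss_coeff_re {a : ℂ} (n : ℕ) :
    ((Real.pi : ℂ) * ((n : ℂ) + 1) ^ 2 * a).re = Real.pi * ((n : ℝ) + 1) ^ 2 * a.re := by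
  have : ((Real.pi : ℂ) * ((n : ℂ) + 1) ^ 2) = ((Real.pi * ((n : ℝ) + 1) ^ 2 : ℝ) : ℂ) := by push_cast; rfl
  rw [this, Complex.re_ofReal_mul]

theorem gauss_coeff_im {a : ℂ} (n : ℕ) :
    ((Real.pi : ℂ) * ((n : ℂ) + 1) ^ 2 * a).im = Real.pi * ((n : ℝ) + 1) ^ 2 * a.im := by
  have : ((Real.pi : ℂ) * ((n : ℂ) + 1) ^ 2) = ((Real.pi * ((n : ℝ) + 1) ^ 2 : ℝ) : ℂ) := by push_cast; rfl
  rw [this, Complex.im_ofReal_mul]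

theorem norm_gaussTerm {a : ℂ} (n : ℕ) (w : ℂ) {x : ℝ} (hx : 0 < x) :
    ‖gaussTerm a n w x‖ = x ^ (w.re - 1) * Real.exp (-(Real.pi * ((n : ℝ) + 1) ^ 2 * a.re * x)) := by
  rw [gaussTerm, norm_mul, Complex.norm_cpow_eq_rpow_re_of_pos hx, Complex.norm_exp, Complex.neg_re,
    Complex.re_mul_ofReal, gauss_coeff_re]
  simp

theorem continuousOn_gaussTerm (a : ℂ) (n : ℕ) (w : ℂ) :
    ContinuousOn (gaussTerm a n w) (Set.Ioi 0) := by
  intro x hx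
  have hx0 : (0 : ℝ) < x := hx
  refine ContinuousAt.continuousWithinAt (ContinuousAt.mul
    (Complex.continuousAt_ofReal_cpow_const _ _ (Or.inr hx0.ne')) ?_)
  fun_prop

theorem integrableOn_rpow_mul_exp {c v : ℝ} (hc : 0 < c) (hv : 0 < v) :
    IntegrableOn (fun x : ℝ => x ^ (v - 1) * Real.exp (-(c * x))) (Set.Ioi 0) := by
  have := integrableOn_rpow_mul_exp_neg_mul_rpow (s := v - 1) (p := 1) (by linarith) one_pos hc
  simpa using this

/-- For x > 1 the exponent Re w may be raised to max(Re w, 1). This makes the bound valid for every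
w and summable over n. -/
theorem integrableOn_gaussTerm_Ioi_one {a : ℂ} (ha : 0 < a.re) (n : ℕ) (w : ℂ) :
    IntegrableOn (gaussTerm a n w) (Set.Ioi 1) ∧
    ∫ x in Set.Ioi (1 : ℝ), ‖gaussTerm a n w x‖ ≤
      (1 / (Real.pi * ((n : ℝ) + 1) ^ 2 * a.re)) ^ (max w.re 1) * Real.Gamma (max w.re 1) := by
  have hc : 0 < Real.pi * ((n : ℝ) + 1) ^ 2 * a.re := by have := Real.pi_pos; positivity
  have hv : 0 < max w.re 1 := lt_max_of_lt_right one_pos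
  have hi := integrableOn_rpow_mul_exp hc hv
  have hsub : Set.Ioi (1 : ℝ) ⊆ Set.Ioi 0 := Set.Ioi_subset_Ioi zero_le_one
  have hb : ∀ x ∈ Set.Ioi (1 : ℝ), ‖gaussTerm a n w x‖ ≤
      x ^ (max w.re 1 - 1) * Real.exp (-(Real.pi * ((n : ℝ) + 1) ^ 2 * a.re * x)) := by
    intro x hx
    rw [norm_gaussTerm n w (hsub hx)]
    gcongr
    · exact (le_of_lt hx)
    · exact le_max_left _ _
  have h1 : IntegrableOn (gaussTerm a n w) (Set.Ioi 1) :=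
    (hi.mono_set hsub).mono' ((continuousOn_gaussTerm a n w).mono hsub |>.aestronglyMeasurable
      measurableSet_Ioi) (ae_restrict_of_forall_mem measurableSet_Ioi hb)
  refine ⟨h1, ?_⟩
  rw [← Real.integral_rpow_mul_exp_neg_mul_Ioi hv hc]
  refine (setIntegral_mono_on h1.norm (hi.mono_set hsub) measurableSet_Ioi hb).trans ?_
  refine setIntegral_mono_set hi (ae_restrict_of_forall_mem measurableSet_Ioi fun x hx => ?_)
    hsub.eventuallyLE
  have hx0 : (0 : ℝ) < x := hx
  positivity

theorem integrableOn_gaussTerm {a : ℂ} (ha : 0 < a.re) (n : ℕ) {w : ℂ} (hw : 0 < w.re) :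
    IntegrableOn (gaussTerm a n w) (Set.Ioi 0) ∧
    ∫ x in Set.Ioi (0 : ℝ), ‖gaussTerm a n w x‖ =
      (1 / (Real.pi * ((n : ℝ) + 1) ^ 2 * a.re)) ^ w.re * Real.Gamma w.re := by
  have hc : 0 < Real.pi * ((n : ℝ) + 1) ^ 2 * a.re := by have := Real.pi_pos; positivity
  have hi := integrableOn_rpow_mul_exp hc hw
  have hb : ∀ x ∈ Set.Ioi (0 : ℝ), ‖gaussTerm a n w x‖ =
      x ^ (w.re - 1) * Real.exp (-(Real.pi * ((n : ℝ) + 1) ^ 2 * a.re * x)) :=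
    fun x hx => norm_gaussTerm n w hx
  refine ⟨hi.mono' ((continuousOn_gaussTerm a n w).aestronglyMeasurable
      measurableSet_Ioi) (ae_restrict_of_forall_mem measurableSet_Ioi fun x hx => (hb x hx).le), ?_⟩
  rw [← Real.integral_rpow_mul_exp_neg_mul_Ioi hw hc]
  exact setIntegral_congr_fun measurableSet_Ioi hb

theorem summable_gauss_bound {c v : ℝ} (hc : 0 < c) (hv : 1 / 2 < v) (G : ℝ) :
    Summable fun n : ℕ => (1 / (Real.pi * ((n : ℝ) + 1) ^ 2 * c)) ^ v * G := by
  refine Summable.mul_right _ ?_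
  have h := (summable_nat_add_iff 1).2 (Real.summable_nat_rpow (p := -(2 * v)) |>.2 (by linarith))
  refine (h.mul_left ((1 / (Real.pi * c)) ^ v)).congr fun n => ?_
  have hn : (0 : ℝ) ≤ (n : ℝ) + 1 := by positivity
  have hp := Real.pi_pos
  have e : 1 / (Real.pi * ((n : ℝ) + 1) ^ 2 * c) = 1 / (Real.pi * c) * (((n : ℝ) + 1) ^ 2)⁻¹ := by
    field_simp
  rw [e, Real.mul_rpow (by positivity) (by positivity), Real.inv_rpow (by positivity),
    Real.rpow_neg (by positivity), Real.rpow_mul (by positivity)]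
  push_cast
  norm_cast

theorem hasSum_thetaSum {a : ℂ} (ha : 0 < a.re) (w : ℂ) {x : ℝ} (hx : 0 < x) :
    HasSum (fun n => gaussTerm a n w x) ((x : ℂ) ^ (w - 1) * ((thetaSum (a * x) - 1) / 2)) := by
  have h := hasSum_nat_jacobiTheta (τ := Complex.I * (a * x)) (by simp; positivity)
  refine (h.mul_left ((x : ℂ) ^ (w - 1))).congr_fun fun n => ?_
  rw [gaussTerm]
  congr 2
  linear_combination -(Real.pi * ((n : ℂ) + 1) ^ 2 * a * x : ℂ) * Complex.I_mul_I

theorem hasSum_integral_gaussTerm {a : ℂ} (ha : 0 < a.re) (w : ℂ) {S : Set ℝ}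
    (hS : MeasurableSet S) (hS0 : S ⊆ Set.Ioi 0) (hi : ∀ n, IntegrableOn (gaussTerm a n w) S)
    (hsum : Summable fun n => ∫ x in S, ‖gaussTerm a n w x‖) :
    HasSum (fun n => ∫ x in S, gaussTerm a n w x)
      (∫ x in S, (x : ℂ) ^ (w - 1) * ((thetaSum (a * x) - 1) / 2)) := by
  have h := hasSum_integral_of_summable_integral_norm hi hsum
  have e : ∫ x in S, (x : ℂ) ^ (w - 1) * ((thetaSum (a * x) - 1) / 2) =
      ∫ x in S, ∑' n, gaussTerm a n w x :=
    setIntegral_congr_fun hS fun x hx => (hasSum_thetaSum ha w (hS0 hx)).tsum_eq.symm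
  rwa [e]

theorem norm_cpow_mul_exp {x : ℝ} (hx : 0 < x) (w r : ℂ) :
    ‖(x : ℂ) ^ (w - 1) * Complex.exp (-(r * x))‖ = x ^ (w.re - 1) * Real.exp (-(r.re * x)) := by
  rw [norm_mul, Complex.norm_cpow_eq_rpow_re_of_pos hx, Complex.norm_exp, Complex.neg_re,
    Complex.re_mul_ofReal]
  simp

theorem continuousOn_cpow_mul_exp (w r : ℂ) :
    ContinuousOn (fun x : ℝ => (x : ℂ) ^ (w - 1) * Complex.exp (-(r * x))) (Set.Ioi 0) := by
  intro x hx
  have hx0 : (0 : ℝ) < x := hx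
  refine ContinuousAt.continuousWithinAt (ContinuousAt.mul
    (Complex.continuousAt_ofReal_cpow_const _ _ (Or.inr hx0.ne')) ?_)
  fun_prop

theorem integrableOn_cpow_mul_exp {w r : ℂ} (hw : 0 < w.re) (hr : 0 < r.re) :
    IntegrableOn (fun x : ℝ => (x : ℂ) ^ (w - 1) * Complex.exp (-(r * x))) (Set.Ioi 0) :=
  (integrableOn_rpow_mul_exp hr hw).mono'
    ((continuousOn_cpow_mul_exp w r).aestronglyMeasurable measurableSet_Ioi)
    (ae_restrict_of_forall_mem measurableSet_Ioi fun _ hx => (norm_cpow_mul_exp hx w r).le)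

/-- Both sides are holomorphic in r on the right half plane and agree for real r > 0; the identity
theorem applies because the real points accumulate at 1. -/
theorem integral_cpow_mul_exp_neg_mul {w r : ℂ} (hw : 0 < w.re) (hr : 0 < r.re) :
    ∫ x in Set.Ioi (0 : ℝ), (x : ℂ) ^ (w - 1) * Complex.exp (-(r * x)) =
      r ^ (-w) * Complex.Gamma w := by
  have hf : AnalyticOnNhd ℂ (fun r : ℂ =>
      ∫ x in Set.Ioi (0 : ℝ), (x : ℂ) ^ (w - 1) * Complex.exp (-(r * x))) {s : ℂ | 0 < s.re} := by
    refine DifferentiableOn.analyticOnNhd (fun r hr => ?_) isOpen_re_pos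
    have hr0 : 0 < r.re := hr
    refine DifferentiableAt.differentiableWithinAt ?_
    have hball : ∀ y ∈ Metric.ball r (r.re / 2), r.re / 2 ≤ y.re := by
      intro y hy
      have h1 : ‖y - r‖ < r.re / 2 := by simpa [dist_eq_norm] using hy
      have h2 := (abs_le.1 (Complex.abs_re_le_norm (y - r))).1
      simp at h2
      linarith
    have hb := integrableOn_rpow_mul_exp (c := r.re / 2) (v := w.re + 1) (by linarith) (by linarith)
    refine (hasDerivAt_integral_of_dominated_loc_of_deriv_le (𝕜 := ℂ)
      (F := fun (r : ℂ) (x : ℝ) => (x : ℂ) ^ (w - 1) * Complex.exp (-(r * x)))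
      (F' := fun (r : ℂ) (x : ℝ) => (x : ℂ) ^ (w - 1) * (Complex.exp (-(r * x)) * (-x)))
      (bound := fun x => x ^ (w.re + 1 - 1) * Real.exp (-(r.re / 2 * x)))
      (Metric.ball_mem_nhds r (by linarith : 0 < r.re / 2)) ?_
      (integrableOn_cpow_mul_exp hw hr0) ?_ ?_ hb ?_).2.differentiableAt
    · exact Eventually.of_forall fun y =>
        (continuousOn_cpow_mul_exp w y).aestronglyMeasurable measurableSet_Ioi
    · refine ContinuousOn.aestronglyMeasurable (fun x hx => ?_) measurableSet_Ioi
      have hx0 : (0 : ℝ) < x := hx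
      refine ContinuousAt.continuousWithinAt (ContinuousAt.mul
        (Complex.continuousAt_ofReal_cpow_const _ _ (Or.inr hx0.ne')) ?_)
      fun_prop
    · refine ae_restrict_of_forall_mem measurableSet_Ioi fun x hx y hy => ?_
      have hx0 : (0 : ℝ) < x := hx
      rw [← mul_assoc, norm_mul, norm_cpow_mul_exp hx0, norm_neg, Complex.norm_real,
        Real.norm_of_nonneg hx0.le, mul_right_comm]
      have e : x ^ (w.re - 1) * x = x ^ (w.re + 1 - 1) := by
        rw [← Real.rpow_add_one hx0.ne']; congr 1; ring
      rw [e]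
      have := hball y hy
      gcongr
    · refine ae_restrict_of_forall_mem measurableSet_Ioi fun x hx y hy => ?_
      have h1 : HasDerivAt (fun y : ℂ => -(y * x)) (-(x : ℂ)) y := by
        exact ((hasDerivAt_id y).mul_const (x : ℂ)).fun_neg.congr_deriv (by simp)
      exact h1.cexp.const_mul _
  have hg : AnalyticOnNhd ℂ (fun r : ℂ => r ^ (-w) * Complex.Gamma w) {s : ℂ | 0 < s.re} := by
    refine DifferentiableOn.analyticOnNhd (fun r hr => ?_) isOpen_re_pos
    have hr0 : 0 < r.re := hr
    refine DifferentiableAt.differentiableWithinAt (DifferentiableAt.mul_const ?_ _)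
    exact DifferentiableAt.cpow_const differentiableAt_id (Or.inl hr0)
  refine hf.eqOn_of_preconnected_of_frequently_eq hg (convex_halfSpace_re_gt 0).isPreconnected
    (z₀ := 1) (by simp) ?_ hr
  have ht : Tendsto (fun x : ℝ => (x : ℂ)) (𝓝[≠] 1) (𝓝[≠] 1) := by
    refine tendsto_nhdsWithin_iff.2 ⟨?_, ?_⟩
    · exact (Complex.continuous_ofReal.tendsto' 1 1 (by simp)).mono_left nhdsWithin_le_nhds
    · filter_upwards [self_mem_nhdsWithin] with x hx
      simpa using hx
  refine ht.frequently (Eventually.frequently ?_)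
  filter_upwards [mem_nhdsWithin_of_mem_nhds (Ioi_mem_nhds one_pos)] with x hx
  have hx0 : (0 : ℝ) < x := hx
  rw [Complex.integral_cpow_mul_exp_neg_mul_Ioi hw hx0, inv_cpow_of_re_pos (by simpa using hx0),
    Complex.cpow_neg]

theorem gauss_coeff_re_pos {a : ℂ} (ha : 0 < a.re) (n : ℕ) :
    0 < ((Real.pi : ℂ) * ((n : ℂ) + 1) ^ 2 * a).re := by
  rw [gauss_coeff_re]
  have := Real.pi_pos
  positivity

theorem ne_zero_of_re_pos {a : ℂ} (ha : 0 < a.re) : a ≠ 0 := by rintro rfl; simp at ha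

theorem cpow_mul_integral_gaussTerm {a : ℂ} (ha : 0 < a.re) (n : ℕ) {w : ℂ} (hw : 0 < w.re) :
    a ^ w * ∫ x in Set.Ioi (0 : ℝ), gaussTerm a n w x =
      Complex.Gammaℝ (2 * w) * (((n + 1 : ℕ) : ℂ)) ^ (-(2 * w)) := by
  have hr := gauss_coeff_re_pos ha n
  have h := integral_cpow_mul_exp_neg_mul hw hr
  have e : ∫ x in Set.Ioi (0 : ℝ), gaussTerm a n w x =
    (Real.pi * ((n : ℂ) + 1) ^ 2 * a) ^ (-w) * Complex.Gamma w := h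
  have ha0 := ne_zero_of_re_pos ha
  have hn : (0 : ℝ) < (n : ℝ) + 1 := by positivity
  have hcoe : (Real.pi * ((n : ℂ) + 1) ^ 2 * a) = a * ((Real.pi * ((n : ℝ) + 1) ^ 2 : ℝ) : ℂ) := by
    push_cast; ring
  have hsq : ((((n : ℝ) + 1) ^ 2 : ℝ) : ℂ) ^ (-w) = (((n + 1 : ℕ) : ℂ)) ^ (-(2 * w)) := by
    have hn0 : ((n : ℂ) + 1) ≠ 0 := by exact_mod_cast n.succ_ne_zero
    push_cast
    rw [pow_two, show ((n : ℂ) + 1) = (((n : ℝ) + 1 : ℝ) : ℂ) by push_cast; rfl,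
      Complex.mul_cpow_ofReal_nonneg hn.le hn.le, ← Complex.cpow_add _ _ (by exact_mod_cast hn.ne')]
    congr 1; ring
  rw [e, hcoe, mul_ofReal_cpow ha (by have := Real.pi_pos; positivity), Complex.ofReal_mul,
    Complex.mul_cpow_ofReal_nonneg Real.pi_pos.le (by positivity), hsq, Complex.cpow_neg a,
    Complex.Gammaℝ_def, show 2 * w / 2 = w by ring, show -(2 * w) / 2 = -w by ring]
  have : a ^ w ≠ 0 := by simp [Complex.cpow_eq_zero_iff, ha0]
  field_simp

/-- Upper incomplete part of the rotated Gamma integral. -/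
noncomputable def gaussUpper (a : ℂ) (n : ℕ) (w : ℂ) : ℂ :=
  a ^ w * ∫ x in Set.Ioi (1 : ℝ), gaussTerm a n w x

/-- Lower incomplete part of the rotated Gamma integral. -/
noncomputable def gaussLower (a : ℂ) (n : ℕ) (w : ℂ) : ℂ :=
  a ^ w * ∫ x in Set.Ioc (0 : ℝ) 1, gaussTerm a n w x

theorem gaussLower_add_gaussUpper {a : ℂ} (ha : 0 < a.re) (n : ℕ) {w : ℂ} (hw : 0 < w.re) :
    gaussLower a n w + gaussUpper a n w =
      Complex.Gammaℝ (2 * w) * (((n + 1 : ℕ) : ℂ)) ^ (-(2 * w)) := by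
  rw [← cpow_mul_integral_gaussTerm ha n hw, gaussLower, gaussUpper, ← mul_add]
  congr 1
  have hi := (integrableOn_gaussTerm ha n hw).1
  rw [← Set.Ioc_union_Ioi_eq_Ioi zero_le_one, setIntegral_union Set.Ioc_disjoint_Ioi_same
    measurableSet_Ioi (hi.mono_set Set.Ioc_subset_Ioi_self)
    (hi.mono_set (Set.Ioi_subset_Ioi zero_le_one))]

/-- The Mellin transform of the part of the theta function beyond `1`. -/
noncomputable def thetaTail (a : ℂ) (w : ℂ) : ℂ :=
  mellin ((Set.Ioi (1 : ℝ)).indicator fun x => thetaSum (a * x) - 1) w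

theorem hasSum_gaussUpper {a : ℂ} (ha : 0 < a.re) (w : ℂ) :
    HasSum (fun n => gaussUpper a n w) (a ^ w * thetaTail a w / 2) := by
  have h := hasSum_integral_gaussTerm ha w measurableSet_Ioi (Set.Ioi_subset_Ioi zero_le_one)
    (fun n => (integrableOn_gaussTerm_Ioi_one ha n w).1)
    (Summable.of_nonneg_of_le (fun n => integral_nonneg fun x => norm_nonneg _)
      (fun n => (integrableOn_gaussTerm_Ioi_one ha n w).2)
      (summable_gauss_bound ha (lt_max_of_lt_right (by norm_num)) _))
  have e : thetaTail a w / 2 =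
      ∫ x in Set.Ioi (1 : ℝ), (x : ℂ) ^ (w - 1) * ((thetaSum (a * x) - 1) / 2) := by
    rw [thetaTail, mellin]
    have h1 : ∀ x : ℝ, (x : ℂ) ^ (w - 1) • (Set.Ioi (1 : ℝ)).indicator
        (fun x : ℝ => thetaSum (a * x) - 1) x = (Set.Ioi (1 : ℝ)).indicator
        (fun x : ℝ => (x : ℂ) ^ (w - 1) * (thetaSum (a * x) - 1)) x := by
      intro x
      by_cases hx : x ∈ Set.Ioi (1 : ℝ) <;> simp [hx]
    simp_rw [h1]
    rw [setIntegral_indicator measurableSet_Ioi,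
      Set.inter_eq_right.2 (Set.Ioi_subset_Ioi zero_le_one), ← integral_div]
    refine setIntegral_congr_fun measurableSet_Ioi fun x _ => ?_
    ring
  rw [mul_div_assoc, e]
  exact h.mul_left _

/-- On (0, 1) the theta functional equation turns the modified function into the tail of the dual
theta series at 1/x, and x ↦ 1/x carries its Mellin transform to an integral over (1, ∞) at 1/2 - w.
-/
theorem thetaPair_Λ₀_eq {a : ℂ} (ha : 0 < a.re) (w : ℂ) :
    (thetaPair a ha).Λ₀ w = thetaTail a w + 1 / a ^ (1 / 2 : ℂ) * thetaTail (1 / a) (1 / 2 - w) := by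
  have hmod : ∀ x ∈ Set.Ioi (0 : ℝ), (thetaPair a ha).f_modif x =
      (Set.Ioi (1 : ℝ)).indicator (fun x : ℝ => thetaSum (a * x) - 1) x +
      (x : ℂ) ^ (-(1 / 2) : ℂ) • ((1 / a ^ (1 / 2 : ℂ)) •
        (Set.Ioi (1 : ℝ)).indicator (fun x : ℝ => thetaSum (1 / a * x) - 1) x⁻¹) := by
    intro x hx
    have hx0 : (0 : ℝ) < x := hx
    simp only [WeakFEPair.f_modif, Pi.add_apply]
    congr 1
    by_cases h1 : x ∈ Set.Ioo (0 : ℝ) 1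
    · have h2 : x⁻¹ ∈ Set.Ioi (1 : ℝ) := (one_lt_inv₀ hx0).2 h1.2
      rw [Set.indicator_of_mem h1, Set.indicator_of_mem h2]
      have h3 := (thetaPair a ha).h_feq x⁻¹ (by simpa using hx0)
      simp only [one_div, inv_inv] at h3
      rw [h3]
      have e : (((x⁻¹ : ℝ) ^ (thetaPair a ha).k : ℝ) : ℂ) = (x : ℂ) ^ (-(1 / 2) : ℂ) := by
        rw [Real.inv_rpow hx0.le, ← Real.rpow_neg hx0.le]
        rw [Complex.ofReal_cpow hx0.le]
        simp [thetaPair]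
      have e2 : (((x : ℝ) ^ (-(thetaPair a ha).k) : ℝ) : ℂ) = (x : ℂ) ^ (-(1 / 2) : ℂ) := by
        rw [Complex.ofReal_cpow hx0.le]
        simp [thetaPair]
      rw [e, e2]
      simp only [thetaPair, smul_eq_mul]
      push_cast
      ring
    · have h2 : x⁻¹ ∉ Set.Ioi (1 : ℝ) := by
        intro h
        exact h1 ⟨hx0, (one_lt_inv₀ hx0).1 h⟩
      rw [Set.indicator_of_notMem h1, Set.indicator_of_notMem h2]
      simp
  have hM : MellinConvergent (thetaPair a ha).f_modif w :=
    ((thetaPair a ha).isStrongFEPair_toStrongFEPair.hasMellin w).1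
  have hA : MellinConvergent ((Set.Ioi (1 : ℝ)).indicator fun x : ℝ => thetaSum (a * x) - 1) w := by
    have h := Integrable.indicator hM (measurableSet_Ioi (a := (1 : ℝ)))
    refine (integrableOn_congr_fun (fun x hx => ?_) measurableSet_Ioi).1 h
    by_cases h1 : x ∈ Set.Ioi (1 : ℝ)
    · have h2 : x ∉ Set.Ioo (0 : ℝ) 1 := fun h => lt_asymm h.2 h1
      simp only [WeakFEPair.f_modif, Pi.add_apply]
      rw [Set.indicator_of_mem h1, Set.indicator_of_mem h1, Set.indicator_of_mem h1,
        Set.indicator_of_notMem h2, add_zero]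
      rfl
    · rw [Set.indicator_of_notMem h1, Set.indicator_of_notMem h1, smul_zero]
  have hB : MellinConvergent (fun x : ℝ => (x : ℂ) ^ (-(1 / 2) : ℂ) • ((1 / a ^ (1 / 2 : ℂ)) •
        (Set.Ioi (1 : ℝ)).indicator (fun x : ℝ => thetaSum (1 / a * x) - 1) x⁻¹)) w := by
    refine (integrableOn_congr_fun (fun x hx => ?_) measurableSet_Ioi).1 (hasMellin_sub hM hA).1
    simp only [hmod x hx]
    congr 1
    rw [add_sub_cancel_left]
  have h := (hasMellin_add hA hB).2
  rw [mellin_cpow_smul, mellin_const_smul, mellin_comp_inv] at h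
  have e : (thetaPair a ha).Λ₀ w = mellin (fun x : ℝ =>
      (Set.Ioi (1 : ℝ)).indicator (fun x : ℝ => thetaSum (a * x) - 1) x +
      (x : ℂ) ^ (-(1 / 2) : ℂ) • ((1 / a ^ (1 / 2 : ℂ)) •
        (Set.Ioi (1 : ℝ)).indicator (fun x : ℝ => thetaSum (1 / a * x) - 1) x⁻¹)) w := by
    refine setIntegral_congr_fun measurableSet_Ioi fun x hx => ?_
    simp only [hmod x hx]
  rw [e, h, thetaTail, thetaTail, smul_eq_mul]
  congr 3
  ring

/-- Termwise integration: rotating the Gamma integral multiplies each term by a^{-w}, so a^w Λ(w)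
does not depend on a. -/
theorem thetaPair_Λ_eq_of_lt {a : ℂ} (ha : 0 < a.re) {w : ℂ} (hw : 1 / 2 < w.re) :
    a ^ w * (thetaPair a ha).Λ w = 2 * completedRiemannZeta (2 * w) := by
  have hw0 : 0 < w.re := by linarith
  have h := hasSum_integral_gaussTerm ha w measurableSet_Ioi subset_rfl
    (fun n => (integrableOn_gaussTerm ha n hw0).1)
    ((summable_gauss_bound ha hw _).congr fun n => (integrableOn_gaussTerm ha n hw0).2.symm)
  have h2 := h.mul_left (a ^ w)
  simp_rw [cpow_mul_integral_gaussTerm ha _ hw0] at h2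
  have h3 : HasSum (fun n : ℕ => ((n + 1 : ℕ) : ℂ) ^ (-(2 * w))) (riemannZeta (2 * w)) := by
    have hs : 1 < (2 * w).re := by simp; linarith
    rw [zeta_eq_tsum_one_div_nat_add_one_cpow hs]
    have hsumm : Summable fun n : ℕ => 1 / ((n : ℂ) + 1) ^ (2 * w) := by
      have := (summable_nat_add_iff 1).2 (Complex.summable_one_div_nat_cpow.2 hs)
      simpa using this
    refine hsumm.hasSum.congr_fun fun n => ?_
    rw [Complex.cpow_neg, one_div]; push_cast; rfl
  have h4 := h2.unique (h3.mul_left (Complex.Gammaℝ (2 * w)))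
  have h5 : (thetaPair a ha).Λ w / 2 =
      ∫ x in Set.Ioi (0 : ℝ), (x : ℂ) ^ (w - 1) * ((thetaSum (a * x) - 1) / 2) := by
    rw [← ((thetaPair a ha).hasMellin (s := w) (by simpa [thetaPair] using hw)).2, mellin,
      ← integral_div]
    refine setIntegral_congr_fun measurableSet_Ioi fun x _ => ?_
    simp only [thetaPair, smul_eq_mul]
    ring
  rw [← h5] at h4
  have h2w : 2 * w ≠ 0 := mul_ne_zero two_ne_zero (ne_zero_of_re_pos hw0)
  have hG : Complex.Gammaℝ (2 * w) ≠ 0 := Complex.Gammaℝ_ne_zero_of_re_pos (by simp; linarith)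
  rw [riemannZeta_def_of_ne_zero h2w, mul_div_cancel₀ _ hG] at h4
  linear_combination 2 * h4

/-- The factor w(1/2 - w) removes both poles, so `F` and `G` are entire; they agree near 1 by the
case Re w > 1/2, hence everywhere. -/
theorem thetaPair_Λ_eq {a : ℂ} (ha : 0 < a.re) {w : ℂ} (hw0 : w ≠ 0) (hw1 : w ≠ 1 / 2) :
    a ^ w * (thetaPair a ha).Λ w = 2 * completedRiemannZeta (2 * w) := by
  have ha0 := ne_zero_of_re_pos ha
  set F : ℂ → ℂ := fun w => a ^ w * (w * (1 / 2 - w) * (thetaPair a ha).Λ₀ w - (1 / 2 - w) -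
    w * (1 / a ^ (1 / 2 : ℂ))) with hF
  set G : ℂ → ℂ := fun w => w * (1 / 2 - w) * (2 * completedRiemannZeta₀ (2 * w)) - (1 / 2 - w) - w
    with hG
  have hFΛ : ∀ w : ℂ, w ≠ 0 → w ≠ 1 / 2 → F w = w * (1 / 2 - w) * (a ^ w * (thetaPair a ha).Λ w) := by
    intro w h0 h1
    have h1' : 1 / 2 - w ≠ 0 := sub_ne_zero.2 h1.symm
    have e1 : (thetaPair a ha).f₀ = 1 := rfl
    have e2 : (thetaPair a ha).g₀ = 1 := rfl
    have e3 : (thetaPair a ha).ε = 1 / a ^ (1 / 2 : ℂ) := rfl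
    have e4 : (((thetaPair a ha).k : ℝ) : ℂ) = 1 / 2 := by simp [thetaPair]
    simp only [hF, WeakFEPair.Λ, e1, e2, e3, e4, smul_eq_mul, mul_one]
    have i1 := mul_inv_cancel₀ h0
    have i2 := mul_inv_cancel₀ h1'
    simp only [div_eq_mul_inv (_ : ℂ) (1 / 2 - w), one_div w]
    linear_combination a ^ w * (1 / 2 - w) * i1 + a ^ w * w * (1 / a ^ (1 / 2 : ℂ)) * i2
  have hGΛ : ∀ w : ℂ, w ≠ 0 → w ≠ 1 / 2 →
      G w = w * (1 / 2 - w) * (2 * completedRiemannZeta (2 * w)) := by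
    intro w h0 h1
    have h1' : 1 - 2 * w ≠ 0 := fun h => h1 (by linear_combination -h / 2)
    simp only [hG, completedRiemannZeta_eq]
    have i1 := mul_inv_cancel₀ h0
    have i2 := mul_inv_cancel₀ h1'
    simp only [one_div, mul_inv]
    linear_combination (1 / 2 - w) * i1 + w * i2
  have dF : Differentiable ℂ F := by
    have h1 := (thetaPair a ha).differentiable_Λ₀
    have h2 : Differentiable ℂ fun w : ℂ => a ^ w := fun w =>
      DifferentiableAt.const_cpow differentiableAt_id (Or.inl ha0)
    simp only [hF]
    fun_prop
  have dG : Differentiable ℂ G := by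
    have h1 := differentiable_completedZeta₀
    simp only [hG]
    fun_prop
  have hFG : F = G := by
    refine (Complex.analyticOnNhd_univ_iff_differentiable.2 dF).eq_of_eventuallyEq (z₀ := 1)
      (Complex.analyticOnNhd_univ_iff_differentiable.2 dG) ?_
    filter_upwards [(isOpen_lt continuous_const Complex.continuous_re).mem_nhds
      (show (1 : ℂ) ∈ {s : ℂ | 1 / 2 < s.re} by norm_num)] with w hw
    have hw' : 1 / 2 < w.re := hw
    have h0 : w ≠ 0 := ne_zero_of_re_pos (by linarith)
    have h1 : w ≠ 1 / 2 := by rintro rfl; norm_num at hw'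
    rw [hFΛ w h0 h1, hGΛ w h0 h1, thetaPair_Λ_eq_of_lt ha hw']
  have h := congrFun hFG w
  rw [hFΛ w hw0 hw1, hGΛ w hw0 hw1] at h
  exact mul_left_cancel₀ (mul_ne_zero hw0 (sub_ne_zero.2 hw1.symm)) h

/-- The completed zeta function as a sum of incomplete Gamma functions along rotated rays. -/
theorem completedRiemannZeta_eq_gaussUpper {a : ℂ} (ha : 0 < a.re) {w : ℂ} (hw0 : w ≠ 0)
    (hw1 : w ≠ 1 / 2) :
    completedRiemannZeta (2 * w) = ∑' n, gaussUpper a n w + ∑' n, gaussUpper (1 / a) n (1 / 2 - w) -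
      a ^ w / (2 * w) - a ^ w * (1 / a ^ (1 / 2 : ℂ)) / (1 - 2 * w) := by
  have ha0 := ne_zero_of_re_pos ha
  have h := thetaPair_Λ_eq ha hw0 hw1
  have h1' : 1 / 2 - w ≠ 0 := sub_ne_zero.2 hw1.symm
  have h1'' : 1 - 2 * w ≠ 0 := fun h => hw1 (by linear_combination -h / 2)
  have e1 : (thetaPair a ha).f₀ = 1 := rfl
  have e2 : (thetaPair a ha).g₀ = 1 := rfl
  have e3 : (thetaPair a ha).ε = 1 / a ^ (1 / 2 : ℂ) := rfl
  have e4 : (((thetaPair a ha).k : ℝ) : ℂ) = 1 / 2 := by simp [thetaPair]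
  have e5 : (1 / a) ^ (1 / 2 - w) = a ^ w * (1 / a ^ (1 / 2 : ℂ)) := by
    rw [inv_cpow_of_re_pos ha, Complex.cpow_sub _ _ ha0]
    field_simp
  rw [(hasSum_gaussUpper ha w).tsum_eq, (hasSum_gaussUpper (inv_re_pos ha) (1 / 2 - w)).tsum_eq, e5]
  rw [WeakFEPair.Λ, e1, e2, e3, e4, thetaPair_Λ₀_eq] at h
  simp only [smul_eq_mul, mul_one] at h
  have e6 : (1 / 2 - w) = (1 - 2 * w) / 2 := by ring
  rw [e6] at h ⊢
  have hc : a ^ (1 / 2 : ℂ) ≠ 0 := by simp [Complex.cpow_eq_zero_iff, ha0]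
  have h7 : completedRiemannZeta (2 * w) = (a ^ w * (thetaTail a w + 1 / a ^ (1 / 2 : ℂ) *
    thetaTail (1 / a) ((1 - 2 * w) / 2) - 1 / w -
      1 / a ^ (1 / 2 : ℂ) / ((1 - 2 * w) / 2))) / 2 := by rw [h]; ring
  rw [h7]
  field_simp

/-! ### First derivative test for the incomplete Gamma integrals -/

/-- The phase Im w · log x - Im r · x has derivative Im w/x - Im r, which stays below -m beyond y.
One integration by parts gives a boundary term 1/m and an integral dominated by that of a monotone
function of variation at most 2/m. No power of Re r enters, so the ray may approach the imaginary
axis. -/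
theorem norm_integral_Ioi_cpow_mul_exp_le {w r : ℂ} (hw0 : 0 < w.re) (hw1 : w.re ≤ 1)
    (hv : 0 < w.im) (hwv : ‖w - 1‖ ≤ 2 * w.im) (hr : 0 < r.re) {y m : ℝ} (hy : 1 ≤ y) (hm : 0 < m)
    (h : m ≤ r.im - w.im / y) :
    ‖∫ x in Set.Ioi y, (x : ℂ) ^ (w - 1) * Complex.exp (-(r * x))‖ ≤ 3 / m := by
  have hy0 : 0 < y := by linarith
  set f : ℝ → ℂ := fun x => (x : ℂ) ^ (w - 1) * Complex.exp (-(r * x)) with hf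
  set q : ℝ → ℂ := fun x => (w - 1) / x - r with hq
  have hd : ∀ x, y ≤ x → m ≤ r.im - w.im / x := fun x hx =>
    h.trans (sub_le_sub_left (div_le_div_of_nonneg_left hv.le hy0 hx) _)
  have hqim : ∀ x : ℝ, (q x).im = w.im / x - r.im := by
    intro x; simp [hq, Complex.div_ofReal_im]
  have hqn : ∀ x : ℝ, y ≤ x → r.im - w.im / x ≤ ‖q x‖ := by
    intro x hx
    refine le_trans ?_ (Complex.abs_im_le_norm _)
    rw [hqim, abs_sub_comm]
    exact le_abs_self _
  have hq0 : ∀ x : ℝ, y ≤ x → q x ≠ 0 := fun x hx =>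
    norm_pos_iff.1 (hm.trans_le ((hd x hx).trans (hqn x hx)))
  have hfd : ∀ x : ℝ, 0 < x → HasDerivAt f (f x * q x) x := by
    intro x hx
    have hx0 : (x : ℂ) ≠ 0 := by exact_mod_cast hx.ne'
    have h1 : HasDerivAt (fun z : ℂ => z ^ (w - 1) * Complex.exp (-(r * z)))
        ((w - 1) * (x : ℂ) ^ (w - 1 - 1) * Complex.exp (-(r * x)) +
          (x : ℂ) ^ (w - 1) * (Complex.exp (-(r * x)) * (-(r * 1)))) (x : ℂ) := by
      refine HasDerivAt.mul ?_ (((hasDerivAt_id (x : ℂ)).const_mul r).fun_neg.cexp)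
      simpa using (hasDerivAt_id (x : ℂ)).cpow_const (c := w - 1)
        (by simpa using (Complex.ofReal_mem_slitPlane.2 hx))
    refine h1.comp_ofReal.congr_deriv ?_
    simp only [hf, hq]
    rw [Complex.cpow_sub (w - 1) 1 hx0, Complex.cpow_one]
    field_simp
    ring
  have hqd : ∀ x : ℝ, 0 < x → HasDerivAt q (-(w - 1) / (x : ℂ) ^ 2) x := by
    intro x hx
    have hx0 : (x : ℂ) ≠ 0 := by exact_mod_cast hx.ne'
    have h1 : HasDerivAt (fun z : ℂ => (w - 1) / z - r) (-(w - 1) / (x : ℂ) ^ 2) (x : ℂ) := by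
      have := ((hasDerivAt_inv hx0).const_mul (w - 1)).sub_const r
      refine HasDerivAt.congr_deriv ?_ (show (w - 1) * -((x : ℂ) ^ 2)⁻¹ = _ by field_simp)
      simpa [div_eq_mul_inv] using this
    exact h1.comp_ofReal
  -- Since f' = fq, the derivative of f/q is f - fq'/q²; `e` is the second term.
  set e : ℝ → ℂ := fun x => f x * ((w - 1) / ((x : ℂ) ^ 2 * q x ^ 2)) with he
  have hG : ∀ x : ℝ, y ≤ x → HasDerivAt (fun x => f x / q x) (f x + e x) x := by
    intro x hx
    have hx0 : 0 < x := by linarith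
    have hx0' : (x : ℂ) ≠ 0 := by exact_mod_cast hx0.ne'
    have hqx := hq0 x hx
    refine ((hfd x hx0).fun_div (hqd x hx0) hqx).congr_deriv ?_
    simp only [he]
    field_simp
    ring
  have hfn : ∀ x : ℝ, y ≤ x → ‖f x‖ ≤ Real.exp (-(r.re * x)) := by
    intro x hx
    have hx0 : 0 < x := by linarith
    rw [hf, norm_cpow_mul_exp hx0]
    exact mul_le_of_le_one_left (Real.exp_pos _).le
      (Real.rpow_le_one_of_one_le_of_nonpos (by linarith) (by linarith))
  have hfn1 : ∀ x : ℝ, y ≤ x → ‖f x‖ ≤ 1 := fun x hx => (hfn x hx).trans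
    (Real.exp_le_one_iff.2 (by have : 0 < x := by linarith
                               have := mul_pos hr this; linarith))
  -- `g` is increasing, and its derivative majorizes ‖e‖ because ‖f‖ ≤ 1 and ‖w - 1‖ ≤ 2 Im w.
  set g : ℝ → ℝ := fun x => -2 / (r.im - w.im / x) with hg
  set g' : ℝ → ℝ := fun x => 2 * w.im / (x ^ 2 * (r.im - w.im / x) ^ 2) with hg'
  have hgd : ∀ x : ℝ, y ≤ x → HasDerivAt g (g' x) x := by
    intro x hx
    have hx0 : 0 < x := by linarith
    have hne : r.im - w.im / x ≠ 0 := (hm.trans_le (hd x hx)).ne'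
    have h1 : HasDerivAt (fun x : ℝ => r.im - w.im / x) (w.im / x ^ 2) x := by
      have := ((hasDerivAt_inv hx0.ne').const_mul w.im).const_sub r.im
      refine HasDerivAt.congr_deriv ?_ (show -(w.im * -(x ^ 2)⁻¹) = _ by field_simp)
      simpa [div_eq_mul_inv] using this
    refine ((hasDerivAt_const x (-2 : ℝ)).fun_div h1 hne).congr_deriv ?_
    simp only [hg']
    field_simp
    ring
  have hgt : Tendsto g atTop (𝓝 (-2 / r.im)) := by
    have h1 : Tendsto (fun x : ℝ => r.im - w.im / x) atTop (𝓝 (r.im - 0)) :=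
      (tendsto_const_nhds.div_atTop tendsto_id).const_sub _
    rw [sub_zero] at h1
    have : r.im ≠ 0 := by
      have h2 := div_pos hv hy0
      exact (by linarith : (0 : ℝ) < r.im).ne'
    exact tendsto_const_nhds.div h1 this
  have hgpos : ∀ x ∈ Set.Ioi y, 0 ≤ g' x := fun x hx => by
    simp only [hg']; positivity
  have hgi : IntegrableOn g' (Set.Ioi y) :=
    integrableOn_Ioi_deriv_of_nonneg (hgd y le_rfl).continuousAt.continuousWithinAt
      (fun x hx => hgd x (le_of_lt hx)) hgpos hgt
  have hgint : ∫ x in Set.Ioi y, g' x ≤ 2 / m := by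
    rw [integral_Ioi_of_hasDerivAt_of_nonneg (hgd y le_rfl).continuousAt.continuousWithinAt
      (fun x hx => hgd x (le_of_lt hx)) hgpos hgt]
    have hrim : 0 < r.im := by
      have h2 := div_pos hv hy0
      linarith
    have h3 : 0 ≤ 2 / r.im := by positivity
    have h4 : 2 / (r.im - w.im / y) ≤ 2 / m := div_le_div_of_nonneg_left two_pos.le hm h
    simp only [hg, neg_div]
    linarith
  have hen : ∀ x ∈ Set.Ioi y, ‖e x‖ ≤ g' x := by
    intro x hx
    have hx' : y ≤ x := le_of_lt hx
    have hx0 : 0 < x := by linarith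
    have hpos := hm.trans_le (hd x hx')
    have e1 : ‖e x‖ = ‖f x‖ * (‖w - 1‖ / (x ^ 2 * ‖q x‖ ^ 2)) := by
      simp only [he]
      rw [norm_mul (f x), norm_div, norm_mul ((x : ℂ) ^ 2), norm_pow, norm_pow, Complex.norm_real,
        Real.norm_of_nonneg hx0.le]
    rw [e1]
    simp only [hg']
    refine (mul_le_of_le_one_left (by positivity) (hfn1 x hx')).trans ?_
    have := hqn x hx'
    gcongr
  have hsub : Set.Ioi y ⊆ Set.Ioi 0 := Set.Ioi_subset_Ioi hy0.le
  have hfi : IntegrableOn f (Set.Ioi y) := (integrableOn_cpow_mul_exp hw0 hr).mono_set hsub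
  have hei : IntegrableOn e (Set.Ioi y) := by
    refine hgi.mono' ?_ (ae_restrict_of_forall_mem measurableSet_Ioi hen)
    refine ContinuousOn.aestronglyMeasurable (fun x hx => ContinuousAt.continuousWithinAt ?_)
      measurableSet_Ioi
    have hx0 : 0 < x := hsub hx
    have hx0' : (x : ℂ) ≠ 0 := by exact_mod_cast hx0.ne'
    have hqx := hq0 x (le_of_lt hx)
    refine (hfd x hx0).continuousAt.mul (continuousAt_const.div ?_ (by positivity))
    exact (Complex.continuous_ofReal.continuousAt.pow 2).mul ((hqd x hx0).continuousAt.pow 2)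
  have hGt : Tendsto (fun x => f x / q x) atTop (𝓝 0) := by
    have h1 : Tendsto (fun x : ℝ => Real.exp (-(r.re * x)) / m) atTop (𝓝 0) := by
      have := (Real.tendsto_exp_neg_atTop_nhds_zero.comp (tendsto_id.const_mul_atTop hr)).div_const m
      simpa [Function.comp_def] using this
    refine squeeze_zero_norm' ?_ h1
    filter_upwards [eventually_ge_atTop y] with x hx
    rw [norm_div]
    have h2 := hfn x hx
    have h3 := (hd x hx).trans (hqn x hx)
    gcongr
  have hI := integral_Ioi_of_hasDerivAt_of_tendsto (hG y le_rfl).continuousAt.continuousWithinAt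
    (fun x hx => hG x (le_of_lt hx)) (hfi.add hei) hGt
  rw [integral_add hfi hei] at hI
  have hI2 : ∫ x in Set.Ioi y, f x = -(f y / q y) - ∫ x in Set.Ioi y, e x := by
    linear_combination hI
  rw [hI2]
  have b1 : ‖f y / q y‖ ≤ 1 / m := by
    rw [norm_div]
    have h2 := hfn1 y le_rfl
    have h3 := h.trans (hqn y le_rfl)
    gcongr
  have b2 : ‖∫ x in Set.Ioi y, e x‖ ≤ 2 / m :=
    (norm_integral_le_of_norm_le hgi (ae_restrict_of_forall_mem measurableSet_Ioi hen)).trans hgint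
  calc _ ≤ ‖-(f y / q y)‖ + ‖∫ x in Set.Ioi y, e x‖ := norm_sub_le _ _
    _ ≤ 1 / m + 2 / m := by rw [norm_neg]; exact add_le_add b1 b2
    _ = 3 / m := by ring

/-- The same test to the left of the stationary point; here the singularity of x^{w-1} at 0 must
also be absorbed. -/
theorem norm_integral_Ioc_cpow_mul_exp_le {w r : ℂ} (hw0 : 1 / 8 ≤ w.re) (hw1 : w.re ≤ 1)
    (hv : 0 < w.im) (hwv : ‖w - 1‖ ≤ 2 * w.im) (hr : 0 < r.re) (hri : 0 < r.im) {y m : ℝ}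
    (hy0 : 0 < y) (hy : y ≤ 1) (hm : 0 < m) (h : m ≤ w.im - r.im * y) :
    ‖∫ x in Set.Ioc 0 y, (x : ℂ) ^ (w - 1) * Complex.exp (-(r * x))‖ ≤ 17 / m := by
  have hwre : 0 < w.re := by linarith
  set f : ℝ → ℂ := fun x => (x : ℂ) ^ (w - 1) * Complex.exp (-(r * x)) with hf
  set p : ℝ → ℂ := fun x => w - 1 - r * x with hp
  have hd : ∀ x, x ≤ y → m ≤ w.im - r.im * x := fun x hx =>
    h.trans (sub_le_sub_left (mul_le_mul_of_nonneg_left hx hri.le) _)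
  have hpn : ∀ x : ℝ, w.im - r.im * x ≤ ‖p x‖ := by
    intro x
    refine le_trans ?_ (Complex.abs_im_le_norm _)
    have : (p x).im = w.im - r.im * x := by simp [hp]
    rw [this]
    exact le_abs_self _
  have hp0 : ∀ x : ℝ, x ≤ y → p x ≠ 0 := fun x hx =>
    norm_pos_iff.1 (hm.trans_le ((hd x hx).trans (hpn x)))
  -- The previous primitive f/q with numerator and denominator multiplied by x, so that it is
  -- continuous and zero at 0.
  set G : ℝ → ℂ := fun x => (x : ℂ) ^ w * Complex.exp (-(r * x)) / p x with hGdef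
  set e : ℝ → ℂ := fun x => f x * ((w - 1) / p x ^ 2) with he
  have hpc : Continuous p := by simp only [hp]; fun_prop
  have hGc : ContinuousOn G (Set.Icc 0 y) := by
    intro x hx
    refine ContinuousAt.continuousWithinAt (ContinuousAt.div (ContinuousAt.mul
      (Complex.continuousAt_ofReal_cpow_const _ _ (Or.inl hwre)) (by fun_prop)) hpc.continuousAt
      (hp0 x hx.2))
  have hGd : ∀ x : ℝ, 0 < x → x ≤ y → HasDerivAt G (f x + e x) x := by
    intro x hx hxy
    have hx0 : (x : ℂ) ≠ 0 := by exact_mod_cast hx.ne'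
    have hpx := hp0 x hxy
    have hpx' : w - 1 - r * (x : ℂ) ≠ 0 := hpx
    have h1 : HasDerivAt (fun z : ℂ => z ^ w * Complex.exp (-(r * z)))
        (w * (x : ℂ) ^ (w - 1) * Complex.exp (-(r * x)) +
          (x : ℂ) ^ w * (Complex.exp (-(r * x)) * (-(r * 1)))) (x : ℂ) := by
      refine HasDerivAt.mul ?_ (((hasDerivAt_id (x : ℂ)).const_mul r).fun_neg.cexp)
      simpa using (hasDerivAt_id (x : ℂ)).cpow_const (c := w)
        (by simpa using (Complex.ofReal_mem_slitPlane.2 hx))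
    have h2 : HasDerivAt (fun z : ℂ => w - 1 - r * z) (-(r * 1)) (x : ℂ) :=
      ((hasDerivAt_id (x : ℂ)).const_mul r).const_sub _
    refine ((h1.fun_div h2 hpx').comp_ofReal).congr_deriv ?_
    simp only [hf, he, hp]
    have e1 : (x : ℂ) ^ w = (x : ℂ) ^ (w - 1) * x := by
      rw [Complex.cpow_sub _ _ hx0, Complex.cpow_one, div_mul_cancel₀ _ hx0]
    rw [e1]
    field_simp
    ring
  have hfn : ∀ x : ℝ, 0 < x → ‖f x‖ ≤ x ^ (w.re - 1) := by
    intro x hx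
    rw [hf, norm_cpow_mul_exp hx]
    refine mul_le_of_le_one_right (by positivity) (Real.exp_le_one_iff.2 ?_)
    have := mul_pos hr hx; linarith
  -- The factor 1/Re w undoes the differentiation of x^{Re w}; Re w ≥ 1/8 bounds 2/Re w by 16.
  set g : ℝ → ℝ := fun x => 2 / w.re * (x ^ w.re / (w.im - r.im * x)) with hg
  set g' : ℝ → ℝ := fun x => 2 / w.re * ((w.re * x ^ (w.re - 1) * (w.im - r.im * x) -
    x ^ w.re * (-(r.im * 1))) / (w.im - r.im * x) ^ 2) with hg'
  have hgd : ∀ x : ℝ, 0 < x → x ≤ y → HasDerivAt g (g' x) x := by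
    intro x hx hxy
    have hne : w.im - r.im * x ≠ 0 := (hm.trans_le (hd x hxy)).ne'
    exact ((Real.hasDerivAt_rpow_const (Or.inl hx.ne')).fun_div
      (((hasDerivAt_id x).const_mul r.im).const_sub w.im) hne).const_mul _
  have hgc : ContinuousOn g (Set.Icc 0 y) := by
    intro x hx
    have hne : w.im - r.im * x ≠ 0 := (hm.trans_le (hd x hx.2)).ne'
    refine ContinuousAt.continuousWithinAt (continuousAt_const.mul (ContinuousAt.div
      (Real.continuousAt_rpow_const _ _ (Or.inr hwre.le)) (by fun_prop) hne))
  have hgpos : ∀ x ∈ Set.Ioo 0 y, 0 ≤ g' x := fun x hx => by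
    have hx0 : 0 < x := hx.1
    have hpos := hm.trans_le (hd x hx.2.le)
    simp only [hg', mul_one, mul_neg, sub_neg_eq_add]
    positivity
  have hgi : IntervalIntegrable g' volume 0 y :=
    (intervalIntegrable_iff_integrableOn_Ioc_of_le hy0.le).2
    (intervalIntegral.integrableOn_deriv_of_nonneg hgc (fun x hx => hgd x hx.1 hx.2.le) hgpos)
  have hgint : ∫ x in (0 : ℝ)..y, g' x ≤ 16 / m := by
    rw [intervalIntegral.integral_eq_sub_of_hasDerivAt_of_le hy0.le hgc
      (fun x hx => hgd x hx.1 hx.2.le) hgi]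
    have h0 : g 0 = 0 := by simp [hg, Real.zero_rpow hwre.ne']
    rw [h0, sub_zero]
    simp only [hg]
    have h1 : 2 / w.re ≤ 16 := by rw [div_le_iff₀ hwre]; linarith
    have h2 : y ^ w.re ≤ 1 := Real.rpow_le_one hy0.le hy hwre.le
    have hpos := hm.trans_le h
    calc 2 / w.re * (y ^ w.re / (w.im - r.im * y)) ≤ 16 * (1 / m) := by gcongr
      _ = 16 / m := by ring
  have hen : ∀ x : ℝ, 0 < x → x ≤ y → ‖e x‖ ≤ g' x := by
    intro x hx hxy
    have hpos := hm.trans_le (hd x hxy)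
    simp only [he, hg', mul_one, mul_neg, sub_neg_eq_add]
    rw [norm_mul, norm_div, norm_pow]
    have h1 : ‖w - 1‖ / ‖p x‖ ^ 2 ≤ 2 * w.im / (w.im - r.im * x) ^ 2 := by
      have := hpn x
      gcongr
    refine (mul_le_mul (hfn x hx) h1 (by positivity) (by positivity)).trans ?_
    have e1 : x ^ w.re = x ^ (w.re - 1) * x := by
      rw [← Real.rpow_add_one hx.ne']; congr 1; ring
    rw [e1]
    have e2 : 2 / w.re * ((w.re * x ^ (w.re - 1) * (w.im - r.im * x) + x ^ (w.re - 1) * x * r.im) /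
        (w.im - r.im * x) ^ 2) - x ^ (w.re - 1) * (2 * w.im / (w.im - r.im * x) ^ 2) =
        2 * x ^ (w.re - 1) * (r.im * x) * (1 / w.re - 1) / (w.im - r.im * x) ^ 2 := by
      field_simp
      ring
    have e3 : 0 ≤ 1 / w.re - 1 := by
      rw [sub_nonneg, le_div_iff₀ hwre]; linarith
    have e4 : 0 ≤ 2 * x ^ (w.re - 1) * (r.im * x) * (1 / w.re - 1) / (w.im - r.im * x) ^ 2 := by
      positivity
    linarith
  have hfi0 : IntegrableOn f (Set.Ioc 0 y) :=
    (integrableOn_cpow_mul_exp hwre hr).mono_set Set.Ioc_subset_Ioi_self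
  have hfi : IntervalIntegrable f volume 0 y :=
    (intervalIntegrable_iff_integrableOn_Ioc_of_le hy0.le).2 hfi0
  have hei0 : IntegrableOn e (Set.Ioc 0 y) := by
    refine ((intervalIntegrable_iff_integrableOn_Ioc_of_le hy0.le).1 hgi).mono' ?_
      (ae_restrict_of_forall_mem measurableSet_Ioc fun x hx => hen x hx.1 hx.2)
    refine ContinuousOn.aestronglyMeasurable ?_ measurableSet_Ioc
    refine ((continuousOn_cpow_mul_exp w r).mono Set.Ioc_subset_Ioi_self).mul
      (continuousOn_const.div (hpc.pow 2).continuousOn fun x hx => pow_ne_zero 2 (hp0 x hx.2))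
  have hei : IntervalIntegrable e volume 0 y :=
    (intervalIntegrable_iff_integrableOn_Ioc_of_le hy0.le).2 hei0
  have hI := intervalIntegral.integral_eq_sub_of_hasDerivAt_of_le hy0.le hGc
    (fun x hx => hGd x hx.1 hx.2.le) (hfi.add hei)
  rw [intervalIntegral.integral_add hfi hei] at hI
  have hG0 : G 0 = 0 := by
    simp [hGdef, Complex.zero_cpow (ne_zero_of_re_pos hwre)]
  rw [hG0, sub_zero] at hI
  rw [← intervalIntegral.integral_of_le hy0.le]
  have hI2 : ∫ x in (0 : ℝ)..y, f x = G y - ∫ x in (0 : ℝ)..y, e x := by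
    linear_combination hI
  rw [hI2]
  have b1 : ‖G y‖ ≤ 1 / m := by
    simp only [hGdef]
    rw [norm_div, norm_mul, Complex.norm_cpow_eq_rpow_re_of_pos hy0]
    have h3 := h.trans (hpn y)
    have h2 : y ^ w.re ≤ 1 := Real.rpow_le_one hy0.le hy hwre.le
    have h4 : ‖Complex.exp (-(r * y))‖ ≤ 1 := by
      rw [Complex.norm_exp, Real.exp_le_one_iff, Complex.neg_re, Complex.re_mul_ofReal]
      have := mul_pos hr hy0; linarith
    gcongr
    exact mul_le_one₀ h2 (norm_nonneg _) h4
  have b2 : ‖∫ x in (0 : ℝ)..y, e x‖ ≤ 16 / m := by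
    refine (intervalIntegral.norm_integral_le_of_norm_le hy0.le ?_ hgi).trans hgint
    exact Eventually.of_forall fun x hx => hen x hx.1 hx.2
  calc _ ≤ ‖G y‖ + ‖∫ x in (0 : ℝ)..y, e x‖ := norm_sub_le _ _
    _ ≤ 1 / m + 16 / m := add_le_add b1 b2
    _ = 17 / m := by ring

theorem norm_sub_one_le_two_mul_im {w : ℂ} (hw0 : 0 < w.re) (hw1 : w.re ≤ 1) (hv : 1 ≤ w.im) :
    ‖w - 1‖ ≤ 2 * w.im := by
  refine (Complex.norm_le_abs_re_add_abs_im _).trans ?_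
  simp only [Complex.sub_re, Complex.one_re, Complex.sub_im, Complex.one_im, sub_zero]
  rw [abs_of_nonpos (by linarith), abs_of_pos (by linarith)]
  linarith

/-- The phase is stationary near x = A²/(n+1)², so for n + 1 ≥ A the ray x > 1 lies on one side of
that point. The condition on 1 - Im a keeps the rotation from displacing it appreciably. -/
theorem norm_integral_gaussTerm_Ioi_le {a w : ℂ} {A : ℝ} (hA : 4 ≤ A) (ha : 0 < a.re)
    (ha1 : a.im ≤ 1) (ha2 : (1 - a.im) * A ^ 2 ≤ 1 / 16) (hw0 : 0 < w.re) (hw1 : w.re ≤ 1)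
    (hv : |w.im - Real.pi * A ^ 2| ≤ 1) (n : ℕ) (hn : A ≤ (n : ℝ) + 1) :
    ‖∫ x in Set.Ioi (1 : ℝ), gaussTerm a n w x‖ ≤ 34 / (|((n : ℝ) + 1) ^ 2 - A ^ 2| + A) := by
  have hpi := Real.pi_gt_three
  set k : ℝ := (n : ℝ) + 1 with hk
  have hX0 : 0 ≤ k ^ 2 - A ^ 2 := by nlinarith
  rw [abs_of_nonneg hX0]
  obtain ⟨hv1, hv2⟩ := abs_le.1 hv
  have hvp : 1 ≤ w.im := by nlinarith
  have hwv := norm_sub_one_le_two_mul_im hw0 hw1 hvp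
  have hrre : 0 < ((Real.pi : ℂ) * ((n : ℂ) + 1) ^ 2 * a).re := gauss_coeff_re_pos ha n
  have hrim := gauss_coeff_im (a := a) n
  rw [← hk] at hrim
  set X := k ^ 2 - A ^ 2 with hX
  have hkX : k ^ 2 = X + A ^ 2 := by rw [hX]; ring
  have hc : 1 - a.im ≤ 1 / 256 := by
    by_contra hcon
    push Not at hcon
    have : 16 ≤ A ^ 2 := by nlinarith
    nlinarith
  have hrim2 : Real.pi * (X + A ^ 2) - Real.pi * (X / 256 + 1 / 16) ≤
      ((Real.pi : ℂ) * ((n : ℂ) + 1) ^ 2 * a).im := by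
    rw [hrim, hkX]
    have : (1 - a.im) * (X + A ^ 2) ≤ X / 256 + 1 / 16 := by nlinarith
    nlinarith
  set r := (Real.pi : ℂ) * ((n : ℂ) + 1) ^ 2 * a with hr
  have hpi4 := Real.pi_lt_four
  -- Away from the transition the phase derivative at x = 1 is already at least X. Close to it, the
  -- interval [1, 1 + 1/A] is bounded by its length, and beyond it the phase derivative is at least
  -- X + A.
  rcases lt_or_ge A X with hXA | hXA
  · have := norm_integral_Ioi_cpow_mul_exp_le hw0 hw1 (by linarith) hwv hrre le_rfl
      (m := X) (by linarith) (by rw [div_one]; nlinarith)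
    refine this.trans ?_
    rw [div_le_div_iff₀ (by linarith) (by linarith)]
    linarith
  · have hA0 : 0 < A := by linarith
    have hy : (1 : ℝ) ≤ 1 + 1 / A := by have : 0 < 1 / A := by positivity
                                        linarith
    have hm : X + A ≤ r.im - w.im / (1 + 1 / A) := by
      have e1 : w.im / (1 + 1 / A) = w.im * A / (A + 1) := by field_simp
      have e2 : w.im * A / (A + 1) ≤ Real.pi * A ^ 2 + 1 - Real.pi * A + Real.pi := by
        rw [div_le_iff₀ (by linarith)]
        nlinarith
      rw [e1]
      nlinarith
    have h1 := norm_integral_Ioi_cpow_mul_exp_le hw0 hw1 (by linarith) hwv hrre hy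
      (m := X + A) (by linarith) hm
    have hint := integrableOn_gaussTerm ha n hw0
    have h2 : ‖∫ x in Set.Ioc (1 : ℝ) (1 + 1 / A), gaussTerm a n w x‖ ≤ 1 * (1 / A) := by
      have := norm_setIntegral_le_of_norm_le_const (μ := volume) (s := Set.Ioc (1 : ℝ) (1 + 1 / A))
        (f := gaussTerm a n w) (C := 1) (by simp) (fun x hx => ?_)
      · refine this.trans_eq ?_
        rw [Real.volume_real_Ioc_of_le hy]; ring
      · have hx0 : 0 < x := by linarith [hx.1]
        rw [norm_gaussTerm n w hx0]
        refine mul_le_one₀ (Real.rpow_le_one_of_one_le_of_nonpos hx.1.le (by linarith))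
          (Real.exp_pos _).le (Real.exp_le_one_iff.2 ?_)
        have : 0 < Real.pi * ((n : ℝ) + 1) ^ 2 * a.re * x := by positivity
        linarith
    rw [← Set.Ioc_union_Ioi_eq_Ioi hy, setIntegral_union Set.Ioc_disjoint_Ioi_same
      measurableSet_Ioi (hint.1.mono_set (Set.Ioc_subset_Ioi_self.trans
        (Set.Ioi_subset_Ioi zero_le_one)))
      (hint.1.mono_set (Set.Ioi_subset_Ioi (by linarith)))]
    refine (norm_add_le _ _).trans ((add_le_add h2 h1).trans ?_)
    have h3 : 1 / A ≤ 2 / (X + A) := by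
      rw [div_le_div_iff₀ (by linarith) (by linarith)]; linarith
    have h4 : 2 / (X + A) + 3 / (X + A) ≤ 34 / (X + A) := by
      rw [← add_div]
      gcongr
      norm_num
    linarith

/-- For n + 1 ≤ A the stationary point lies to the right of (0, 1], up to an error of order 1/A;
near the transition the interval (1 - 1/A, 1] is again removed trivially. -/
theorem norm_integral_gaussTerm_Ioc_le {a w : ℂ} {A : ℝ} (hA : 4 ≤ A) (ha : 0 < a.re)
    (ha0 : 0 < a.im) (ha1 : a.im ≤ 1) (hw0 : 1 / 8 ≤ w.re) (hw1 : w.re ≤ 1)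
    (hv : |w.im - Real.pi * A ^ 2| ≤ 1) (n : ℕ) (hn : (n : ℝ) + 1 ≤ A) :
    ‖∫ x in Set.Ioc (0 : ℝ) 1, gaussTerm a n w x‖ ≤ 34 / (|((n : ℝ) + 1) ^ 2 - A ^ 2| + A) := by
  have hpi := Real.pi_gt_three
  set k : ℝ := (n : ℝ) + 1 with hk
  have hk0 : 0 < k := by positivity
  have hX0 : 0 ≤ A ^ 2 - k ^ 2 := by nlinarith
  rw [abs_sub_comm, abs_of_nonneg hX0]
  obtain ⟨hv1, hv2⟩ := abs_le.1 hv
  have hvp : 1 ≤ w.im := by nlinarith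
  have hw00 : 0 < w.re := by linarith
  have hwv := norm_sub_one_le_two_mul_im hw00 hw1 hvp
  have hrre : 0 < ((Real.pi : ℂ) * ((n : ℂ) + 1) ^ 2 * a).re := gauss_coeff_re_pos ha n
  have hrim := gauss_coeff_im (a := a) n
  rw [← hk] at hrim
  have hrpos : 0 < ((Real.pi : ℂ) * ((n : ℂ) + 1) ^ 2 * a).im := by rw [hrim]; positivity
  set X := A ^ 2 - k ^ 2 with hX
  have hkX : k ^ 2 = A ^ 2 - X := by rw [hX]; ring
  have hrim2 : ((Real.pi : ℂ) * ((n : ℂ) + 1) ^ 2 * a).im ≤ Real.pi * (A ^ 2 - X) := by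
    rw [hrim, ← hkX]
    exact mul_le_of_le_one_right (by positivity) ha1
  set r := (Real.pi : ℂ) * ((n : ℂ) + 1) ^ 2 * a with hr
  rcases lt_or_ge A X with hXA | hXA
  · have := norm_integral_Ioc_cpow_mul_exp_le hw0 hw1 (by linarith) hwv hrre hrpos one_pos le_rfl
      (m := X) (by linarith) (by rw [mul_one]; nlinarith)
    refine this.trans ?_
    rw [div_le_div_iff₀ (by linarith) (by linarith)]
    linarith
  · have hA0 : 0 < A := by linarith
    have hA1 : 1 / A ≤ 1 / 4 := by gcongr
    have hA2 : 0 < 1 / A := by positivity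
    have hm : X + A ≤ w.im - r.im * (1 - 1 / A) := by
      have e1 : r.im * (1 - 1 / A) ≤ Real.pi * (A ^ 2 - X) * (1 - 1 / A) :=
        mul_le_mul_of_nonneg_right hrim2 (by linarith)
      have e2 : Real.pi * (A ^ 2 - X) * (1 - 1 / A) =
          Real.pi * A ^ 2 - Real.pi * X - Real.pi * A + Real.pi * (X / A) := by field_simp; ring
      have e3 : X / A ≤ 1 := by rw [div_le_one hA0]; exact hXA
      nlinarith
    have h1 := norm_integral_Ioc_cpow_mul_exp_le hw0 hw1 (by linarith) hwv hrre hrpos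
      (y := 1 - 1 / A) (by linarith) (by linarith) (m := X + A) (by linarith) hm
    have hint := integrableOn_gaussTerm ha n hw00
    have h2 : ‖∫ x in Set.Ioc (1 - 1 / A) 1, gaussTerm a n w x‖ ≤ 2 * (1 / A) := by
      have := norm_setIntegral_le_of_norm_le_const (μ := volume) (s := Set.Ioc (1 - 1 / A) 1)
        (f := gaussTerm a n w) (C := 2) (by simp) (fun x hx => ?_)
      · refine this.trans_eq ?_
        rw [Real.volume_real_Ioc_of_le (by linarith)]; ring
      · have hx0 : 1 / 2 ≤ x := by linarith [hx.1]
        have hx00 : 0 < x := by linarith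
        rw [norm_gaussTerm n w hx00]
        have e1 : x ^ (w.re - 1) ≤ 2 := by
          refine (Real.rpow_le_rpow_of_exponent_ge hx00 hx.2
            (show (-1 : ℝ) ≤ w.re - 1 by linarith)).trans ?_
          rw [Real.rpow_neg_one]
          exact inv_le_of_inv_le₀ two_pos (by linarith)
        have e2 : Real.exp (-(Real.pi * ((n : ℝ) + 1) ^ 2 * a.re * x)) ≤ 1 := by
          refine Real.exp_le_one_iff.2 ?_
          have : 0 < Real.pi * ((n : ℝ) + 1) ^ 2 * a.re * x := by positivity
          linarith
        exact (mul_le_mul e1 e2 (Real.exp_pos _).le two_pos.le).trans_eq (mul_one _)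
    rw [← Set.Ioc_union_Ioc_eq_Ioc (show (0 : ℝ) ≤ 1 - 1 / A by linarith) (by linarith),
      setIntegral_union (Set.Ioc_disjoint_Ioc_of_le le_rfl)
      measurableSet_Ioc (hint.1.mono_set Set.Ioc_subset_Ioi_self)
      (hint.1.mono_set (Set.Ioc_subset_Ioi_self.trans (Set.Ioi_subset_Ioi (by linarith))))]
    refine (norm_add_le _ _).trans ((add_le_add h1 h2).trans ?_)
    have h3 : 1 / A ≤ 2 / (X + A) := by
      rw [div_le_div_iff₀ (by linarith) (by linarith)]; linarith
    have h4 : 17 / (X + A) + 2 * (2 / (X + A)) ≤ 34 / (X + A) := by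
      rw [← mul_div_assoc, ← add_div]
      gcongr
      norm_num
    linarith

/-! ### The ray at height t and the approximate functional equation -/

/-- The direction of rotation of the Gamma integral at height `t`. -/
noncomputable def rotDir (t : ℝ) : ℂ := Complex.exp (((Real.pi / 2 - 1 / t : ℝ) : ℂ) * Complex.I)

theorem rotDir_re (t : ℝ) : (rotDir t).re = Real.sin (1 / t) := by
  rw [rotDir, Complex.exp_ofReal_mul_I_re, Real.cos_pi_div_two_sub]

theorem rotDir_im (t : ℝ) : (rotDir t).im = Real.cos (1 / t) := by
  rw [rotDir, Complex.exp_ofReal_mul_I_im, Real.sin_pi_div_two_sub]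

theorem rotDir_re_pos {t : ℝ} (ht : 1 ≤ t) : 0 < (rotDir t).re := by
  rw [rotDir_re]
  have h1 : 1 / t ≤ 1 := by rw [div_le_one (by linarith)]; exact ht
  exact Real.sin_pos_of_pos_of_lt_pi (by positivity) (by linarith [Real.pi_gt_three])

theorem rotDir_im_pos {t : ℝ} (ht : 1 ≤ t) : 0 < (rotDir t).im := by
  rw [rotDir_im]
  have h1 : 1 / t ≤ 1 := by rw [div_le_one (by linarith)]; exact ht
  have h2 : 0 < 1 / t := by positivity
  exact Real.cos_pos_of_mem_Ioo ⟨by linarith [Real.pi_gt_three], by linarith [Real.pi_gt_three]⟩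

theorem rotDir_im_le (t : ℝ) : (rotDir t).im ≤ 1 := by
  rw [rotDir_im]; exact Real.cos_le_one _

theorem one_sub_rotDir_im_le (t : ℝ) : 1 - (rotDir t).im ≤ (1 / t) ^ 2 / 2 := by
  rw [rotDir_im]
  linarith [Real.one_sub_sq_div_two_le_cos (x := 1 / t)]

theorem log_rotDir {t : ℝ} (ht : 1 ≤ t) :
    Complex.log (rotDir t) = ((Real.pi / 2 - 1 / t : ℝ) : ℂ) * Complex.I := by
  have h1 : 1 / t ≤ 1 := by rw [div_le_one (by linarith)]; exact ht
  have h2 : 0 < 1 / t := by positivity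
  have hpi := Real.pi_gt_three
  rw [rotDir, Complex.log_exp]
  · rw [Complex.im_ofReal_mul, Complex.I_im, mul_one]; linarith
  · rw [Complex.im_ofReal_mul, Complex.I_im, mul_one]; linarith

theorem norm_rotDir_cpow {t : ℝ} (ht : 1 ≤ t) (w : ℂ) :
    ‖rotDir t ^ w‖ = Real.exp (-((Real.pi / 2 - 1 / t) * w.im)) := by
  rw [Complex.cpow_def_of_ne_zero (ne_zero_of_re_pos (rotDir_re_pos ht)), log_rotDir ht,
    Complex.norm_exp]
  congr 1
  simp [Complex.mul_re]

/-- Stopping 1/t short of the angle π/2 costs only a factor e in the decay e^{-π Im w/2}, yet keeps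
the real part positive, as the theta series requires. -/
theorem norm_rotDir_cpow_le {t : ℝ} (ht : 2 ≤ t) {w : ℂ} (hw : w.im ≤ t) :
    ‖rotDir t ^ w‖ ≤ Real.exp 1 * Real.exp (-(Real.pi * w.im / 2)) := by
  rw [norm_rotDir_cpow (by linarith), ← Real.exp_add]
  refine Real.exp_le_exp.2 ?_
  have : 1 / t * w.im ≤ 1 := by
    rw [one_div_mul_eq_div, div_le_one (by linarith)]; exact hw
  linarith

theorem conj_gaussTerm (a : ℂ) (n : ℕ) (w : ℂ) {x : ℝ} (hx : 0 < x) :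
    gaussTerm (starRingEnd ℂ a) n (starRingEnd ℂ w) x = starRingEnd ℂ (gaussTerm a n w x) := by
  have h : (x : ℂ) ^ (starRingEnd ℂ w - 1) = starRingEnd ℂ ((x : ℂ) ^ (w - 1)) := by
    have := Complex.cpow_conj (x : ℂ) (w - 1) (by
      rw [Complex.arg_ofReal_of_nonneg hx.le]; exact Real.pi_pos.ne)
    rw [map_sub, map_one, Complex.conj_ofReal] at this
    exact this
  rw [gaussTerm, gaussTerm, h, map_mul, ← Complex.exp_conj]
  simp

theorem conj_gaussUpper {a : ℂ} (ha : 0 < a.re) (n : ℕ) (w : ℂ) :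
    gaussUpper (starRingEnd ℂ a) n (starRingEnd ℂ w) = starRingEnd ℂ (gaussUpper a n w) := by
  have harg : a.arg ≠ Real.pi := by
    have : a ∈ Complex.slitPlane := Or.inl ha
    exact (Complex.mem_slitPlane_iff_arg.1 this).1
  rw [gaussUpper, gaussUpper, map_mul, ← integral_conj]
  congr 1
  · rw [Complex.cpow_conj _ _ (by
      rw [Complex.arg_conj, if_neg harg]
      intro h
      have h2 : |a.arg| < Real.pi / 2 := Complex.abs_arg_lt_pi_div_two_iff.2 (Or.inl ha)
      rw [abs_lt] at h2
      linarith [Real.pi_pos]), Complex.conj_conj]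
  · exact setIntegral_congr_fun measurableSet_Ioi fun x hx =>
      conj_gaussTerm a n w (lt_trans one_pos hx)

theorem conj_gaussLower {a : ℂ} (ha : 0 < a.re) (n : ℕ) (w : ℂ) :
    gaussLower (starRingEnd ℂ a) n (starRingEnd ℂ w) = starRingEnd ℂ (gaussLower a n w) := by
  have harg : a.arg ≠ Real.pi := by
    have : a ∈ Complex.slitPlane := Or.inl ha
    exact (Complex.mem_slitPlane_iff_arg.1 this).1
  rw [gaussLower, gaussLower, map_mul, ← integral_conj]
  congr 1
  · rw [Complex.cpow_conj _ _ (by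
      rw [Complex.arg_conj, if_neg harg]
      intro h
      have h2 : |a.arg| < Real.pi / 2 := Complex.abs_arg_lt_pi_div_two_iff.2 (Or.inl ha)
      rw [abs_lt] at h2
      linarith [Real.pi_pos]), Complex.conj_conj]
  · exact setIntegral_congr_fun measurableSet_Ioc fun x hx =>
      conj_gaussTerm a n w hx.1

theorem one_div_rotDir (t : ℝ) : 1 / rotDir t = starRingEnd ℂ (rotDir t) := by
  rw [rotDir, ← Complex.exp_conj, one_div, ← Complex.exp_neg]
  rw [map_mul, Complex.conj_ofReal, Complex.conj_I, mul_neg]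

/-- With Y = 1 + |k - A| the denominator is at least AY and at least Y²/2. Interpolating between
these bounds gives a summable power of Y while retaining a power of A. -/
theorem one_div_abs_sq_sub_sq_add_le {A k : ℝ} (hA : 1 ≤ A) (hk : 0 ≤ k) :
    1 / (|k ^ 2 - A ^ 2| + A) ≤ 2 * A ^ (-(3 / 4) : ℝ) * (1 + |k - A|) ^ (-(5 / 4) : ℝ) := by
  have hA0 : 0 < A := by linarith
  set Y := 1 + |k - A| with hY
  have hYp : 0 < Y := by positivity
  set D := |k ^ 2 - A ^ 2| + A with hD
  have hDp : 0 < D := by positivity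
  have e : |k ^ 2 - A ^ 2| = |k - A| * (k + A) := by
    rw [show k ^ 2 - A ^ 2 = (k - A) * (k + A) by ring, abs_mul, abs_of_nonneg (by linarith : 0 ≤ k + A)]
  have hp := abs_nonneg (k - A)
  have h1 : A * Y ≤ D := by
    rw [hD, e, hY]; nlinarith
  have h2 : Y ^ 2 / 2 ≤ D := by
    have : |k - A| ≤ k + A := abs_le.2 ⟨by linarith, by linarith⟩
    rw [hD, e, hY]; nlinarith
  -- With weights 3/4 and 1/4 the exponent of Y is 3/4 + 2/4 = 5/4 > 1.
  have h3 : (A * Y) ^ (3 / 4 : ℝ) * (Y ^ 2 / 2) ^ (1 / 4 : ℝ) ≤ D := by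
    calc _ ≤ D ^ (3 / 4 : ℝ) * D ^ (1 / 4 : ℝ) := by gcongr
      _ = D := by rw [← Real.rpow_add hDp]; norm_num
  have h4 : (A * Y) ^ (3 / 4 : ℝ) * (Y ^ 2 / 2) ^ (1 / 4 : ℝ) =
      A ^ (3 / 4 : ℝ) * Y ^ (5 / 4 : ℝ) / 2 ^ (1 / 4 : ℝ) := by
    rw [Real.mul_rpow hA0.le hYp.le, Real.div_rpow (by positivity) two_pos.le, ← Real.rpow_natCast,
      ← Real.rpow_mul hYp.le, mul_div_assoc', mul_assoc, ← Real.rpow_add hYp]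
    norm_num
  have h5 : (2 : ℝ) ^ (1 / 4 : ℝ) ≤ 2 := by
    calc (2 : ℝ) ^ (1 / 4 : ℝ) ≤ 2 ^ (1 : ℝ) :=
      Real.rpow_le_rpow_of_exponent_le one_le_two (by norm_num)
      _ = 2 := Real.rpow_one 2
  rw [h4] at h3
  rw [Real.rpow_neg hA0.le, Real.rpow_neg hYp.le, div_le_iff₀ hDp]
  have hp1 : 0 < A ^ (3 / 4 : ℝ) * Y ^ (5 / 4 : ℝ) := by positivity
  have h6 : A ^ (3 / 4 : ℝ) * Y ^ (5 / 4 : ℝ) / 2 ≤ D :=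
    (div_le_div_of_nonneg_left hp1.le (by positivity) h5).trans h3
  calc (1 : ℝ) = 2 * (A ^ (3 / 4 : ℝ))⁻¹ * (Y ^ (5 / 4 : ℝ))⁻¹ *
      (A ^ (3 / 4 : ℝ) * Y ^ (5 / 4 : ℝ) / 2) := by field_simp
    _ ≤ _ := by gcongr

theorem summable_one_add_rpow : Summable fun j : ℕ => (1 + (j : ℝ)) ^ (-(5 / 4) : ℝ) := by
  have h := (summable_nat_add_iff 1).2 (Real.summable_nat_rpow.2 (show (-(5 / 4) : ℝ) < -1 by norm_num))
  refine h.congr fun j => ?_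
  push_cast
  rw [add_comm]

/-- If the incomplete Gamma integrals decay away from the transition index, then the theta series
is close to its Dirichlet polynomial. -/
theorem norm_tsum_gaussUpper_sub_le {a w : ℂ} {A B : ℝ} (ha : 0 < a.re) (hw : 0 < w.re)
    (hA : 1 ≤ A) (hB : 0 ≤ B)
    (h1 : ∀ n : ℕ, A ≤ (n : ℝ) + 1 → ‖gaussUpper a n w‖ ≤ B / (|((n : ℝ) + 1) ^ 2 - A ^ 2| + A))
    (h2 : ∀ n : ℕ, (n : ℝ) + 1 ≤ A → ‖gaussLower a n w‖ ≤ B / (|((n : ℝ) + 1) ^ 2 - A ^ 2| + A)) :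
    ‖∑' n, gaussUpper a n w - Complex.Gammaℝ (2 * w) *
      ∑ n ∈ Finset.range ⌊A⌋₊, (((n + 1 : ℕ) : ℂ)) ^ (-(2 * w))‖ ≤
      4 * (∑' j : ℕ, (1 + (j : ℝ)) ^ (-(5 / 4) : ℝ)) * B * A ^ (-(3 / 4) : ℝ) := by
  set N := ⌊A⌋₊ with hN
  have hA0 : 0 ≤ A := by linarith
  have hNA : (N : ℝ) ≤ A := Nat.floor_le hA0
  have hAN : A < N + 1 := Nat.lt_floor_add_one A
  set S := ∑' j : ℕ, (1 + (j : ℝ)) ^ (-(5 / 4) : ℝ) with hS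
  set Q : ℝ := B * (2 * A ^ (-(3 / 4) : ℝ)) with hQ
  have hQ0 : 0 ≤ Q := by positivity
  have hgen : ∀ (n : ℕ) (j : ℝ), 0 ≤ j → j ≤ |(n : ℝ) + 1 - A| →
      B / (|((n : ℝ) + 1) ^ 2 - A ^ 2| + A) ≤ Q * (1 + j) ^ (-(5 / 4) : ℝ) := by
    intro n j hj0 hj
    have := one_div_abs_sq_sub_sq_add_le hA (k := (n : ℝ) + 1) (by positivity)
    rw [div_eq_mul_one_div, hQ, mul_assoc]
    refine mul_le_mul_of_nonneg_left (this.trans ?_) hB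
    refine mul_le_mul_of_nonneg_left ?_ (by positivity)
    exact Real.rpow_le_rpow_of_nonpos (by positivity) (by linarith) (by norm_num)
  have hsum := (hasSum_gaussUpper ha w).summable
  rw [← hsum.sum_add_tsum_nat_add N, Finset.mul_sum]
  have e1 : ∀ n, Complex.Gammaℝ (2 * w) * (((n + 1 : ℕ) : ℂ)) ^ (-(2 * w)) =
      gaussLower a n w + gaussUpper a n w := fun n => (gaussLower_add_gaussUpper ha n hw).symm
  rw [Finset.sum_congr rfl fun n _ => e1 n, Finset.sum_add_distrib]
  -- For n + 1 ≤ N the complete integral is lower plus upper, so only the lower parts of the head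
  -- and the upper parts of the tail remain.
  have e2 : ∑ n ∈ Finset.range N, gaussUpper a n w + ∑' j, gaussUpper a (j + N) w -
      (∑ n ∈ Finset.range N, gaussLower a n w + ∑ n ∈ Finset.range N, gaussUpper a n w) =
      ∑' j, gaussUpper a (j + N) w - ∑ n ∈ Finset.range N, gaussLower a n w := by ring
  rw [e2]
  have b1 : ‖∑' j, gaussUpper a (j + N) w‖ ≤ Q * S := by
    refine tsum_of_norm_bounded (summable_one_add_rpow.hasSum.mul_left Q) fun j => ?_
    have hc : ((j + N : ℕ) : ℝ) + 1 - A = j + (N + 1 - A) := by push_cast; ring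
    have hj : (0 : ℝ) ≤ j := j.cast_nonneg
    refine (h1 _ (by linarith)).trans (hgen _ j hj ?_)
    rw [hc]
    exact (by linarith : (j : ℝ) ≤ j + (N + 1 - A)).trans (le_abs_self _)
  have b2 : ‖∑ n ∈ Finset.range N, gaussLower a n w‖ ≤ Q * S := by
    refine (norm_sum_le _ _).trans ?_
    have : ∀ n ∈ Finset.range N, ‖gaussLower a n w‖ ≤
        Q * (1 + ((N - 1 - n : ℕ) : ℝ)) ^ (-(5 / 4) : ℝ) := by
      intro n hn
      have hnN : n + 1 ≤ N := Finset.mem_range.1 hn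
      have hnN' : (n : ℝ) + 1 ≤ N := by exact_mod_cast hnN
      refine (h2 n (by linarith)).trans (hgen n _ (Nat.cast_nonneg _) ?_)
      rw [Nat.sub_sub, Nat.cast_sub (by omega), abs_sub_comm]
      push_cast
      exact (by linarith : (N : ℝ) - (1 + n) ≤ A - (n + 1)).trans (le_abs_self _)
    refine (Finset.sum_le_sum this).trans ?_
    rw [Finset.sum_range_reflect (fun j => Q * (1 + (j : ℝ)) ^ (-(5 / 4) : ℝ)) N, ← Finset.mul_sum]
    refine mul_le_mul_of_nonneg_left ?_ hQ0
    exact summable_one_add_rpow.sum_le_tsum _ fun j _ => by positivity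
  calc _ ≤ _ := norm_sub_le _ _
    _ ≤ Q * S + Q * S := add_le_add b1 b2
    _ = _ := by rw [hQ]; ring

theorem four_le_sqrt_div {t : ℝ} (ht : 101 ≤ t) : 4 ≤ Real.sqrt (t / (2 * Real.pi)) := by
  refine Real.le_sqrt_of_sq_le ?_
  rw [le_div_iff₀ (by positivity)]
  linarith [Real.pi_lt_d4]

theorem sqrt_div_sq {t : ℝ} (ht : 0 ≤ t) :
    Real.pi * Real.sqrt (t / (2 * Real.pi)) ^ 2 = t / 2 := by
  rw [Real.sq_sqrt (by positivity)]
  field_simp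

theorem one_sub_rotDir_im_mul_le {t : ℝ} (ht : 101 ≤ t) :
    (1 - (rotDir t).im) * Real.sqrt (t / (2 * Real.pi)) ^ 2 ≤ 1 / 16 := by
  have hpi := Real.pi_gt_three
  rw [Real.sq_sqrt (by positivity)]
  calc _ ≤ (1 / t) ^ 2 / 2 * (t / (2 * Real.pi)) := by
        gcongr
        exact one_sub_rotDir_im_le t
    _ = 1 / (4 * Real.pi * t) := by field_simp; ring
    _ ≤ 1 / 16 := by gcongr; nlinarith

theorem norm_gaussUpper_rotDir_le {t : ℝ} (ht : 101 ≤ t) {w : ℂ} (hw0 : 1 / 8 ≤ w.re)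
    (hw1 : w.re ≤ 1) (hv : |w.im - t / 2| ≤ 1) (n : ℕ)
    (hn : Real.sqrt (t / (2 * Real.pi)) ≤ (n : ℝ) + 1) :
    ‖gaussUpper (rotDir t) n w‖ ≤ 34 * (Real.exp 1 * Real.exp (-(Real.pi * w.im / 2))) /
      (|((n : ℝ) + 1) ^ 2 - Real.sqrt (t / (2 * Real.pi)) ^ 2| + Real.sqrt (t / (2 * Real.pi))) := by
  obtain ⟨hv1, hv2⟩ := abs_le.1 hv
  rw [← sqrt_div_sq (by linarith : 0 ≤ t)] at hv
  rw [gaussUpper, norm_mul]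
  have h1 := norm_rotDir_cpow_le (t := t) (w := w) (by linarith) (by linarith)
  have h2 := norm_integral_gaussTerm_Ioi_le (four_le_sqrt_div ht) (rotDir_re_pos (by linarith))
    (rotDir_im_le t) (one_sub_rotDir_im_mul_le ht) (by linarith) hw1 hv n hn
  exact (mul_le_mul h1 h2 (norm_nonneg _) (by positivity)).trans_eq (by ring)

theorem norm_gaussLower_rotDir_le {t : ℝ} (ht : 101 ≤ t) {w : ℂ} (hw0 : 1 / 8 ≤ w.re)
    (hw1 : w.re ≤ 1) (hv : |w.im - t / 2| ≤ 1) (n : ℕ)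
    (hn : (n : ℝ) + 1 ≤ Real.sqrt (t / (2 * Real.pi))) :
    ‖gaussLower (rotDir t) n w‖ ≤ 34 * (Real.exp 1 * Real.exp (-(Real.pi * w.im / 2))) /
      (|((n : ℝ) + 1) ^ 2 - Real.sqrt (t / (2 * Real.pi)) ^ 2| + Real.sqrt (t / (2 * Real.pi))) := by
  obtain ⟨hv1, hv2⟩ := abs_le.1 hv
  rw [← sqrt_div_sq (by linarith : 0 ≤ t)] at hv
  rw [gaussLower, norm_mul]
  have h1 := norm_rotDir_cpow_le (t := t) (w := w) (by linarith) (by linarith)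
  have h2 := norm_integral_gaussTerm_Ioc_le (four_le_sqrt_div ht) (rotDir_re_pos (by linarith))
    (rotDir_im_pos (by linarith)) (rotDir_im_le t) hw0 hw1 hv n hn
  exact (mul_le_mul h1 h2 (norm_nonneg _) (by positivity)).trans_eq (by ring)

/-- Absolute constant in the approximate functional equation for the completed zeta function. -/
noncomputable def thetaConst : ℝ :=
  8 * (∑' j : ℕ, (1 + (j : ℝ)) ^ (-(5 / 4) : ℝ)) * 34 * Real.exp 1 + Real.exp 1

/-- Both theta series are truncated at A. Since |a| = 1, the dual direction 1/a is the conjugate of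
a, so conjugation reduces the second series to the estimates for the first; the strip for Re w is
symmetric under w ↦ 1/2 - w. The two polar terms are of lower order. -/
theorem norm_completedRiemannZeta_sub_le {t : ℝ} (ht : 101 ≤ t) {w : ℂ} (hw0 : 1 / 8 ≤ w.re)
    (hw1 : w.re ≤ 3 / 8) (hv : |w.im - t / 2| ≤ 1) :
    ‖completedRiemannZeta (2 * w) -
      (Complex.Gammaℝ (2 * w) * ∑ n ∈ Finset.range ⌊Real.sqrt (t / (2 * Real.pi))⌋₊,
        (((n + 1 : ℕ) : ℂ)) ^ (-(2 * w)) +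
      Complex.Gammaℝ (2 * (1 / 2 - w)) * ∑ n ∈ Finset.range ⌊Real.sqrt (t / (2 * Real.pi))⌋₊,
        (((n + 1 : ℕ) : ℂ)) ^ (-(2 * (1 / 2 - w))))‖ ≤
      thetaConst * Real.exp (-(Real.pi * w.im / 2)) *
        Real.sqrt (t / (2 * Real.pi)) ^ (-(3 / 4) : ℝ) := by
  obtain ⟨hv1, hv2⟩ := abs_le.1 hv
  have hA4 := four_le_sqrt_div ht
  have hA2 := sqrt_div_sq (by linarith : 0 ≤ t)
  set A := Real.sqrt (t / (2 * Real.pi)) with hA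
  have hpi := Real.pi_gt_three
  have hvA : A ≤ w.im := by nlinarith
  have hvp : 0 < w.im := by linarith
  set a := rotDir t with ha
  have hare : 0 < a.re := rotDir_re_pos (by linarith)
  have hare' : 0 < (1 / a).re := by rw [ha, one_div_rotDir]; exact hare
  set B := Real.exp 1 * Real.exp (-(Real.pi * w.im / 2)) with hB
  have hB0 : 0 < B := by positivity
  have hw0' : w ≠ 0 := by rintro rfl; simp at hvp
  have hw1' : w ≠ 1 / 2 := by rintro rfl; simp at hvp
  have b1 := norm_tsum_gaussUpper_sub_le (a := a) (w := w) (A := A) (B := 34 * B) hare (by linarith)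
    (by linarith) (by positivity)
    (fun n hn => norm_gaussUpper_rotDir_le ht hw0 (by linarith) hv n hn)
    (fun n hn => norm_gaussLower_rotDir_le ht hw0 (by linarith) hv n hn)
  have hcre : (1 / 2 - w).re = 1 / 2 - w.re := by simp
  set w' := starRingEnd ℂ (1 / 2 - w) with hw'
  have hw're : w'.re = 1 / 2 - w.re := by rw [hw', Complex.conj_re, hcre]
  have hw'im : w'.im = w.im := by simp [hw']
  -- The point w' has the same imaginary part as w, so the hypotheses at height t still apply.
  have hww : 1 / 2 - w = starRingEnd ℂ w' := by rw [hw', Complex.conj_conj]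
  have b2 := norm_tsum_gaussUpper_sub_le (a := 1 / a) (w := 1 / 2 - w) (A := A) (B := 34 * B) hare'
    (by rw [hcre]; linarith) (by linarith) (by positivity)
    (fun n hn => by
      rw [ha, one_div_rotDir, hww, conj_gaussUpper hare, RCLike.norm_conj]
      rw [hB, ← hw'im]
      exact norm_gaussUpper_rotDir_le ht (by rw [hw're]; linarith) (by rw [hw're]; linarith)
        (by rw [hw'im]; exact hv) n hn)
    (fun n hn => by
      rw [ha, one_div_rotDir, hww, conj_gaussLower hare, RCLike.norm_conj]
      rw [hB, ← hw'im]
      exact norm_gaussLower_rotDir_le ht (by rw [hw're]; linarith) (by rw [hw're]; linarith)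
        (by rw [hw'im]; exact hv) n hn)
  have haw : ‖a ^ w‖ ≤ B := norm_rotDir_cpow_le (by linarith) (by linarith)
  have b3 : ‖a ^ w / (2 * w)‖ ≤ B / (2 * w.im) := by
    rw [norm_div]
    have : 2 * w.im ≤ ‖2 * w‖ := by
      refine le_trans ?_ (Complex.abs_im_le_norm _)
      have : (2 * w).im = 2 * w.im := by simp
      rw [this]; exact le_abs_self _
    gcongr
  have b4 : ‖a ^ w * (1 / a ^ (1 / 2 : ℂ)) / (1 - 2 * w)‖ ≤ B / (2 * w.im) := by
    have h1 : ‖a ^ (1 / 2 : ℂ)‖ = 1 := by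
      rw [ha, norm_rotDir_cpow (by linarith)]
      norm_num
    rw [norm_div, norm_mul, norm_div, h1, norm_one, div_one, mul_one]
    have : 2 * w.im ≤ ‖1 - 2 * w‖ := by
      refine le_trans ?_ (Complex.abs_im_le_norm _)
      have : (1 - 2 * w).im = -(2 * w.im) := by simp
      rw [this, abs_neg]; exact le_abs_self _
    gcongr
  have b5 : B / w.im ≤ B * A ^ (-(3 / 4) : ℝ) := by
    rw [div_eq_mul_inv]
    refine mul_le_mul_of_nonneg_left ?_ hB0.le
    calc w.im⁻¹ ≤ A⁻¹ := inv_anti₀ (by linarith) hvA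
      _ = A ^ (-1 : ℝ) := (Real.rpow_neg_one A).symm
      _ ≤ _ := Real.rpow_le_rpow_of_exponent_le (by linarith) (by norm_num)
  rw [completedRiemannZeta_eq_gaussUpper hare hw0' hw1']
  rw [show ∀ p q r s u v : ℂ, p + q - r - s - (u + v) = (p - u) + (q - v) - r - s from
    fun p q r s u v => by ring]
  have b6 : B / (2 * w.im) + B / (2 * w.im) = B / w.im := by field_simp; ring
  refine (norm_sub_le _ _).trans ((add_le_add ((norm_sub_le _ _).trans
    (add_le_add ((norm_add_le _ _).trans (add_le_add b1 b2)) b3)) b4).trans ?_)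
  have e : thetaConst * Real.exp (-(Real.pi * w.im / 2)) * A ^ (-(3 / 4) : ℝ) =
      4 * (∑' j : ℕ, (1 + (j : ℝ)) ^ (-(5 / 4) : ℝ)) * (34 * B) * A ^ (-(3 / 4) : ℝ) +
      4 * (∑' j : ℕ, (1 + (j : ℝ)) ^ (-(5 / 4) : ℝ)) * (34 * B) * A ^ (-(3 / 4) : ℝ) +
      B * A ^ (-(3 / 4) : ℝ) := by
    rw [thetaConst, hB]; ring
  rw [e]
  linarith

/-- The main sum of the approximate functional equation, as a holomorphic function. -/
noncomputable def afeSum (N : ℕ) (z : ℂ) : ℂ :=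
  ∑ n ∈ Finset.Icc 1 N, (Complex.exp (Complex.I * rsThetaC z) * (n : ℂ) ^ (-(1 / 2 + Complex.I * z)) +
    Complex.exp (-(Complex.I * rsThetaC z)) * (n : ℂ) ^ (-(1 / 2 - Complex.I * z)))

theorem afeSum_eq_range (N : ℕ) (z : ℂ) : afeSum N z =
    Complex.exp (Complex.I * rsThetaC z) *
      ∑ n ∈ Finset.range N, (((n + 1 : ℕ) : ℂ)) ^ (-(1 / 2 + Complex.I * z)) +
    Complex.exp (-(Complex.I * rsThetaC z)) *
      ∑ n ∈ Finset.range N, (((n + 1 : ℕ) : ℂ)) ^ (-(1 / 2 - Complex.I * z)) := by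
  have h : ∀ f : ℕ → ℂ, ∑ n ∈ Finset.Icc 1 N, f n = ∑ n ∈ Finset.range N, f (n + 1) := by
    intro f
    rw [Finset.range_eq_Ico, Finset.sum_Ico_add' f 0 N 1, zero_add, Finset.Ico_add_one_right_eq_Icc]
  rw [afeSum, Finset.sum_add_distrib, h, h, Finset.mul_sum, Finset.mul_sum]

theorem thetaConst_nonneg : 0 ≤ thetaConst := by
  have : 0 ≤ ∑' j : ℕ, (1 + (j : ℝ)) ^ (-(5 / 4) : ℝ) := tsum_nonneg fun j => by positivity
  have := Real.exp_pos 1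
  unfold thetaConst
  positivity

/-- Division of the preceding estimate by `gammaGeom z`. The exponentials cancel and a factor of
order A^{1/2} is lost, leaving A^{-3/4 + 1/2}. -/
theorem norm_hardyC_sub_afeSum_le {t : ℝ} (ht : 101 ≤ t) {z : ℂ} (hz : ‖z - t‖ ≤ 1 / 8) :
    ‖hardyC z - afeSum ⌊Real.sqrt (t / (2 * Real.pi))⌋₊ z‖ ≤
      2 * Real.exp 1 * thetaConst * Real.sqrt (t / (2 * Real.pi)) ^ (-(1 / 4) : ℝ) := by
  have hre : |z.re - t| ≤ 1 / 8 := by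
    have := Complex.abs_re_le_norm (z - t)
    rw [Complex.sub_re, Complex.ofReal_re] at this
    exact this.trans hz
  have him : |z.im| ≤ 1 / 8 := by
    have := Complex.abs_im_le_norm (z - t)
    rw [Complex.sub_im, Complex.ofReal_im, sub_zero] at this
    exact this.trans hz
  obtain ⟨hre1, hre2⟩ := abs_le.1 hre
  obtain ⟨him1, him2⟩ := abs_le.1 him
  have hz0 : 0 < z.re := by linarith
  set w : ℂ := 1 / 4 + Complex.I * (z / 2) with hw
  have hwre : w.re = 1 / 4 - z.im / 2 := by
    simp [hw]; ring
  have hwim : w.im = z.re / 2 := by simp [hw]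
  have h := norm_completedRiemannZeta_sub_le ht (w := w) (by rw [hwre]; linarith)
    (by rw [hwre]; linarith) (by rw [hwim, abs_le]; constructor <;> linarith)
  have e1 : 2 * w = 1 / 2 + Complex.I * z := by rw [hw]; ring
  have e2 : 2 * (1 / 2 - w) = 1 / 2 - Complex.I * z := by rw [hw]; ring
  rw [e1, e2, ← hardyC_mul_gammaGeom hz0, Gammaℝ_half_add hz0, Gammaℝ_half_sub hz0] at h
  have hA4 := four_le_sqrt_div ht
  have hA2 := sqrt_div_sq (by linarith : 0 ≤ t)
  set A := Real.sqrt (t / (2 * Real.pi)) with hA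
  set N := ⌊A⌋₊
  rw [show ∀ p q g r s u v : ℂ, p * g - (q * g * r + s * g * u) = (p - (q * r + s * u)) * g from
    fun p q g r s u v => by ring, ← afeSum_eq_range, norm_mul] at h
  · have hg := one_le_mul_norm_gammaGeom_sq (z := z) (by linarith)
    rw [← hw] at hg
    set G := ‖gammaGeom z‖
    set F := ‖hardyC z - afeSum N z‖
    have hA0 : 0 < A := by linarith
    have hwn : Real.sqrt ‖w‖ ≤ 4 * A := by
      refine Real.sqrt_le_iff.2 ⟨by positivity, ?_⟩
      have h1 : ‖w‖ ≤ |w.re| + |w.im| := Complex.norm_le_abs_re_add_abs_im w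
      have h2 : |w.re| ≤ 1 := by rw [hwre, abs_le]; constructor <;> linarith
      have h3 : |w.im| ≤ t := by rw [hwim, abs_le]; constructor <;> linarith
      have := Real.pi_lt_four
      nlinarith
    refine abs_le_of_sq_le_sq' ?_ (by have := thetaConst_nonneg; positivity) |>.2
    have hF0 : 0 ≤ F := norm_nonneg _
    have hsq : (F * G) ^ 2 ≤ (thetaConst * Real.exp (-(Real.pi * w.im / 2)) *
        A ^ (-(3 / 4) : ℝ)) ^ 2 := by gcongr
    have hE : Real.exp (-(Real.pi * w.im / 2)) ^ 2 * Real.exp (Real.pi * z.re / 2) = 1 := by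
      rw [← Real.exp_nat_mul, ← Real.exp_add, hwim, Real.exp_eq_one_iff]
      push_cast; ring
    have hE2 : Real.exp 2 = Real.exp 1 ^ 2 := by rw [← Real.exp_nat_mul]; norm_num
    have hAp : (A ^ (-(3 / 4) : ℝ)) ^ 2 * A = (A ^ (-(1 / 4) : ℝ)) ^ 2 := by
      rw [← Real.rpow_mul_natCast hA0.le, ← Real.rpow_mul_natCast hA0.le, ← Real.rpow_add_one hA0.ne']
      norm_num
    calc F ^ 2 = F ^ 2 * 1 := by ring
      _ ≤ F ^ 2 * (Real.exp 2 * Real.exp (Real.pi * z.re / 2) * Real.sqrt ‖w‖ * G ^ 2) := by gcongr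
      _ = (F * G) ^ 2 * (Real.exp 2 * Real.exp (Real.pi * z.re / 2) * Real.sqrt ‖w‖) := by ring
      _ ≤ (thetaConst * Real.exp (-(Real.pi * w.im / 2)) * A ^ (-(3 / 4) : ℝ)) ^ 2 *
        (Real.exp 2 * Real.exp (Real.pi * z.re / 2) * (4 * A)) := by gcongr
      _ = 4 * Real.exp 2 * thetaConst ^ 2 *
        (Real.exp (-(Real.pi * w.im / 2)) ^ 2 * Real.exp (Real.pi * z.re / 2)) *
        ((A ^ (-(3 / 4) : ℝ)) ^ 2 * A) := by ring
      _ = _ := by rw [hE, hAp, hE2]; ring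
  -- Any value serves: `v` does not occur in the rewriting identity.
  · exact 0

/-! ### Crude comparison with the Dirichlet polynomial in large discs -/

/-- Im θ(z) is Im z · log A up to 25 = 8 + 17: the Taylor remainder is at most 8 because r² ≤ t, and
replacing θ'(t) by log A costs at most (17/t) · t. -/
theorem norm_exp_rsThetaC_le {t : ℝ} (ht : 101 ≤ t) {r : ℝ} (hr : 0 ≤ r) (hrt : r ^ 2 ≤ t) {z : ℂ}
    (hz : ‖z - t‖ ≤ r) :
    ‖Complex.exp (Complex.I * rsThetaC z)‖ ≤
        Real.exp 25 * Real.sqrt (t / (2 * Real.pi)) ^ (-z.im) ∧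
      ‖Complex.exp (-(Complex.I * rsThetaC z))‖ ≤
        Real.exp 25 * Real.sqrt (t / (2 * Real.pi)) ^ z.im := by
  have hrt' : r ≤ t / 10 := by nlinarith
  have hA4 := four_le_sqrt_div ht
  have hL := abs_deriv_rsTheta_sub_log_le (t := t) (by linarith)
  have hlog : Real.log (t / (2 * Real.pi)) / 2 = Real.log (Real.sqrt (t / (2 * Real.pi))) := by
    rw [Real.log_sqrt (by positivity)]
  rw [hlog] at hL
  set A := Real.sqrt (t / (2 * Real.pi)) with hA
  set L := deriv rsTheta t with hLd
  have hE := norm_rsThetaC_sub_le (t := t) (z := z) (by linarith) (by linarith)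
  set E := rsThetaC z - rsTheta t - L * (z - t) with hEd
  have hE8 : ‖E‖ ≤ 8 := by
    refine hE.trans ?_
    have : ‖z - t‖ ^ 2 ≤ t := (pow_le_pow_left₀ (norm_nonneg _) hz 2).trans hrt
    calc 8 / t * ‖z - t‖ ^ 2 ≤ 8 / t * t := by gcongr
      _ = 8 := by field_simp
  have hT : rsThetaC z = E + rsTheta t + L * (z - t) := by rw [hEd]; ring
  have him : (rsThetaC z).im = E.im + L * z.im := by
    rw [hT]; simp
  have hEi := (Complex.abs_im_le_norm E).trans hE8
  have hzi : |z.im| ≤ r := by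
    have := Complex.abs_im_le_norm (z - t)
    rw [Complex.sub_im, Complex.ofReal_im, sub_zero] at this
    exact this.trans hz
  have hLz : |L * z.im - Real.log A * z.im| ≤ 17 := by
    rw [← sub_mul, abs_mul]
    calc _ ≤ 17 / t * t := by gcongr; linarith
      _ = 17 := by field_simp
  have hA0 : 0 < A := by linarith
  rw [abs_le] at hEi hLz
  constructor
  · rw [Complex.norm_exp, Real.rpow_def_of_pos hA0, ← Real.exp_add]
    refine Real.exp_le_exp.2 ?_
    rw [Complex.I_mul_re, him]
    linarith
  · rw [Complex.norm_exp, Real.rpow_def_of_pos hA0, ← Real.exp_add]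
    refine Real.exp_le_exp.2 ?_
    rw [Complex.neg_re, Complex.I_mul_re, him]
    linarith

/-- The growth A^y of P is offset by N^{-y} in the truncation error of ζ, at the price of 2^y since
A ≤ 2N. The decay A^{-y} of Q offsets the growth of the dual sum. -/
theorem norm_mul_zeta_sub_sub_le {s s' P Q : ℂ} {y A M : ℝ} (hA : 2 ≤ A) (hy : 0 ≤ y) (hM : 0 ≤ M)
    (hs : s.re = 1 / 2 + y) (hs' : s'.re = 1 / 2 - y) (hi : 1 ≤ |s.im|)
    (hP : ‖P‖ ≤ M * A ^ y) (hQ : ‖Q‖ ≤ M * A ^ (-y)) :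
    ‖P * (riemannZeta s - ∑ n ∈ Finset.Icc 1 ⌊A⌋₊, (n : ℂ) ^ (-s)) -
        Q * ∑ n ∈ Finset.Icc 1 ⌊A⌋₊, (n : ℂ) ^ (-s')‖ ≤
      M * ((4 + 2 * ‖s‖ + A) * A ^ 2 * 2 ^ y) + M * A := by
  have hA0 : 0 < A := by linarith
  set N := ⌊A⌋₊ with hN
  have hN1 : 1 ≤ N := Nat.le_floor (by push_cast; linarith)
  have hNA : (N : ℝ) ≤ A := Nat.floor_le hA0.le
  have hAN : A < N + 1 := Nat.lt_floor_add_one A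
  have hN1' : (1 : ℝ) ≤ N := by exact_mod_cast hN1
  have hN0 : (0 : ℝ) < N := by linarith
  have hA2N : A ≤ 2 * N := by linarith
  have h1 := norm_riemannZeta_sub_sum_le (s := s) (by rw [hs]; linarith) hi hN1
  have e1 : A ^ y * (N : ℝ) ^ (2 - s.re) ≤ A ^ 2 * 2 ^ y := by
    calc A ^ y * (N : ℝ) ^ (2 - s.re) ≤ (2 * N) ^ y * (N : ℝ) ^ (2 - y) := by
          gcongr
          rw [hs]; linarith
      _ = 2 ^ y * (N : ℝ) ^ (2 : ℝ) := by
          rw [Real.mul_rpow two_pos.le hN0.le, mul_assoc, ← Real.rpow_add hN0]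
          norm_num
      _ ≤ 2 ^ y * A ^ (2 : ℝ) := by gcongr
      _ = A ^ 2 * 2 ^ y := by rw [mul_comm]; norm_num
  have b1 : ‖P * (riemannZeta s - ∑ n ∈ Finset.Icc 1 N, (n : ℂ) ^ (-s))‖ ≤
      M * ((4 + 2 * ‖s‖ + A) * A ^ 2 * 2 ^ y) := by
    rw [norm_mul]
    calc _ ≤ M * A ^ y * ((4 + 2 * ‖s‖ + N) * (N : ℝ) ^ (2 - s.re)) := by gcongr
      _ = M * ((4 + 2 * ‖s‖ + N) * (A ^ y * (N : ℝ) ^ (2 - s.re))) := by ring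
      _ ≤ M * ((4 + 2 * ‖s‖ + A) * (A ^ 2 * 2 ^ y)) := by gcongr
      _ = _ := by ring
  have b2 : ‖Q * ∑ n ∈ Finset.Icc 1 N, (n : ℂ) ^ (-s')‖ ≤ M * A := by
    rw [norm_mul]
    have h2 : ‖∑ n ∈ Finset.Icc 1 N, (n : ℂ) ^ (-s')‖ ≤ A * A ^ y := by
      refine (norm_sum_le _ _).trans ?_
      have : ∀ n ∈ Finset.Icc 1 N, ‖(n : ℂ) ^ (-s')‖ ≤ A ^ y := by
        intro n hn
        obtain ⟨hn1, hnN⟩ := Finset.mem_Icc.1 hn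
        have hn1' : (1 : ℝ) ≤ n := by exact_mod_cast hn1
        have hnN' : (n : ℝ) ≤ N := by exact_mod_cast hnN
        rw [norm_natCast_cpow_neg (by omega), hs']
        calc (n : ℝ) ^ (-(1 / 2 - y)) ≤ (n : ℝ) ^ y := by
              gcongr
              linarith
          _ ≤ A ^ y := by gcongr; linarith
      refine (Finset.sum_le_sum this).trans ?_
      rw [Finset.sum_const, Nat.card_Icc, nsmul_eq_mul, Nat.add_sub_cancel]
      gcongr
    calc _ ≤ M * A ^ (-y) * (A * A ^ y) := by gcongr
      _ = M * A * (A ^ (-y) * A ^ y) := by ring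
      _ = M * A := by rw [← Real.rpow_add hA0]; norm_num
  exact (norm_sub_le _ _).trans (add_le_add b1 b2)

/-- For Im z ≤ 0 the definition of `hardyC` has its zeta value on or right of the critical line; for
Im z ≥ 0 the reflected form does, and the two sums exchange roles. -/
theorem norm_hardyC_sub_afeSum_le_mul_two_rpow {t : ℝ} (ht : 101 ≤ t) {r : ℝ} (hr : 0 ≤ r)
    (hrt : r ^ 2 ≤ t) {z : ℂ} (hz : ‖z - t‖ ≤ r) :
    ‖hardyC z - afeSum ⌊Real.sqrt (t / (2 * Real.pi))⌋₊ z‖ ≤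
      2 * Real.exp 25 * t ^ 2 * 2 ^ r := by
  have hrt' : r ≤ t / 10 := by nlinarith
  have hA4 := four_le_sqrt_div ht
  have hA2 := sqrt_div_sq (by linarith : 0 ≤ t)
  obtain ⟨p1, p2⟩ := norm_exp_rsThetaC_le ht hr hrt hz
  set A := Real.sqrt (t / (2 * Real.pi)) with hA
  have hpi := Real.pi_gt_three
  have hA6 : A ^ 2 ≤ t / 6 := by nlinarith
  have hAt : A ≤ t / 6 := by nlinarith
  have hzi : |z.im| ≤ r := by
    have := Complex.abs_im_le_norm (z - t)
    rw [Complex.sub_im, Complex.ofReal_im, sub_zero] at this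
    exact this.trans hz
  have hzr : |z.re - t| ≤ r := by
    have := Complex.abs_re_le_norm (z - t)
    rw [Complex.sub_re, Complex.ofReal_re] at this
    exact this.trans hz
  obtain ⟨hzi1, hzi2⟩ := abs_le.1 hzi
  obtain ⟨hzr1, hzr2⟩ := abs_le.1 hzr
  have hz0 : 0 < z.re := by linarith
  have hzn : ‖z‖ ≤ 1.1 * t := by
    have : ‖z‖ ≤ ‖z - t‖ + ‖(t : ℂ)‖ := by
      simpa using norm_add_le (z - t) (t : ℂ)
    rw [Complex.norm_real, Real.norm_of_nonneg (by linarith)] at this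
    linarith
  have hIz : ‖Complex.I * z‖ ≤ 1.1 * t := by rw [norm_mul, Complex.norm_I, one_mul]; exact hzn
  have hM : ∀ y : ℝ, ∀ s : ℂ, 0 ≤ y → y ≤ r → ‖s‖ ≤ 1 / 2 + 1.1 * t →
      Real.exp 25 * ((4 + 2 * ‖s‖ + A) * A ^ 2 * 2 ^ y) + Real.exp 25 * A ≤
      2 * Real.exp 25 * t ^ 2 * 2 ^ r := by
    intro y s hy hyr hs
    have h1 : (4 + 2 * ‖s‖ + A) * A ^ 2 ≤ t ^ 2 := by
      calc _ ≤ (6 * t) * (t / 6) := by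
            refine mul_le_mul (by linarith) hA6 (by positivity) (by positivity)
        _ = t ^ 2 := by ring
    have h2 : (2 : ℝ) ^ y ≤ 2 ^ r := Real.rpow_le_rpow_of_exponent_le one_le_two hyr
    have h3 : A ≤ t ^ 2 * 2 ^ r := by
      have h4 : (1 : ℝ) ≤ 2 ^ r := Real.one_le_rpow one_le_two hr
      have h5 : A ≤ t ^ 2 := by nlinarith
      calc A ≤ t ^ 2 * 1 := by linarith
        _ ≤ _ := by gcongr
    calc _ ≤ Real.exp 25 * (t ^ 2 * 2 ^ r) + Real.exp 25 * (t ^ 2 * 2 ^ r) := by gcongr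
      _ = _ := by ring
  have hsum : afeSum ⌊A⌋₊ z = Complex.exp (Complex.I * rsThetaC z) *
      ∑ n ∈ Finset.Icc 1 ⌊A⌋₊, (n : ℂ) ^ (-(1 / 2 + Complex.I * z)) +
      Complex.exp (-(Complex.I * rsThetaC z)) *
      ∑ n ∈ Finset.Icc 1 ⌊A⌋₊, (n : ℂ) ^ (-(1 / 2 - Complex.I * z)) := by
    rw [afeSum, Finset.sum_add_distrib, Finset.mul_sum, Finset.mul_sum]
  have n1 : ‖1 / 2 + Complex.I * z‖ ≤ 1 / 2 + 1.1 * t := by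
    refine (norm_add_le _ _).trans (add_le_add (by norm_num) hIz)
  have n2 : ‖1 / 2 - Complex.I * z‖ ≤ 1 / 2 + 1.1 * t := by
    refine (norm_sub_le _ _).trans (add_le_add (by norm_num) hIz)
  rcases le_total z.im 0 with h | h
  · have := norm_mul_zeta_sub_sub_le (s := 1 / 2 + Complex.I * z) (s' := 1 / 2 - Complex.I * z)
      (y := -z.im) (A := A) (by linarith) (by linarith) (Real.exp_pos 25).le (by simp) (by simp)
      (by simp; rw [abs_of_pos hz0]; linarith) p1 (by rw [neg_neg]; exact p2)
    have e : hardyC z - afeSum ⌊A⌋₊ z = Complex.exp (Complex.I * rsThetaC z) *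
        (riemannZeta (1 / 2 + Complex.I * z) - ∑ n ∈ Finset.Icc 1 ⌊A⌋₊,
          (n : ℂ) ^ (-(1 / 2 + Complex.I * z))) -
        Complex.exp (-(Complex.I * rsThetaC z)) *
        ∑ n ∈ Finset.Icc 1 ⌊A⌋₊, (n : ℂ) ^ (-(1 / 2 - Complex.I * z)) := by
      rw [hsum, hardyC]; ring
    rw [e]
    exact this.trans (hM _ _ (by linarith) (by linarith) n1)
  · have := norm_mul_zeta_sub_sub_le (s := 1 / 2 - Complex.I * z) (s' := 1 / 2 + Complex.I * z)
      (y := z.im) (A := A) (by linarith) h (Real.exp_pos 25).le (by simp) (by simp; ring)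
      (by simp; rw [abs_of_pos hz0]; linarith) p2 p1
    have e : hardyC z - afeSum ⌊A⌋₊ z = Complex.exp (-(Complex.I * rsThetaC z)) *
        (riemannZeta (1 / 2 - Complex.I * z) - ∑ n ∈ Finset.Icc 1 ⌊A⌋₊,
          (n : ℂ) ^ (-(1 / 2 - Complex.I * z))) -
        Complex.exp (Complex.I * rsThetaC z) *
        ∑ n ∈ Finset.Icc 1 ⌊A⌋₊, (n : ℂ) ^ (-(1 / 2 + Complex.I * z)) := by
      rw [hsum, hardyC_eq_reflect hz0]; ring
    rw [e]
    exact this.trans (hM _ _ h hzi2 n2)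

/-! ### Linearization of the phase -/

theorem sum_one_div_sqrt_le (N : ℕ) :
    ∑ n ∈ Finset.Icc 1 N, 1 / Real.sqrt n ≤ 2 * Real.sqrt N := by
  induction N with
  | zero => simp
  | succ N ih =>
    rw [Finset.sum_Icc_succ_top (by omega)]
    have h0 := Real.sqrt_nonneg (N : ℝ)
    have h1 : 0 < Real.sqrt ((N + 1 : ℕ) : ℝ) := Real.sqrt_pos.2 (by positivity)
    have h2 := Real.sq_sqrt (N.cast_nonneg (α := ℝ))
    have h3 := Real.sq_sqrt ((N + 1).cast_nonneg (α := ℝ))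
    have h4 : 1 / Real.sqrt ((N + 1 : ℕ) : ℝ) ≤ 2 * Real.sqrt ((N + 1 : ℕ) : ℝ) - 2 * Real.sqrt N := by
      rw [div_le_iff₀ h1]
      push_cast at h3 ⊢
      nlinarith [sq_nonneg (Real.sqrt ((N : ℝ) + 1) - Real.sqrt N)]
    linarith

/-- The main sum with the phase linearized at `t`. -/
noncomputable def linSum (N : ℕ) (t : ℝ) (z : ℂ) : ℂ :=
  ∑ n ∈ Finset.Icc 1 N, ((1 / Real.sqrt n : ℝ) : ℂ) *
    (Complex.exp (Complex.I * ((rsTheta t - t * Real.log n : ℝ) +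
        (deriv rsTheta t - Real.log n : ℝ) * (z - t))) +
      Complex.exp (-(Complex.I * ((rsTheta t - t * Real.log n : ℝ) +
        (deriv rsTheta t - Real.log n : ℝ) * (z - t)))))

theorem natCast_cpow_neg_half {n : ℕ} (hn : n ≠ 0) (u : ℂ) :
    (n : ℂ) ^ (-(1 / 2 + u)) = ((1 / Real.sqrt n : ℝ) : ℂ) * Complex.exp (-(u * Real.log n)) := by
  have hn0 : (n : ℂ) ≠ 0 := by exact_mod_cast hn
  have hnp : (0 : ℝ) < n := by exact_mod_cast Nat.pos_of_ne_zero hn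
  have e1 : Real.sqrt n = Real.exp (Real.log n / 2) := by
    rw [← Real.log_sqrt hnp.le, Real.exp_log (Real.sqrt_pos.2 hnp)]
  rw [Complex.cpow_def_of_ne_zero hn0, ← Complex.natCast_log, e1, one_div (Real.exp _), ← Real.exp_neg,
    Complex.ofReal_exp, ← Complex.exp_add]
  congr 1
  push_cast
  ring

theorem norm_exp_add_sub_exp_le {p e : ℂ} (he : ‖e‖ ≤ 1) :
    ‖Complex.exp (p + e) - Complex.exp p‖ ≤ 2 * Real.exp ‖p.re‖ * ‖e‖ := by
  rw [Complex.exp_add, ← mul_sub_one, norm_mul, Complex.norm_exp]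
  have h1 := Complex.norm_exp_sub_one_le he
  have h2 : Real.exp p.re ≤ Real.exp ‖p.re‖ := Real.exp_le_exp.2 (Real.le_norm_self _)
  calc _ ≤ Real.exp ‖p.re‖ * (2 * ‖e‖) := by gcongr
    _ = _ := by ring

/-- The Taylor remainder E of θ is at most 8r²/t ≤ 1, so each exponential changes by a factor 1 +
O(r²/t); its modulus is at most e^{Lr}, and ∑ n^{-1/2} ≤ 2t^{1/4}. -/
theorem norm_afeSum_sub_linSum_le {t : ℝ} (ht : 101 ≤ t) {r : ℝ} (hr : 0 ≤ r)
    (hrt : 8 * r ^ 2 ≤ t) (hL : 17 / t ≤ deriv rsTheta t) {z : ℂ} (hz : ‖z - t‖ ≤ r) :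
    ‖afeSum ⌊Real.sqrt (t / (2 * Real.pi))⌋₊ z - linSum ⌊Real.sqrt (t / (2 * Real.pi))⌋₊ t z‖ ≤
      64 * Real.sqrt (Real.sqrt t) * Real.exp (deriv rsTheta t * r) * r ^ 2 / t := by
  have hrt' : r ≤ t / 10 := by nlinarith
  have hA4 := four_le_sqrt_div ht
  have hA2 := sqrt_div_sq (by linarith : 0 ≤ t)
  have hLl := abs_deriv_rsTheta_sub_log_le (t := t) (by linarith)
  have hlog : Real.log (t / (2 * Real.pi)) / 2 = Real.log (Real.sqrt (t / (2 * Real.pi))) := by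
    rw [Real.log_sqrt (by positivity)]
  rw [hlog] at hLl
  have hpi := Real.pi_gt_three
  have hAt : Real.sqrt (t / (2 * Real.pi)) ≤ Real.sqrt t :=
    Real.sqrt_le_sqrt (div_le_self (by linarith) (by linarith))
  set A := Real.sqrt (t / (2 * Real.pi)) with hA
  set L := deriv rsTheta t with hLd
  have hE := norm_rsThetaC_sub_le (t := t) (z := z) (by linarith) (by linarith)
  set E := rsThetaC z - rsTheta t - L * (z - t) with hEd
  have hE1 : ‖E‖ ≤ 8 * r ^ 2 / t := by
    refine hE.trans ?_
    calc 8 / t * ‖z - t‖ ^ 2 ≤ 8 / t * r ^ 2 := by gcongr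
      _ = _ := by ring
  have hE2 : ‖E‖ ≤ 1 := hE1.trans (by rw [div_le_one (by linarith)]; exact hrt)
  have hT : rsThetaC z = E + rsTheta t + L * (z - t) := by rw [hEd]; ring
  set N := ⌊A⌋₊ with hN
  have hNA : (N : ℝ) ≤ A := Nat.floor_le (by linarith)
  have hzi : |z.im| ≤ r := by
    have := Complex.abs_im_le_norm (z - t)
    rw [Complex.sub_im, Complex.ofReal_im, sub_zero] at this
    exact this.trans hz
  have hterm : ∀ n ∈ Finset.Icc 1 N,
      ‖(Complex.exp (Complex.I * rsThetaC z) * (n : ℂ) ^ (-(1 / 2 + Complex.I * z)) +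
        Complex.exp (-(Complex.I * rsThetaC z)) * (n : ℂ) ^ (-(1 / 2 - Complex.I * z))) -
      ((1 / Real.sqrt n : ℝ) : ℂ) *
        (Complex.exp (Complex.I * ((rsTheta t - t * Real.log n : ℝ) +
          (L - Real.log n : ℝ) * (z - t))) +
        Complex.exp (-(Complex.I * ((rsTheta t - t * Real.log n : ℝ) +
          (L - Real.log n : ℝ) * (z - t)))))‖ ≤
      1 / Real.sqrt n * (4 * Real.exp (L * r) * (8 * r ^ 2 / t)) := by
    intro n hn
    obtain ⟨hn1, hnN⟩ := Finset.mem_Icc.1 hn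
    have hn1' : (1 : ℝ) ≤ n := by exact_mod_cast hn1
    have hnN' : (n : ℝ) ≤ A := le_trans (by exact_mod_cast hnN) hNA
    have hn0 : n ≠ 0 := by omega
    have hln0 : 0 ≤ Real.log n := Real.log_nonneg hn1'
    have hlnA : Real.log n ≤ Real.log A := Real.log_le_log (by linarith) hnN'
    -- Since log n ≤ log A ≤ L + 17/t, the frequency is at least -17/t, hence at least -L.
    have hlam : |L - Real.log n| ≤ L := by
      rw [abs_le] at hLl ⊢
      constructor <;> linarith
    have hL0 : 0 ≤ L := (abs_nonneg _).trans hlam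
    set p : ℂ := Complex.I * ((rsTheta t - t * Real.log n : ℝ) + (L - Real.log n : ℝ) * (z - t))
      with hp
    have hpre : p.re = -((L - Real.log n) * z.im) := by
      rw [hp, Complex.I_mul_re, Complex.add_im, Complex.ofReal_im, Complex.im_ofReal_mul]
      simp
    have hpn : ‖p.re‖ ≤ L * r := by
      rw [hpre, norm_neg, Real.norm_eq_abs, abs_mul]
      gcongr
    have e1 : Complex.exp (Complex.I * rsThetaC z) * (n : ℂ) ^ (-(1 / 2 + Complex.I * z)) =
        ((1 / Real.sqrt n : ℝ) : ℂ) * Complex.exp (p + Complex.I * E) := by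
      rw [natCast_cpow_neg_half hn0, mul_left_comm, ← Complex.exp_add]
      congr 2
      rw [hT, hp]; push_cast; ring
    have e2 : Complex.exp (-(Complex.I * rsThetaC z)) * (n : ℂ) ^ (-(1 / 2 - Complex.I * z)) =
        ((1 / Real.sqrt n : ℝ) : ℂ) * Complex.exp (-p + -(Complex.I * E)) := by
      rw [sub_eq_add_neg (1 / 2 : ℂ), natCast_cpow_neg_half hn0, mul_left_comm, ← Complex.exp_add]
      congr 2
      rw [hT, hp]; push_cast; ring
    rw [e1, e2, ← mul_add, ← mul_sub, norm_mul, Complex.norm_real,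
      Real.norm_of_nonneg (by positivity)]
    refine mul_le_mul_of_nonneg_left ?_ (by positivity)
    rw [add_sub_add_comm]
    have hIE : ‖Complex.I * E‖ = ‖E‖ := by rw [norm_mul, Complex.norm_I, one_mul]
    have b1 := norm_exp_add_sub_exp_le (p := p) (e := Complex.I * E) (by rw [hIE]; exact hE2)
    have b2 := norm_exp_add_sub_exp_le (p := -p) (e := -(Complex.I * E))
      (by rw [norm_neg, hIE]; exact hE2)
    rw [norm_neg, Complex.neg_re, norm_neg] at b2
    rw [hIE] at b1 b2
    have hexp : Real.exp ‖p.re‖ ≤ Real.exp (L * r) := Real.exp_le_exp.2 hpn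
    calc _ ≤ _ := norm_add_le _ _
      _ ≤ 2 * Real.exp ‖p.re‖ * ‖E‖ + 2 * Real.exp ‖p.re‖ * ‖E‖ := add_le_add b1 b2
      _ = 4 * Real.exp ‖p.re‖ * ‖E‖ := by ring
      _ ≤ 4 * Real.exp (L * r) * (8 * r ^ 2 / t) := by gcongr
  rw [afeSum, linSum, ← Finset.sum_sub_distrib]
  refine (norm_sum_le_of_le _ hterm).trans ?_
  rw [← Finset.sum_mul]
  have hs := sum_one_div_sqrt_le N
  have hNs : Real.sqrt N ≤ Real.sqrt (Real.sqrt t) := Real.sqrt_le_sqrt (hNA.trans hAt)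
  calc _ ≤ 2 * Real.sqrt (Real.sqrt t) * (4 * Real.exp (L * r) * (8 * r ^ 2 / t)) := by
        gcongr
        linarith
    _ = _ := by ring

/-! ### Iterated derivatives and Cauchy estimates -/

theorem differentiableOn_iteratedDeriv {f : ℂ → ℂ} {U : Set ℂ} (hU : IsOpen U)
    (hf : DifferentiableOn ℂ f U) (k : ℕ) : DifferentiableOn ℂ (iteratedDeriv k f) U := by
  induction k with
  | zero => rwa [iteratedDeriv_zero]
  | succ k ih => rw [iteratedDeriv_succ]; exact ih.deriv hU

theorem iteratedDeriv_comp_ofReal {f : ℂ → ℂ} {U : Set ℂ} (hU : IsOpen U)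
    (hf : DifferentiableOn ℂ f U) (k : ℕ) {x : ℝ} (hx : (x : ℂ) ∈ U) :
    iteratedDeriv k (fun y : ℝ => f y) x = iteratedDeriv k f x := by
  induction k generalizing x with
  | zero => simp
  | succ k ih =>
    rw [iteratedDeriv_succ, iteratedDeriv_succ]
    have h1 : iteratedDeriv k (fun y : ℝ => f y) =ᶠ[𝓝 x] fun y : ℝ => iteratedDeriv k f y := by
      filter_upwards [Complex.continuous_ofReal.continuousAt.eventually (hU.mem_nhds hx)] with y hy
      exact ih hy
    rw [h1.deriv_eq]
    exact (((differentiableOn_iteratedDeriv hU hf k).differentiableAt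
      (hU.mem_nhds hx)).hasDerivAt.comp_ofReal).deriv

theorem iteratedDeriv_cexp_linear (a b : ℂ) (k : ℕ) :
    iteratedDeriv k (fun z : ℂ => Complex.exp (a + b * z)) =
      fun z => b ^ k * Complex.exp (a + b * z) := by
  induction k with
  | zero => simp
  | succ k ih =>
    rw [iteratedDeriv_succ, ih]
    funext z
    have h := ((((hasDerivAt_id z).const_mul b).const_add a).cexp.const_mul (b ^ k)).deriv
    simp only [id_eq, mul_one] at h
    rw [h]; ring

theorem pow_mul_exp_add_pow_mul_exp (k : ℕ) (x l : ℝ) :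
    (Complex.I * l) ^ k * Complex.exp (Complex.I * x) +
      (-(Complex.I * l)) ^ k * Complex.exp (-(Complex.I * x)) =
      ((2 * (l ^ k * Real.cos (x + k * (Real.pi / 2))) : ℝ) : ℂ) := by
  have hI : Complex.I ^ k = Complex.exp (k * ((Real.pi / 2 : ℂ) * Complex.I)) := by
    rw [Complex.exp_nat_mul, Complex.exp_pi_div_two_mul_I]
  have hI' : (-Complex.I) ^ k = Complex.exp (k * -((Real.pi / 2 : ℂ) * Complex.I)) := by
    rw [Complex.exp_nat_mul, Complex.exp_neg, Complex.exp_pi_div_two_mul_I, Complex.inv_I]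
  rw [← neg_mul, mul_pow, mul_pow, hI, hI']
  push_cast
  rw [Complex.cos, show (x + k * (Real.pi / 2) : ℂ) * Complex.I =
    k * ((Real.pi / 2 : ℂ) * Complex.I) + Complex.I * x by ring,
    show -(x + k * (Real.pi / 2) : ℂ) * Complex.I =
    k * -((Real.pi / 2 : ℂ) * Complex.I) + -(Complex.I * x) by ring, Complex.exp_add,
    Complex.exp_add]
  ring

/-- Differentiating exp(±iλz) k times gives (±iλ)^k, and i^k = e^{ikπ/2} produces the shift kπ/2 in
the cosine. -/
theorem iteratedDeriv_linSum (k : ℕ) (t : ℝ) :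
    iteratedDeriv k (linSum ⌊Real.sqrt (t / (2 * Real.pi))⌋₊ t) t = (afeMain k t : ℂ) := by
  have hexp : ∀ a b : ℂ, ContDiff ℂ k fun z : ℂ => Complex.exp (a + b * z) := fun a b => by fun_prop
  have hfun : linSum ⌊Real.sqrt (t / (2 * Real.pi))⌋₊ t = fun z =>
      ∑ n ∈ Finset.Icc 1 ⌊Real.sqrt (t / (2 * Real.pi))⌋₊, ((1 / Real.sqrt n : ℝ) : ℂ) *
        (Complex.exp (Complex.I * ((rsTheta t - t * Real.log n : ℝ) -
            (deriv rsTheta t - Real.log n : ℝ) * t) +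
            Complex.I * (deriv rsTheta t - Real.log n : ℝ) * z) +
          Complex.exp (-(Complex.I * ((rsTheta t - t * Real.log n : ℝ) -
            (deriv rsTheta t - Real.log n : ℝ) * t)) +
            -(Complex.I * (deriv rsTheta t - Real.log n : ℝ)) * z)) := by
    funext z
    refine Finset.sum_congr rfl fun n _ => ?_
    congr 3 <;> ring
  rw [hfun, iteratedDeriv_fun_sum fun n _ => ContDiff.contDiffAt
    (contDiff_const.mul ((hexp _ _).add (hexp _ _))), afeMain, Finset.mul_sum, Complex.ofReal_sum]
  refine Finset.sum_congr rfl fun n _ => ?_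
  rw [iteratedDeriv_const_mul_field, iteratedDeriv_fun_add (hexp _ _).contDiffAt
    (hexp _ _).contDiffAt, iteratedDeriv_cexp_linear, iteratedDeriv_cexp_linear]
  have h := pow_mul_exp_add_pow_mul_exp k (rsTheta t - t * Real.log n) (deriv rsTheta t - Real.log n)
  rw [show 2 * (1 / Real.sqrt n * (deriv rsTheta t - Real.log n) ^ k *
    Real.cos (rsTheta t - t * Real.log n + k * (Real.pi / 2))) = 1 / Real.sqrt n *
    (2 * ((deriv rsTheta t - Real.log n) ^ k *
      Real.cos (rsTheta t - t * Real.log n + k * (Real.pi / 2)))) by ring, Complex.ofReal_mul, ← h]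
  congr 4
  · ring_nf
  · ring_nf

theorem differentiableOn_hardyC : DifferentiableOn ℂ hardyC {z : ℂ | 0 < z.re} := by
  intro z hz
  obtain ⟨-, h1, -, -⟩ := half_add_ne (show 0 < z.re from hz)
  refine DifferentiableAt.differentiableWithinAt (DifferentiableAt.mul ?_ ?_)
  · exact ((hasDerivAt_rsThetaC hz).differentiableAt.const_mul Complex.I).cexp
  · exact (differentiableAt_riemannZeta h1).comp z (by fun_prop)

theorem differentiableOn_afeSum (N : ℕ) : DifferentiableOn ℂ (afeSum N) {z : ℂ | 0 < z.re} := by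
  intro z hz
  refine DifferentiableAt.differentiableWithinAt (DifferentiableAt.fun_sum fun n hn => ?_)
  have hn0 : (n : ℂ) ≠ 0 := by
    have := (Finset.mem_Icc.1 hn).1
    exact_mod_cast (by omega : n ≠ 0)
  have hT : DifferentiableAt ℂ rsThetaC z := (hasDerivAt_rsThetaC hz).differentiableAt
  refine DifferentiableAt.add ?_ ?_
  · exact (hT.const_mul Complex.I).cexp.mul (DifferentiableAt.const_cpow (by fun_prop) (Or.inl hn0))
  · exact (hT.const_mul Complex.I).fun_neg.cexp.mul
      (DifferentiableAt.const_cpow (by fun_prop) (Or.inl hn0))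

theorem differentiable_linSum (N : ℕ) (t : ℝ) : Differentiable ℂ (linSum N t) := by
  unfold linSum
  fun_prop

theorem afeError_eq {t : ℝ} (ht : 0 < t) (k : ℕ) {N : ℕ}
    (hN : N = ⌊Real.sqrt (t / (2 * Real.pi))⌋₊) :
    afeError k t = iteratedDeriv k (hardyC - afeSum N) t +
      iteratedDeriv k (afeSum N - linSum N t) t := by
  have hmem : {z : ℂ | 0 < z.re} ∈ 𝓝 (t : ℂ) := isOpen_re_pos.mem_nhds (by simpa)
  have c1 : ContDiffAt ℂ k hardyC t :=
    (differentiableOn_hardyC.contDiffOn isOpen_re_pos).contDiffAt hmem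
  have c2 : ContDiffAt ℂ k (afeSum N) t :=
    ((differentiableOn_afeSum N).contDiffOn isOpen_re_pos).contDiffAt hmem
  have c3 : ContDiffAt ℂ k (linSum N t) t := (differentiable_linSum N t).contDiff.contDiffAt
  have h : hardyZ = fun x : ℝ => hardyC x := funext hardyZ_eq
  rw [iteratedDeriv_sub c1 c2, iteratedDeriv_sub c2 c3, afeError, h,
    iteratedDeriv_comp_ofReal isOpen_re_pos differentiableOn_hardyC k (by simpa),
    ← iteratedDeriv_linSum, ← hN]
  ring

theorem norm_iteratedDeriv_le_of_forall_norm_sub_le {f : ℂ → ℂ}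
    (hf : DifferentiableOn ℂ f {z : ℂ | 0 < z.re}) {t r M : ℝ} (hr : 0 < r) (hrt : r < t)
    (hM : ∀ z : ℂ, ‖z - t‖ ≤ r → ‖f z‖ ≤ M) (k : ℕ) :
    ‖iteratedDeriv k f t‖ ≤ k.factorial * M / r ^ k := by
  refine Complex.norm_iteratedDeriv_le_of_forall_mem_sphere_norm_le k hr
    (DifferentiableOn.diffContOnCl (hf.mono fun z hz => ?_)) fun z hz => hM z ?_
  · have hz' := Metric.closure_ball_subset_closedBall hz
    rw [mem_closedBall_iff_norm] at hz'
    have := (Complex.abs_re_le_norm (z - t)).trans hz'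
    rw [Complex.sub_re, Complex.ofReal_re, abs_le] at this
    show 0 < z.re
    linarith
  · exact (mem_sphere_iff_norm.1 hz).le

/-- Stirling's upper bound with k in place of √k, by induction from (1 + 1/k)^{k+1} ≥ e. -/
theorem factorial_mul_exp_le {k : ℕ} (hk : 1 ≤ k) :
    (k.factorial : ℝ) * Real.exp k ≤ Real.exp 1 * k * (k : ℝ) ^ k := by
  induction k, hk using Nat.le_induction with
  | base => simp
  | succ k hk ih =>
    have hk0 : (0 : ℝ) < k := by exact_mod_cast hk
    have h1 : Real.exp 1 * (k : ℝ) ^ (k + 1) ≤ ((k : ℝ) + 1) ^ (k + 1) := by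
      have h2 : Real.exp (1 / ((k : ℝ) + 1)) * k ≤ (k : ℝ) + 1 := by
        have h3 := Real.add_one_le_exp (-(1 / ((k : ℝ) + 1)))
        have h4 : -(1 / ((k : ℝ) + 1)) + 1 = k / (k + 1) := by field_simp; ring
        rw [h4, Real.exp_neg, div_le_iff₀ (by positivity), inv_mul_eq_div,
          le_div_iff₀ (Real.exp_pos _)] at h3
        linarith
      have h5 := pow_le_pow_left₀ (by positivity) h2 (k + 1)
      rw [mul_pow, ← Real.exp_nat_mul] at h5
      have h6 : ((k + 1 : ℕ) : ℝ) * (1 / ((k : ℝ) + 1)) = 1 := by push_cast; field_simp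
      rwa [h6] at h5
    rw [Nat.factorial_succ]
    push_cast
    rw [Real.exp_add]
    calc ((k : ℝ) + 1) * k.factorial * (Real.exp k * Real.exp 1) =
        ((k : ℝ) + 1) * Real.exp 1 * (k.factorial * Real.exp k) := by ring
      _ ≤ ((k : ℝ) + 1) * Real.exp 1 * (Real.exp 1 * k * (k : ℝ) ^ k) := by gcongr
      _ = Real.exp 1 * ((k : ℝ) + 1) * (Real.exp 1 * (k : ℝ) ^ (k + 1)) := by ring
      _ ≤ _ := by gcongr

theorem factorial_le_self_pow (k : ℕ) : (k.factorial : ℝ) ≤ (k : ℝ) ^ k := by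
  exact_mod_cast Nat.factorial_le_pow k

/-! ### Choice of the radii and the final bounds -/

theorem deriv_rsTheta_le {t : ℝ} (ht : 101 ≤ t) : deriv rsTheta t ≤ Real.log t / 2 := by
  have h := (abs_le.1 (abs_deriv_rsTheta_sub_log_le (t := t) (by linarith))).2
  have h1 : 1 ≤ Real.log (2 * Real.pi) := by
    rw [Real.le_log_iff_exp_le (by positivity)]
    linarith [Real.exp_one_lt_d9, Real.pi_gt_three]
  have h2 : 17 / t ≤ 17 / 101 := by gcongr
  rw [Real.log_div (by positivity) (by positivity)] at h
  linarith

theorem eventually_le_deriv_rsTheta : ∀ᶠ t in atTop, Real.log t / 4 ≤ deriv rsTheta t := by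
  filter_upwards [eventually_ge_atTop 101,
    Real.tendsto_log_atTop.eventually_ge_atTop (2 * Real.log (2 * Real.pi) + 1)] with t ht hl
  have h := (abs_le.1 (abs_deriv_rsTheta_sub_log_le (t := t) (by linarith))).1
  have h2 : 17 / t ≤ 17 / 101 := by gcongr
  rw [Real.log_div (by positivity) (by positivity)] at h
  linarith

theorem eventually_mul_log_pow_le (c : ℝ) (n : ℕ) {a : ℝ} (ha : 0 < a) :
    ∀ᶠ t in atTop, c * Real.log t ^ n ≤ t ^ a := by
  have h := (isLittleO_log_rpow_rpow_atTop (n : ℝ) ha).bound (c := 1 / (|c| + 1)) (by positivity)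
  filter_upwards [h, eventually_ge_atTop 1] with t ht h1
  have hl := Real.log_nonneg h1
  rw [Real.rpow_natCast, Real.norm_of_nonneg (by positivity), Real.norm_of_nonneg (by positivity),
    one_div_mul_eq_div, le_div_iff₀ (by positivity)] at ht
  have : c ≤ |c| + 1 := by linarith [le_abs_self c]
  calc c * Real.log t ^ n ≤ (|c| + 1) * Real.log t ^ n := by gcongr
    _ ≤ t ^ a := by linarith

/-- Cauchy's estimate with r = βk/L. The range k ≤ 3L² keeps r = O(log t), well inside the disc
where the crude bound holds. -/
theorem norm_iteratedDeriv_hardyC_sub_afeSum_le : ∀ᶠ t : ℝ in atTop, ∀ k : ℕ,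
    deriv rsTheta t / 8 ≤ k → (k : ℝ) ≤ 3 * deriv rsTheta t ^ 2 →
    ‖iteratedDeriv k (hardyC - afeSum ⌊Real.sqrt (t / (2 * Real.pi))⌋₊) t‖ ≤
      2 * Real.exp 26 * t ^ (-(1 / 2) : ℝ) * deriv rsTheta t ^ k := by
  -- In β^k = e^k · e^{80k} the first factor absorbs k. From k ≥ L/8 ≥ (log t)/32, the second is at
  -- least t^{5/2}, which turns t² into t^{-1/2}.
  set β : ℝ := Real.exp 81 with hβ
  filter_upwards [eventually_ge_atTop 101, eventually_le_deriv_rsTheta,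
    Real.tendsto_log_atTop.eventually_ge_atTop (4 * β), eventually_mul_log_pow_le (9 * β ^ 2) 2
      one_pos] with t ht hL1 hlog h9 k hk1 hk2
  have hL2 := deriv_rsTheta_le ht
  set L := deriv rsTheta t with hL
  rw [Real.rpow_one] at h9
  have hβ0 : 0 < β := Real.exp_pos _
  have hβ1 : 1 ≤ β := Real.one_le_exp (by norm_num)
  have hβL : β ≤ L := by linarith
  have hL0 : 0 < L := by linarith
  have ht0 : 0 < t := by linarith
  have hk0' : (0 : ℝ) < k := by linarith
  have hk0 : 1 ≤ k := by exact_mod_cast hk0'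
  set r := β * k / L with hr
  have hr0 : 0 < r := by positivity
  have hr3 : r ≤ 3 * β * L := by
    rw [hr, div_le_iff₀ hL0]
    nlinarith
  have hrt : r ^ 2 ≤ t := by
    calc r ^ 2 ≤ (3 * β * L) ^ 2 := by gcongr
      _ = 9 * β ^ 2 * L ^ 2 := by ring
      _ ≤ 9 * β ^ 2 * Real.log t ^ 2 := by gcongr; linarith
      _ ≤ t := h9
  have hrt' : r < t := by nlinarith
  have hC := norm_iteratedDeriv_le_of_forall_norm_sub_le
    (differentiableOn_hardyC.sub (differentiableOn_afeSum ⌊Real.sqrt (t / (2 * Real.pi))⌋₊))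
    hr0 hrt' (fun z hz => norm_hardyC_sub_afeSum_le_mul_two_rpow ht hr0.le hrt hz) k
  refine hC.trans ?_
  have hfac := factorial_mul_exp_le hk0
  have hrk : r ≤ k := by
    rw [hr, div_le_iff₀ hL0]; nlinarith
  have h2r : (2 : ℝ) ^ r ≤ Real.exp k := by
    rw [Real.rpow_def_of_pos two_pos]
    refine Real.exp_le_exp.2 ?_
    have := Real.log_two_lt_d9
    have := Real.log_pos one_lt_two
    nlinarith
  have hkt : (k : ℝ) * t ^ 2 ≤ t ^ (-(1 / 2) : ℝ) * β ^ k := by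
    have e1 : (k : ℝ) ≤ Real.exp k := by linarith [Real.add_one_le_exp (k : ℝ)]
    have e2 : β ^ k = Real.exp k * Real.exp (80 * k) := by
      rw [hβ, ← Real.exp_nat_mul, ← Real.exp_add]; ring_nf
    have e3 : t ^ 2 ≤ t ^ (-(1 / 2) : ℝ) * Real.exp (80 * k) := by
      have e4 : Real.exp (5 / 2 * Real.log t) ≤ Real.exp (80 * k) :=
        Real.exp_le_exp.2 (by linarith)
      calc t ^ 2 = t ^ (-(1 / 2) : ℝ) * t ^ (5 / 2 : ℝ) := by
            rw [← Real.rpow_add ht0, ← Real.rpow_natCast]; norm_num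
        _ = t ^ (-(1 / 2) : ℝ) * Real.exp (5 / 2 * Real.log t) := by
            rw [Real.rpow_def_of_pos ht0 (5 / 2), mul_comm (5 / 2 : ℝ)]
        _ ≤ _ := by gcongr
    calc (k : ℝ) * t ^ 2 ≤ Real.exp k * (t ^ (-(1 / 2) : ℝ) * Real.exp (80 * k)) := by gcongr
      _ = _ := by rw [e2]; ring
  rw [div_le_iff₀ (by positivity), hr, div_pow, mul_pow]
  have e26 : Real.exp 26 = Real.exp 25 * Real.exp 1 := by rw [← Real.exp_add]; norm_num
  calc (k.factorial : ℝ) * (2 * Real.exp 25 * t ^ 2 * 2 ^ r)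
      ≤ k.factorial * (2 * Real.exp 25 * t ^ 2 * Real.exp k) := by gcongr
    _ = 2 * Real.exp 25 * t ^ 2 * (k.factorial * Real.exp k) := by ring
    _ ≤ 2 * Real.exp 25 * t ^ 2 * (Real.exp 1 * k * (k : ℝ) ^ k) := by gcongr
    _ = 2 * Real.exp 26 * (k * t ^ 2) * (k : ℝ) ^ k := by rw [e26]; ring
    _ ≤ 2 * Real.exp 26 * (t ^ (-(1 / 2) : ℝ) * β ^ k) * (k : ℝ) ^ k := by gcongr
    _ = _ := by field_simp

/-- On the circle of radius 1/8 the approximate functional equation has error o(1), and k! 8^k ≤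
(8k)^k ≤ L^k. -/
theorem norm_iteratedDeriv_hardyC_sub_afeSum_le_of_small {ε : ℝ} (hε : 0 < ε) :
    ∀ᶠ t : ℝ in atTop, ∀ k : ℕ, (k : ℝ) ≤ deriv rsTheta t / 8 →
    ‖iteratedDeriv k (hardyC - afeSum ⌊Real.sqrt (t / (2 * Real.pi))⌋₊) t‖ ≤
      ε * deriv rsTheta t ^ k := by
  have hA : Tendsto (fun t : ℝ => Real.sqrt (t / (2 * Real.pi))) atTop atTop :=
    Real.tendsto_sqrt_atTop.comp (tendsto_id.atTop_div_const (by positivity))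
  have hM : Tendsto (fun t : ℝ => 2 * Real.exp 1 * thetaConst *
      Real.sqrt (t / (2 * Real.pi)) ^ (-(1 / 4) : ℝ)) atTop (𝓝 0) := by
    have := ((tendsto_rpow_neg_atTop (show (0 : ℝ) < 1 / 4 by norm_num)).comp hA).const_mul
      (2 * Real.exp 1 * thetaConst)
    simpa [Function.comp_def] using this
  filter_upwards [eventually_ge_atTop 101, hM.eventually_le_const hε] with t ht hMt k hk
  have hC := norm_iteratedDeriv_le_of_forall_norm_sub_le
    (differentiableOn_hardyC.sub (differentiableOn_afeSum ⌊Real.sqrt (t / (2 * Real.pi))⌋₊))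
    (t := t) (r := 1 / 8) (by norm_num) (by linarith)
    (fun z hz => norm_hardyC_sub_afeSum_le ht hz) k
  refine hC.trans ?_
  have h1 : (k.factorial : ℝ) * 8 ^ k ≤ deriv rsTheta t ^ k := by
    calc (k.factorial : ℝ) * 8 ^ k ≤ (k : ℝ) ^ k * 8 ^ k := by
          gcongr; exact factorial_le_self_pow k
      _ = ((k : ℝ) * 8) ^ k := (mul_pow _ _ _).symm
      _ ≤ _ := by gcongr; linarith
  have hp : (1 / 8 : ℝ) ^ k = (8 ^ k)⁻¹ := by rw [one_div, inv_pow]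
  rw [hp, div_inv_eq_mul]
  calc _ ≤ (k.factorial : ℝ) * ε * 8 ^ k := by gcongr
    _ = ε * (k.factorial * 8 ^ k) := by ring
    _ ≤ _ := by gcongr

theorem sqrt_sqrt_div_eq {t : ℝ} (ht : 0 < t) : Real.sqrt (Real.sqrt t) / t = t ^ (-(3 / 4) : ℝ) := by
  rw [Real.sqrt_eq_rpow, Real.sqrt_eq_rpow, ← Real.rpow_mul ht.le, ← Real.rpow_sub_one ht.ne']
  norm_num

theorem norm_iteratedDeriv_afeSum_sub_linSum_le : ∀ᶠ t : ℝ in atTop, ∀ k : ℕ,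
    deriv rsTheta t ≤ k → (k : ℝ) ≤ 3 * deriv rsTheta t ^ 2 →
    ‖iteratedDeriv k (afeSum ⌊Real.sqrt (t / (2 * Real.pi))⌋₊ -
      linSum ⌊Real.sqrt (t / (2 * Real.pi))⌋₊ t) t‖ ≤
      64 * Real.exp 1 * 27 * t ^ (-(1 / 2) : ℝ) * deriv rsTheta t ^ k := by
  filter_upwards [eventually_ge_atTop 101, eventually_le_deriv_rsTheta,
    Real.tendsto_log_atTop.eventually_ge_atTop 4, eventually_mul_log_pow_le 72 2
      one_pos, eventually_mul_log_pow_le 1 4 (show (0 : ℝ) < 1 / 4 by norm_num)]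
    with t ht hL1 hlog h72 h4 k hk1 hk2
  have hL2 := deriv_rsTheta_le ht
  set L := deriv rsTheta t with hL
  rw [Real.rpow_one] at h72
  have hL0 : 1 ≤ L := by linarith
  have hLp : 0 < L := by linarith
  have ht0 : 0 < t := by linarith
  have hk0' : (0 : ℝ) < k := by linarith
  have hk0 : 1 ≤ k := by exact_mod_cast hk0'
  -- This radius minimizes e^{Lr}/r^k; then e^{Lr} = e^k is removed by `factorial_mul_exp_le`,
  -- leaving k r² = O(L⁴) = O(t^{1/4}) to multiply t^{-3/4} L^k.
  set r := k / L with hr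
  have hr0 : 0 < r := by positivity
  have hr3 : r ≤ 3 * L := by
    rw [hr, div_le_iff₀ hLp]
    nlinarith
  have hrt : 8 * r ^ 2 ≤ t := by
    calc 8 * r ^ 2 ≤ 8 * (3 * L) ^ 2 := by gcongr
      _ = 72 * L ^ 2 := by ring
      _ ≤ 72 * Real.log t ^ 2 := by gcongr; linarith
      _ ≤ t := h72
  have hrt' : r < t := by nlinarith
  have h17 : 17 / t ≤ L := by
    rw [div_le_iff₀ ht0]; nlinarith
  have hC := norm_iteratedDeriv_le_of_forall_norm_sub_le
    ((differentiableOn_afeSum ⌊Real.sqrt (t / (2 * Real.pi))⌋₊).sub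
      (differentiable_linSum ⌊Real.sqrt (t / (2 * Real.pi))⌋₊ t).differentiableOn)
    hr0 hrt' (fun z hz => norm_afeSum_sub_linSum_le ht hr0.le hrt h17 hz) k
  refine hC.trans ?_
  have hLr : deriv rsTheta t * r = k := by
    rw [hr, ← hL]; field_simp
  rw [hLr]
  have hfac := factorial_mul_exp_le hk0
  have hkr : (k : ℝ) * r ^ 2 ≤ 27 * t ^ (1 / 4 : ℝ) := by
    calc (k : ℝ) * r ^ 2 ≤ 3 * L ^ 2 * (3 * L) ^ 2 := by gcongr
      _ = 27 * (1 * L ^ 4) := by ring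
      _ ≤ 27 * (1 * Real.log t ^ 4) := by gcongr; linarith
      _ ≤ _ := by gcongr
  have hq : t ^ (1 / 4 : ℝ) * (Real.sqrt (Real.sqrt t) / t) = t ^ (-(1 / 2) : ℝ) := by
    rw [sqrt_sqrt_div_eq ht0, ← Real.rpow_add ht0]; norm_num
  have hrpow : (k : ℝ) ^ k = L ^ k * r ^ k := by
    rw [← mul_pow, hr]; congr 1; field_simp
  rw [div_le_iff₀ (by positivity)]
  calc (k.factorial : ℝ) * (64 * Real.sqrt (Real.sqrt t) * Real.exp k * r ^ 2 / t)
      = 64 * (Real.sqrt (Real.sqrt t) / t) * r ^ 2 * (k.factorial * Real.exp k) := by ring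
    _ ≤ 64 * (Real.sqrt (Real.sqrt t) / t) * r ^ 2 * (Real.exp 1 * k * (k : ℝ) ^ k) := by gcongr
    _ = 64 * Real.exp 1 * (Real.sqrt (Real.sqrt t) / t) * (k * r ^ 2) * (k : ℝ) ^ k := by ring
    _ ≤ 64 * Real.exp 1 * (Real.sqrt (Real.sqrt t) / t) * (27 * t ^ (1 / 4 : ℝ)) * (k : ℝ) ^ k := by
        gcongr
    _ = 64 * Real.exp 1 * 27 * (t ^ (1 / 4 : ℝ) * (Real.sqrt (Real.sqrt t) / t)) *
        (k : ℝ) ^ k := by ring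
    _ = _ := by rw [hq, hrpow]; ring

/-- Radius 1 suffices: e^L ≤ t^{1/2} leaves t^{-1/4}, and k! ≤ k^k ≤ L^k. -/
theorem norm_iteratedDeriv_afeSum_sub_linSum_le_of_small {ε : ℝ} (hε : 0 < ε) :
    ∀ᶠ t : ℝ in atTop, ∀ k : ℕ, (k : ℝ) ≤ deriv rsTheta t →
    ‖iteratedDeriv k (afeSum ⌊Real.sqrt (t / (2 * Real.pi))⌋₊ -
      linSum ⌊Real.sqrt (t / (2 * Real.pi))⌋₊ t) t‖ ≤ ε * deriv rsTheta t ^ k := by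
  have hM : Tendsto (fun t : ℝ => 64 * t ^ (-(1 / 4) : ℝ)) atTop (𝓝 0) := by
    simpa using (tendsto_rpow_neg_atTop (show (0 : ℝ) < 1 / 4 by norm_num)).const_mul 64
  filter_upwards [eventually_ge_atTop 101, eventually_le_deriv_rsTheta,
    Real.tendsto_log_atTop.eventually_ge_atTop 4, hM.eventually_le_const hε] with t ht hL1 hlog hMt k hk
  have hL2 := deriv_rsTheta_le ht
  have ht0 : 0 < t := by linarith
  have h17 : 17 / t ≤ deriv rsTheta t := by
    rw [div_le_iff₀ ht0]; nlinarith
  have hC := norm_iteratedDeriv_le_of_forall_norm_sub_le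
    ((differentiableOn_afeSum ⌊Real.sqrt (t / (2 * Real.pi))⌋₊).sub
      (differentiable_linSum ⌊Real.sqrt (t / (2 * Real.pi))⌋₊ t).differentiableOn)
    one_pos (by linarith) (fun z hz => norm_afeSum_sub_linSum_le ht zero_le_one (by linarith) h17 hz) k
  refine hC.trans ?_
  have hexp : Real.exp (deriv rsTheta t) ≤ t ^ (1 / 2 : ℝ) := by
    rw [Real.rpow_def_of_pos ht0]
    exact Real.exp_le_exp.2 (by linarith)
  have hq : t ^ (1 / 2 : ℝ) * (Real.sqrt (Real.sqrt t) / t) = t ^ (-(1 / 4) : ℝ) := by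
    rw [sqrt_sqrt_div_eq ht0, ← Real.rpow_add ht0]; norm_num
  have hfac : (k.factorial : ℝ) ≤ deriv rsTheta t ^ k :=
    (factorial_le_self_pow k).trans (by gcongr)
  have hL0 : 0 < deriv rsTheta t := by linarith
  rw [one_pow, one_pow, div_one, mul_one, mul_one]
  calc (k.factorial : ℝ) * (64 * Real.sqrt (Real.sqrt t) * Real.exp (deriv rsTheta t) / t)
      = 64 * (Real.exp (deriv rsTheta t) * (Real.sqrt (Real.sqrt t) / t)) * k.factorial := by ring
    _ ≤ 64 * (t ^ (1 / 2 : ℝ) * (Real.sqrt (Real.sqrt t) / t)) * deriv rsTheta t ^ k := by gcongr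
    _ = 64 * t ^ (-(1 / 4) : ℝ) * deriv rsTheta t ^ k := by rw [hq]
    _ ≤ _ := by gcongr

theorem norm_afeError_le : ∃ C : ℝ, 0 ≤ C ∧ ∀ᶠ t : ℝ in atTop, ∀ k : ℕ,
    deriv rsTheta t ≤ k → (k : ℝ) ≤ 3 * deriv rsTheta t ^ 2 →
    ‖afeError k t‖ ≤ C * (t ^ (-(1 / 2) : ℝ) * deriv rsTheta t ^ k) := by
  refine ⟨2 * Real.exp 26 + 64 * Real.exp 1 * 27, by positivity, ?_⟩
  filter_upwards [norm_iteratedDeriv_hardyC_sub_afeSum_le, norm_iteratedDeriv_afeSum_sub_linSum_le,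
    eventually_ge_atTop 101, eventually_le_deriv_rsTheta] with t h1 h2 ht hL1 k hk1 hk2
  have hlog : 0 ≤ Real.log t := Real.log_nonneg (by linarith)
  rw [afeError_eq (by linarith) k rfl]
  refine (norm_add_le _ _).trans ((add_le_add (h1 k (by linarith) hk2) (h2 k hk1 hk2)).trans_eq ?_)
  ring

/-- Three ranges: for k ≥ L the power saving applies; for L/8 ≤ k ≤ L the large circle still handles
truncation; for k ≤ L/8 the small circle does. -/
theorem norm_afeError_le_of_small {ε : ℝ} (hε : 0 < ε) : ∀ᶠ t : ℝ in atTop, ∀ k : ℕ,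
    (k : ℝ) ≤ 3 * deriv rsTheta t ^ 2 → ‖afeError k t‖ ≤ ε * deriv rsTheta t ^ k := by
  obtain ⟨C, hC, hbig⟩ := norm_afeError_le
  have hM : ∀ K : ℝ, Tendsto (fun t : ℝ => K * t ^ (-(1 / 2) : ℝ)) atTop (𝓝 0) := fun K => by
    simpa using (tendsto_rpow_neg_atTop (show (0 : ℝ) < 1 / 2 by norm_num)).const_mul K
  filter_upwards [hbig, norm_iteratedDeriv_hardyC_sub_afeSum_le,
    norm_iteratedDeriv_hardyC_sub_afeSum_le_of_small (half_pos hε),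
    norm_iteratedDeriv_afeSum_sub_linSum_le_of_small (half_pos hε),
    (hM C).eventually_le_const hε, (hM (2 * Real.exp 26)).eventually_le_const (half_pos hε),
    eventually_ge_atTop 101, eventually_le_deriv_rsTheta] with t h1 h2 h3 h4 h5 h6 ht hL1 k hk
  have hlog : 0 ≤ Real.log t := Real.log_nonneg (by linarith)
  have hL0 : 0 ≤ deriv rsTheta t := by linarith
  rcases le_total (deriv rsTheta t) k with hkL | hkL
  · refine (h1 k hkL hk).trans ?_
    rw [← mul_assoc]
    gcongr
  · rw [afeError_eq (by linarith) k rfl]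
    have hA : ‖iteratedDeriv k (hardyC - afeSum ⌊Real.sqrt (t / (2 * Real.pi))⌋₊) t‖ ≤
        ε / 2 * deriv rsTheta t ^ k := by
      rcases le_total (deriv rsTheta t / 8) k with h8 | h8
      · refine (h2 k h8 hk).trans ?_
        gcongr
      · exact h3 k h8
    refine (norm_add_le _ _).trans ((add_le_add hA (h4 k hkL)).trans_eq ?_)
    ring

theorem theorem1 :
    (∀ c : ℝ, 1 < c → ∃ C T : ℝ, 0 < T ∧ ∀ t : ℝ, T ≤ t → ∀ k : ℕ,
      deriv rsTheta t ≤ (k : ℝ) → (k : ℝ) ≤ 3 * deriv rsTheta t ^ 2 →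
        ‖afeError k t‖ ≤ C *
          (t ^ (-(1 / 2) : ℝ) * c ^ ((k : ℝ) / deriv rsTheta t) * deriv rsTheta t ^ k +
            t ^ (-(3 / 4) : ℝ) * Real.exp ((k : ℝ) / (2 * deriv rsTheta t)) * (k : ℝ) *
              deriv rsTheta t ^ ((k : ℤ) - 1))) ∧
    (∀ c' : ℝ, c' < 3 → ∀ ε : ℝ, 0 < ε → ∃ T : ℝ, ∀ t : ℝ, T ≤ t → ∀ k : ℕ,
      (k : ℝ) ≤ c' * deriv rsTheta t ^ 2 →
        ‖afeError k t‖ ≤ ε * deriv rsTheta t ^ k) := by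
  constructor
  · intro c hc
    obtain ⟨C, hC, h⟩ := norm_afeError_le
    obtain ⟨T, hT⟩ := eventually_atTop.1 ((h.and eventually_le_deriv_rsTheta).and
      (eventually_ge_atTop 1))
    refine ⟨C, max T 1, by positivity, fun t ht k hk1 hk2 => ?_⟩
    obtain ⟨⟨h1, hL⟩, ht1⟩ := hT t ((le_max_left _ _).trans ht)
    have hL0 : 0 ≤ deriv rsTheta t := by
      have := Real.log_nonneg ht1
      linarith
    refine (h1 k hk1 hk2).trans (mul_le_mul_of_nonneg_left ?_ hC)
    -- The bound already holds without this factor, so C can be taken independent of c and the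
    -- second term of (1) is merely nonnegative.
    have h2 : 1 ≤ c ^ ((k : ℝ) / deriv rsTheta t) :=
      Real.one_le_rpow hc.le (by positivity)
    have h3 : t ^ (-(1 / 2) : ℝ) * deriv rsTheta t ^ k ≤
        t ^ (-(1 / 2) : ℝ) * c ^ ((k : ℝ) / deriv rsTheta t) * deriv rsTheta t ^ k := by
      gcongr
      exact le_mul_of_one_le_right (by positivity) h2
    have h4 : 0 ≤ t ^ (-(3 / 4) : ℝ) * Real.exp ((k : ℝ) / (2 * deriv rsTheta t)) * (k : ℝ) *
        deriv rsTheta t ^ ((k : ℤ) - 1) := by positivity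
    linarith
  · intro c' hc' ε hε
    obtain ⟨T, hT⟩ := eventually_atTop.1 (norm_afeError_le_of_small hε)
    refine ⟨T, fun t ht k hk => hT t ht k (hk.trans ?_)⟩
    gcongr
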